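/- Let $h\ge 0$ be an integer. All manifolds, maps and forms are smooth; a closed manifold is a compact Hausdorff manifold without boundary (not necessarily connected). Definitions. A generalized contact pair of type $(h,0)$ on a $(2h+2)$-dimensional manifold is a pair of one-forms $(\alpha,\beta)$ such that $d\beta=0$ and $\alpha\wedge(d\alpha)^h\wedge\beta$ is a volume form, i.e. vanishes nowhere. A contact form on a $(2h+1)$-dimensional manifold $F$ is a one-form $a$ such that $a\wedge(da)^h$ vanishes nowhere; $(F,\ker a)$, cooriented by $a$, is then a contact manifold, and a contactomorphism of it is a diffeomorphism $\varphi\colon F\to F$ with $\varphi^*a=f\,a$ for a smooth function $f>0$. The mapping torus of a diffeomorphism $\varphi\colon F\to F$ is the manifold $F_\varphi=(F\times\mathbb R)/\big((x,t)\sim(\varphi(x),t-1)\big)$, with the projection $[(x,t)]\mapsto e^{2\pi i t}$ to $S^1$. A locally conformally symplectic (lcs) form with Lee form $\theta$ is a non-degenerate two-form $\omega$ with $d\omega=\omega\wedge\theta$, where $\theta$ is a closed one-form. (1) Let $M$ be a closed $(2h+2)$-dimensional manifold with a generalized contact pair $(\alpha,\beta)$ of type $(h,0)$. Then $M$ fibers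 over the circle with fiber a closed contact manifold and with monodromy a contactomorphism. Precisely, there are a closed $(2h+1)$-dimensional manifold $F$, a locally trivial smooth fiber bundle $p\colon M\to S^1$ with fiber $F$, a diffeomorphism $\varphi\colon F\to F$, and a diffeomorphism $\Phi\colon M\to F_\varphi$ that intertwines $p$ with the projection $F_\varphi\to S^1$, such that for every $t\in\mathbb R$ the pullback of $\alpha$ under the fiber inclusion $\iota_t\colon F\to M$, $x\mapsto\Phi^{-1}([(x,t)])$, is a contact form on $F$, and $\varphi$ is a contactomorphism of $(F,\ker\iota_0^*\alpha)$. (2) Conversely, let $\varphi$ be a contactomorphism of a $(2h+1)$-dimensional manifold $F$ with a contact form. Then the mapping torus $F_\varphi$ admits a generalized contact pair $(\alpha,\beta)$ of type $(h,0)$. If $F$ is closed, then moreover $(\alpha,\beta)$ induces lcs forms on $F_\varphi$: there is $c_0\in\mathbb R$ such that for all real $c\ge c_0$ the form $d\alpha+c\,\alpha\wedge\beta$ is lcs with Lee form $c\beta$. -/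

import Mathlib

open Set Filter Topology
open scoped Manifold ContDiff

universe u

noncomputable section

namespace ContactPair

/-! ### Exterior algebra of a real vector space -/

section Wedge

variable {V : Type*} [AddCommGroup V] [Module ℝ V] [TopologicalSpace V]

/-- The wedge product of two continuous alternating forms, with the shuffle normalization
`(a ∧ b)(v₁, …, vₖ₊ₗ) = ∑ sign(σ) a(v_σ(1), …, v_σ(k)) b(v_σ(k+1), …, v_σ(k+l))`, the sum being
over the `(k,l)`-shuffles. -/
def wedge {k l : ℕ} (a : V [⋀^Fin k]→L[ℝ] ℝ) (b : V [⋀^Fin l]→L[ℝ] ℝ) :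
    V [⋀^Fin (k + l)]→L[ℝ] ℝ where
  toMultilinearMap := (((LinearMap.mul' ℝ ℝ).compAlternatingMap
    (a.toAlternatingMap.domCoprod b.toAlternatingMap)).domDomCongr
      finSumFinEquiv).toMultilinearMap
  map_eq_zero_of_eq' := (((LinearMap.mul' ℝ ℝ).compAlternatingMap
    (a.toAlternatingMap.domCoprod b.toAlternatingMap)).domDomCongr
      finSumFinEquiv).map_eq_zero_of_eq'
  cont := by
    change Continuous fun v : Fin (k + l) → V => LinearMap.mul' ℝ ℝ
      ((a.toAlternatingMap.domCoprod b.toAlternatingMap) (v ∘ finSumFinEquiv))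
    simp only [AlternatingMap.domCoprod_apply, sum_apply, map_sum]
    refine continuous_finsetSum _ fun σ _ => ?_
    induction σ using Quotient.inductionOn' with
    | h σ =>
      have hab : Continuous fun v : Fin (k + l) → V =>
          a (fun i => v (finSumFinEquiv (σ (Sum.inl i)))) *
            b (fun i => v (finSumFinEquiv (σ (Sum.inr i)))) :=
        (a.cont.comp (by fun_prop)).mul (b.cont.comp (by fun_prop))
      have hs : ∀ v : Fin (k + l) → V, LinearMap.mul' ℝ ℝ ((AlternatingMap.domCoprod.summand
          a.toAlternatingMap b.toAlternatingMap (Quotient.mk'' σ)) (v ∘ finSumFinEquiv)) =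
          ((Equiv.Perm.sign σ : ℤ) : ℝ) * (a (fun i => v (finSumFinEquiv (σ (Sum.inl i)))) *
            b (fun i => v (finSumFinEquiv (σ (Sum.inr i))))) := by
        intro v
        rw [AlternatingMap.domCoprod.summand_mk'', smul_apply, Units.smul_def, map_zsmul,
          zsmul_eq_mul]
        rfl
      simp only [hs]
      exact hab.const_smul ((Equiv.Perm.sign σ : ℤ) : ℝ)

/-- The `m`-fold wedge power `a ∧ ⋯ ∧ a` of a two-form. -/
def wedgePow (a : V [⋀^Fin 2]→L[ℝ] ℝ) : (m : ℕ) → V [⋀^Fin (2 * m)]→L[ℝ] ℝ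
  | 0 => ContinuousAlternatingMap.constOfIsEmpty ℝ V (Fin 0) 1
  | m + 1 => wedge (wedgePow a m) a

end Wedge

/-! ### Differential forms on a manifold -/

section Forms

variable {E : Type*} [NormedAddCommGroup E] [NormedSpace ℝ E]
  {H : Type*} [TopologicalSpace H] {I : ModelWithCorners ℝ E H}
  {M : Type*} [TopologicalSpace M] [ChartedSpace H M]
  {E' : Type*} [NormedAddCommGroup E'] [NormedSpace ℝ E']
  {H' : Type*} [TopologicalSpace H'] {J : ModelWithCorners ℝ E' H'}
  {N : Type*} [TopologicalSpace N] [ChartedSpace H' N]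

variable (I M) in
/-- (Not necessarily smooth) differential forms of degree `k` on the manifold `M`. -/
abbrev DForm (k : ℕ) : Type _ := (x : M) → (TangentSpace I x) [⋀^Fin k]→L[ℝ] ℝ

/-- The pullback of a form along a map. -/
def pullback {k : ℕ} (f : M → N) (η : DForm J N k) : DForm I M k :=
  fun x => (η (f x)).compContinuousLinearMap (mfderiv I J f x)

/-- The local representative of a form in the preferred chart at `x₀`: its pullback along the
inverse of the chart, a form on a subset of the model vector space. -/
def chartRep {k : ℕ} (η : DForm I M k) (x₀ : M) (y : E) : E [⋀^Fin k]→L[ℝ] ℝ :=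
  (η ((extChartAt I x₀).symm y)).compContinuousLinearMap
    (mfderivWithin 𝓘(ℝ, E) I (extChartAt I x₀).symm (range I) y)

/-- A form is smooth if all its local representatives are. -/
def IsSmooth {k : ℕ} (η : DForm I M k) : Prop :=
  ∀ x₀ : M, ContDiffOn ℝ ∞ (chartRep η x₀) (extChartAt I x₀).target

/-- The exterior derivative, computed at `x` in the preferred chart at `x`. -/
def extD {k : ℕ} (η : DForm I M k) : DForm I M (k + 1) :=
  fun x => (extDerivWithin (chartRep η x) (range I) (extChartAt I x x)).compContinuousLinearMap
    (mfderiv I 𝓘(ℝ, E) (extChartAt I x) x)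

/-- The wedge product of forms on a manifold. -/
def wedgeForm {k l : ℕ} (η : DForm I M k) (ζ : DForm I M l) : DForm I M (k + l) :=
  fun x => wedge (V := TangentSpace I x) (η x) (ζ x)

/-- The wedge powers of a two-form on a manifold. -/
def wedgePowForm (η : DForm I M 2) (m : ℕ) : DForm I M (2 * m) :=
  fun x => wedgePow (V := TangentSpace I x) (η x) m

/-- A generalized contact pair of type `(h, 0)`: one-forms `α`, `β` on a manifold of dimension
`2h + 2` such that `dβ = 0` and `α ∧ (dα)^h ∧ β` is a volume form. -/
structure IsGeneralizedContactPair (h : ℕ) (α β : DForm I M 1) : Prop where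
  finrank_eq : Module.finrank ℝ E = 2 * h + 2
  smooth_left : IsSmooth α
  smooth_right : IsSmooth β
  closed : extD β = 0
  volume : ∀ x, wedgeForm (wedgeForm α (wedgePowForm (extD α) h)) β x ≠ 0

/-- A contact form on a manifold of dimension `2h + 1`: a one-form `α` such that
`α ∧ (dα)^h` is a volume form. -/
structure IsContactForm (h : ℕ) (α : DForm I M 1) : Prop where
  finrank_eq : Module.finrank ℝ E = 2 * h + 1
  smooth : IsSmooth α
  volume : ∀ x, wedgeForm α (wedgePowForm (extD α) h) x ≠ 0

/-- `φ` is a contactomorphism of the (cooriented) contact manifold `(M, ker α)`: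
`φ^* α = f α` for a positive smooth function `f`. -/
def IsContactomorphism (α : DForm I M 1) (φ : M ≃ₘ⟮I, I⟯ M) : Prop :=
  ∃ f : M → ℝ, ContMDiff I 𝓘(ℝ, ℝ) ∞ f ∧ (∀ x, 0 < f x) ∧
    ∀ x, pullback (I := I) φ α x = f x • α x

/-- `σ` is a locally conformally symplectic form with Lee form `θ`: a non-degenerate two-form
with `dσ = σ ∧ θ`, where `θ` is a closed one-form. -/
structure IsLCSForm (σ : DForm I M 2) (θ : DForm I M 1) : Prop where
  smooth : IsSmooth σ
  smooth_lee : IsSmooth θ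
  nondegenerate : ∀ (x : M) (v : TangentSpace I x),
    (∀ w : TangentSpace I x, σ x ![v, w] = 0) → v = 0
  closed_lee : extD θ = 0
  eq_wedge : extD σ = wedgeForm σ θ

end Forms

/-! ### Fiber bundles -/

/-- `p : M → B` is a smooth (locally trivial) fiber bundle with fiber `F`. -/
def IsSmoothFiberBundle {E E₁ E₂ H H₁ H₂ M B : Type*}
    [NormedAddCommGroup E] [NormedSpace ℝ E] [TopologicalSpace H]
    [NormedAddCommGroup E₁] [NormedSpace ℝ E₁] [TopologicalSpace H₁]
    [NormedAddCommGroup E₂] [NormedSpace ℝ E₂] [TopologicalSpace H₂]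
    (I : ModelWithCorners ℝ E H) (I₁ : ModelWithCorners ℝ E₁ H₁) (I₂ : ModelWithCorners ℝ E₂ H₂)
    [TopologicalSpace M] [ChartedSpace H M] [TopologicalSpace B] [ChartedSpace H₁ B]
    (F : Type*) [TopologicalSpace F] [ChartedSpace H₂ F] (p : M → B) : Prop :=
  ∀ b : B, ∃ e : Bundle.Trivialization F p, b ∈ e.baseSet ∧
    ContMDiffOn I (I₁.prod I₂) ∞ e e.source ∧
    ContMDiffOn (I₁.prod I₂) I ∞ e.toOpenPartialHomeomorph.symm e.target

/-! ### Mapping tori -/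

section MappingTorus

variable {E : Type*} [NormedAddCommGroup E] [NormedSpace ℝ E]
  {H : Type*} [TopologicalSpace H] {I : ModelWithCorners ℝ E H}
  {F : Type*} [TopologicalSpace F] [ChartedSpace H F]

/-- The action of `ℤ` on `F × ℝ` by `n • (x, t) = (φⁿ x, t - n)`. -/
@[reducible]
def deckAction (φ : F ≃ₘ⟮I, I⟯ F) : AddAction ℤ (F × ℝ) where
  vadd n p := (((φ.toEquiv : Equiv.Perm F) ^ n) p.1, p.2 - n)
  zero_vadd p := by
    change (((φ.toEquiv : Equiv.Perm F) ^ (0 : ℤ)) p.1, p.2 - ((0 : ℤ) : ℝ)) = p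
    simp
  add_vadd m n p := by
    change (((φ.toEquiv : Equiv.Perm F) ^ (m + n)) p.1, p.2 - ((m + n : ℤ) : ℝ)) =
      (((φ.toEquiv : Equiv.Perm F) ^ m) (((φ.toEquiv : Equiv.Perm F) ^ n) p.1), p.2 - n - m)
    rw [zpow_add, Equiv.Perm.mul_apply]
    push_cast
    congr 1
    ring

/-- The mapping torus of a diffeomorphism `φ : F → F`: the quotient of `F × ℝ` by the action of
`ℤ` generated by `(x, t) ↦ (φ x, t - 1)`, that is, `F × [0, 1]` with `(x, 1)` glued to
`(φ x, 0)`. -/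
def MappingTorus (φ : F ≃ₘ⟮I, I⟯ F) : Type _ :=
  Quotient (@AddAction.orbitRel ℤ (F × ℝ) _ (deckAction φ))

namespace MappingTorus

variable (φ : F ≃ₘ⟮I, I⟯ F)

instance : TopologicalSpace (MappingTorus φ) :=
  inferInstanceAs (TopologicalSpace (Quotient (@AddAction.orbitRel ℤ (F × ℝ) _ (deckAction φ))))

/-- The quotient map `F × ℝ → MappingTorus φ`. -/
def mk (p : F × ℝ) : MappingTorus φ :=
  Quotient.mk (@AddAction.orbitRel ℤ (F × ℝ) _ (deckAction φ)) p

theorem mk_surjective : Function.Surjective (mk φ) := Quotient.mk_surjective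

theorem mk_eq_mk_iff (p q : F × ℝ) :
    mk φ p = mk φ q ↔ ∃ n : ℤ, (((φ.toEquiv : Equiv.Perm F) ^ n) q.1, q.2 - n) = p :=
  Quotient.eq''

theorem contMDiff_zpow (n : ℤ) : ContMDiff I I ∞ ((φ.toEquiv : Equiv.Perm F) ^ n) := by
  induction n using Int.induction_on with
  | zero => exact contMDiff_id
  | succ n ih =>
    rw [zpow_add_one, Equiv.Perm.coe_mul]
    exact ih.comp φ.contMDiff
  | pred n ih =>
    rw [zpow_sub_one, Equiv.Perm.coe_mul]
    exact ih.comp φ.symm.contMDiff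

theorem contMDiff_deck (n : ℤ) : ContMDiff (I.prod 𝓘(ℝ, ℝ)) (I.prod 𝓘(ℝ, ℝ)) ∞
    fun p : F × ℝ => (((φ.toEquiv : Equiv.Perm F) ^ n) p.1, p.2 - (n : ℝ)) :=
  ((contMDiff_zpow φ n).comp contMDiff_fst).prodMk (contMDiff_snd.sub contMDiff_const)

theorem isLocalHomeomorph_mk : IsLocalHomeomorph (mk φ) := by
  let := deckAction φ
  have h : IsAddQuotientCoveringMap (mk φ) ℤ :=
    { toIsQuotientMap := isQuotientMap_quotient_mk'
      toContinuousConstVAdd := ⟨fun n => (contMDiff_deck φ n).continuous⟩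
      apply_eq_iff_mem_orbit := Quotient.eq''
      disjoint := fun e => by
        refine ⟨Prod.snd ⁻¹' Metric.ball e.2 (1 / 2),
          continuous_snd.continuousAt (Metric.ball_mem_nhds _ (by norm_num)), ?_⟩
        rintro n ⟨_, ⟨q, hq, rfl⟩, hq'⟩
        have hq' : dist (q.2 - n) e.2 < 1 / 2 := hq'
        have hq : dist q.2 e.2 < 1 / 2 := hq
        rw [Real.dist_eq, abs_lt] at hq hq'
        have h1 : (n : ℝ) < 1 := by linarith
        have h2 : (-1 : ℝ) < n := by linarith
        have h1 : n < 1 := by exact_mod_cast h1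
        have h2 : -1 < n := by exact_mod_cast h2
        omega }
  exact h.isCoveringMap.isLocalHomeomorph

/-- The charts of the mapping torus are the local inverses of the quotient map followed by charts
of `F × ℝ`. -/
instance : ChartedSpace (ModelProd H ℝ) (MappingTorus φ) :=
  (isLocalHomeomorph_mk φ).chartedSpace (mk_surjective φ)

theorem eventually_localInverse_mk (a z : F × ℝ)
    (hz : mk φ z ∈ ((isLocalHomeomorph_mk φ).localInverseAt a).source) :
    ∃ n : ℤ, ∀ᶠ w in 𝓝 z, (isLocalHomeomorph_mk φ).localInverseAt a (mk φ w) =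
      (((φ.toEquiv : Equiv.Perm F) ^ n) w.1, w.2 - (n : ℝ)) := by
  set s := (isLocalHomeomorph_mk φ).localInverseAt a with hs
  have hsz : mk φ (s (mk φ z)) = mk φ z :=
    (isLocalHomeomorph_mk φ).apply_localInverseAt_of_mem hz
  obtain ⟨n, hn⟩ := (mk_eq_mk_iff φ _ _).1 hsz
  refine ⟨n, ?_⟩
  have h1 : ∀ᶠ w in 𝓝 z, mk φ w ∈ s.source :=
    (isLocalHomeomorph_mk φ).continuous.continuousAt (s.open_source.mem_nhds hz)
  have h2 : ∀ᶠ w in 𝓝 z, (((φ.toEquiv : Equiv.Perm F) ^ n) w.1, w.2 - (n : ℝ)) ∈ s.target := by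
    refine (contMDiff_deck φ n).continuous.continuousAt (s.open_target.mem_nhds ?_)
    rw [hn]
    exact s.map_source hz
  filter_upwards [h1, h2] with w hw1 hw2
  refine (isLocalHomeomorph_mk φ).injOn_localInverseAt_target (s.map_source hw1) hw2 ?_
  rw [(isLocalHomeomorph_mk φ).apply_localInverseAt_of_mem hw1]
  exact ((mk_eq_mk_iff φ _ _).2 ⟨n, rfl⟩).symm

/-- The mapping torus is a smooth manifold. -/
instance [IsManifold I ∞ F] : IsManifold (I.prod 𝓘(ℝ, ℝ)) ∞ (MappingTorus φ) := by
  refine isManifold_of_contDiffOn _ _ _ ?_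
  rintro _ _ ⟨a, rfl⟩ ⟨b, rfl⟩
  rintro y ⟨hy, ⟨x, rfl⟩⟩
  rw [mem_preimage, ModelWithCorners.left_inv] at hy
  generalize (mk_surjective φ).hasRightInverse.choose a = a at hy ⊢
  generalize (mk_surjective φ).hasRightInverse.choose b = b at hy ⊢
  simp only [OpenPartialHomeomorph.trans_source, OpenPartialHomeomorph.symm_source,
    OpenPartialHomeomorph.trans_target, OpenPartialHomeomorph.coe_trans_symm,
    (isLocalHomeomorph_mk φ).localInverseAt_symm, mem_inter_iff, mem_preimage,
    Function.comp_apply] at hy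
  obtain ⟨⟨hx, -⟩, hb, hb'⟩ := hy
  obtain ⟨n, hn⟩ := eventually_localInverse_mk φ b _ hb
  have hd := hn.self_of_nhds
  set ca := chartAt (ModelProd H ℝ) a
  set cb := chartAt (ModelProd H ℝ) b
  have hca : ContMDiffAt (I.prod 𝓘(ℝ, ℝ)) (I.prod 𝓘(ℝ, ℝ)) ∞ ca.symm x :=
    (contMDiffOn_chart_symm (x := a)).contMDiffAt (ca.open_target.mem_nhds hx)
  have hcb : ContMDiffAt (I.prod 𝓘(ℝ, ℝ)) (I.prod 𝓘(ℝ, ℝ)) ∞ cb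
      (((φ.toEquiv : Equiv.Perm F) ^ n) (ca.symm x).1, (ca.symm x).2 - (n : ℝ)) := by
    rw [← hd]
    exact (contMDiffOn_chart (x := b)).contMDiffAt (cb.open_source.mem_nhds hb')
  have hg : ContMDiffAt (I.prod 𝓘(ℝ, ℝ)) (I.prod 𝓘(ℝ, ℝ)) ∞ (fun y : ModelProd H ℝ =>
      cb ((isLocalHomeomorph_mk φ).localInverseAt b (mk φ (ca.symm y)))) x := by
    refine (ContMDiffAt.comp x hcb ((contMDiff_deck φ n).contMDiffAt.comp x hca)).congr_of_eventuallyEq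
      ?_
    filter_upwards [hca.continuousAt.eventually hn] with y hy
    simp only [Function.comp_apply, hy]
  refine ContDiffWithinAt.mono ?_ inter_subset_right
  have hext : ∀ z : ModelProd H ℝ, extChartAt (I.prod 𝓘(ℝ, ℝ)) z = (I.prod 𝓘(ℝ, ℝ)).toPartialEquiv := by
    intro z
    rw [extChartAt, chartAt_self_eq]
    exact PartialEquiv.refl_trans _
  have hg' := (contMDiffAt_iff.1 hg).2
  rw [hext, hext] at hg'
  convert! hg' using 2
  rw [OpenPartialHomeomorph.coe_trans, OpenPartialHomeomorph.coe_trans,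
    OpenPartialHomeomorph.coe_trans_symm, (isLocalHomeomorph_mk φ).localInverseAt_symm]
  rfl

/-- The projection of the mapping torus to the circle, `[(x, t)] ↦ exp(2πit)`. -/
def proj : MappingTorus φ → Circle :=
  Quotient.lift (fun p : F × ℝ => Circle.exp (2 * Real.pi * p.2)) <| by
    rintro p q ⟨n, rfl⟩
    change Circle.exp (2 * Real.pi * (q.2 - n)) = Circle.exp (2 * Real.pi * q.2)
    rw [show 2 * Real.pi * (q.2 - n) = 2 * Real.pi * q.2 - n * (2 * Real.pi) by ring]
    exact Circle.periodic_exp.sub_int_mul_eq n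

end MappingTorus

end MappingTorus

end ContactPair

end

set_option linter.unusedSectionVars false

noncomputable section

/-! From a pair to a fibration. The closed form β is first made integral: by Tischler's argument
(`exists_hasLocalLifts`) there is a map p : M → S¹ whose local lifts have a common differential β',
and β' is a positive integer multiple of a small perturbation of β, so that α ∧ (dα)^h ∧ β' still
vanishes nowhere. Then dα is nondegenerate on ker α ∩ ker β' (`nondegenerate_of_wedge_ne_zero`), and
linear algebra (`systemMap_bijective`) yields a unique vector field X and unique functions f, g with
α(X) = 0, β'(X) = 1 and dα(X, ·) = fα + gβ'.

The flow of X turns p at unit speed, hence permutes the fibres and exhibits M as the mapping torus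
of the first return map of the fibre over 1 (`IsSuspensionFlow.diffeomorph`). Since β' restricts to
zero on each fibre, α restricts to a contact form there, and Cartan's formula gives L_X α = fα on
fibres. So the flow multiplies the restriction of α by the exponential of an integral of f
(`IsSuspensionFlow.pullback_flow`), and the return map is a contactomorphism.

Conversely, write (φⁿ)*a = fₙ a. The positive function g(x, t) = Σₙ ρ(t - n) fₙ(x), with ρ a bump
function, makes g·a invariant under the deck group by the cocycle relation of the fₙ
(`IsContactomorphism.exists_invariant_factor`). The forms g·a and dt descend to the mapping torus,
and on each slice t = const the first is a positive multiple of a contact form.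

For the lcs forms take X as above, now for the pair (α, β). As dα(X, X) = 0, in fact dα(X, ·) = fα,
so contracting dα + c α∧β with X gives (f - c)α. The form is nondegenerate wherever c ≠ f
(`eq_zero_of_lcs`), and f is bounded above on a compact manifold. The Lee equation holds because
α∧β∧β = 0.

Smooth flows come from the implicit function theorem applied to the integral equation in a Banach
space of curves (`exists_contDiffAt_solution`). -/

namespace ContactPair

/-! ### Wedge products of alternating forms -/

section WedgeAlgebra

variable {V : Type*} [AddCommGroup V] [Module ℝ V] [TopologicalSpace V]
  {W : Type*} [AddCommGroup W] [Module ℝ W] [TopologicalSpace W]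
  {k l : ℕ}

/-- The summand of the wedge product corresponding to a permutation. -/
def wedgeSummand (a : V [⋀^Fin k]→L[ℝ] ℝ) (b : V [⋀^Fin l]→L[ℝ] ℝ) (v : Fin (k + l) → V)
    (σ : Equiv.Perm (Fin k ⊕ Fin l)) : ℝ :=
  ((Equiv.Perm.sign σ : ℤ) : ℝ) * (a (fun i => v (finSumFinEquiv (σ (Sum.inl i)))) *
    b (fun i => v (finSumFinEquiv (σ (Sum.inr i)))))

theorem wedge_apply_eq_sum_summand (a : V [⋀^Fin k]→L[ℝ] ℝ) (b : V [⋀^Fin l]→L[ℝ] ℝ)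
    (v : Fin (k + l) → V) :
    wedge a b v = ∑ σ : Equiv.Perm.ModSumCongr (Fin k) (Fin l), LinearMap.mul' ℝ ℝ
      ((AlternatingMap.domCoprod.summand a.toAlternatingMap b.toAlternatingMap σ)
        (v ∘ finSumFinEquiv)) := by
  change LinearMap.mul' ℝ ℝ
      ((a.toAlternatingMap.domCoprod b.toAlternatingMap) (v ∘ finSumFinEquiv)) = _
  simp only [AlternatingMap.domCoprod_apply, sum_apply, map_sum]

theorem mul'_summand_mk (a : V [⋀^Fin k]→L[ℝ] ℝ) (b : V [⋀^Fin l]→L[ℝ] ℝ)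
    (v : Fin (k + l) → V) (σ : Equiv.Perm (Fin k ⊕ Fin l)) :
    LinearMap.mul' ℝ ℝ ((AlternatingMap.domCoprod.summand
      a.toAlternatingMap b.toAlternatingMap (Quotient.mk'' σ)) (v ∘ finSumFinEquiv)) =
      wedgeSummand a b v σ := by
  rw [AlternatingMap.domCoprod.summand_mk'', smul_apply, Units.smul_def, map_zsmul,
    zsmul_eq_mul]
  rfl

theorem wedge_apply (a : V [⋀^Fin k]→L[ℝ] ℝ) (b : V [⋀^Fin l]→L[ℝ] ℝ) (v : Fin (k + l) → V) :
    wedge a b v = ∑ σ : Equiv.Perm.ModSumCongr (Fin k) (Fin l),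
      wedgeSummand a b v (Quotient.out σ) := by
  rw [wedge_apply_eq_sum_summand]
  refine Finset.sum_congr rfl fun σ _ => ?_
  rw [← mul'_summand_mk]
  congr 3
  exact (Quotient.out_eq' σ).symm

/-- Both sides are sums over the same chosen shuffle representatives, so they agree summand by
summand. -/
theorem wedge_comp (a : V [⋀^Fin k]→L[ℝ] ℝ) (b : V [⋀^Fin l]→L[ℝ] ℝ) (A : W →L[ℝ] V) :
    wedge (a.compContinuousLinearMap A) (b.compContinuousLinearMap A) =
      (wedge a b).compContinuousLinearMap A := by
  ext v
  rw [ContinuousAlternatingMap.compContinuousLinearMap_apply, wedge_apply, wedge_apply]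
  rfl

theorem wedgePow_comp (a : V [⋀^Fin 2]→L[ℝ] ℝ) (A : W →L[ℝ] V) (m : ℕ) :
    wedgePow (a.compContinuousLinearMap A) m = (wedgePow a m).compContinuousLinearMap A := by
  induction m with
  | zero => rfl
  | succ m ih => rw [wedgePow, ih, wedge_comp, wedgePow]

theorem wedge_smul_right (a : V [⋀^Fin k]→L[ℝ] ℝ) (c : ℝ) (b : V [⋀^Fin l]→L[ℝ] ℝ) :
    wedge a (c • b) = c • wedge a b := by
  ext v
  simp only [ContinuousAlternatingMap.smul_apply, wedge_apply, smul_eq_mul, Finset.mul_sum]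
  exact Finset.sum_congr rfl fun σ _ => by
    simp only [wedgeSummand, ContinuousAlternatingMap.smul_apply, smul_eq_mul]; ring

theorem wedge_smul_left (c : ℝ) (a : V [⋀^Fin k]→L[ℝ] ℝ) (b : V [⋀^Fin l]→L[ℝ] ℝ) :
    wedge (c • a) b = c • wedge a b := by
  ext v
  simp only [ContinuousAlternatingMap.smul_apply, wedge_apply, smul_eq_mul, Finset.mul_sum]
  exact Finset.sum_congr rfl fun σ _ => by
    simp only [wedgeSummand, ContinuousAlternatingMap.smul_apply, smul_eq_mul]; ring

theorem wedgePow_smul (c : ℝ) (a : V [⋀^Fin 2]→L[ℝ] ℝ) (m : ℕ) :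
    wedgePow (c • a) m = c ^ m • wedgePow a m := by
  induction m with
  | zero => simp [wedgePow]
  | succ m ih => rw [wedgePow, ih, wedge_smul_left, wedge_smul_right, wedgePow, smul_smul, pow_succ]

/-- The identity coset consists of the permutations preserving both blocks, and on finite blocks
preserving one forces preserving the other. -/
theorem exists_out_inr_eq_inl {σ : Equiv.Perm (Fin k ⊕ Fin l)}
    (hσ : (Quotient.mk'' σ : Equiv.Perm.ModSumCongr (Fin k) (Fin l)) ≠ Quotient.mk'' 1) :
    (∃ i j, σ (Sum.inl i) = Sum.inr j) ∧ ∃ j i, σ (Sum.inr j) = Sum.inl i := by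
  have key : ¬ Set.MapsTo σ (Set.range Sum.inl) (Set.range Sum.inl) := fun hm => hσ <| by
    refine Quotient.sound' ?_
    rw [QuotientGroup.leftRel_apply]
    simpa using Subgroup.inv_mem _ (Equiv.Perm.mem_sumCongrHom_range_of_perm_mapsTo_inl hm)
  constructor
  · by_contra! h
    refine key ?_
    rintro _ ⟨i, rfl⟩
    rcases h' : σ (Sum.inl i) with j | j
    · exact ⟨j, rfl⟩
    · exact absurd h' (h i j)
  · by_contra! h
    refine key ((Equiv.Perm.perm_mapsTo_inl_iff_mapsTo_inr σ).2 ?_)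
    rintro _ ⟨i, rfl⟩
    rcases h' : σ (Sum.inr i) with j | j
    · exact absurd h' (h i j)
    · exact ⟨j, rfl⟩

/-- Every coset other than that of the identity mixes the two blocks of indices, so the hypothesis
kills all summands but one. -/
theorem wedge_apply_of_forall_summand (a : V [⋀^Fin k]→L[ℝ] ℝ) (b : V [⋀^Fin l]→L[ℝ] ℝ)
    (v : Fin (k + l) → V)
    (h : ∀ σ : Equiv.Perm (Fin k ⊕ Fin l), (∃ i j, σ (Sum.inl i) = Sum.inr j) →
      (∃ j i, σ (Sum.inr j) = Sum.inl i) → wedgeSummand a b v σ = 0) :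
    wedge a b v = a (fun i => v (Fin.castAdd l i)) * b (fun j => v (Fin.natAdd k j)) := by
  rw [wedge_apply_eq_sum_summand]
  refine (Finset.sum_eq_single
    (Quotient.mk'' 1 : Equiv.Perm.ModSumCongr (Fin k) (Fin l)) ?_ ?_).trans ?_
  · intro σ _ hσ
    induction σ using Quotient.inductionOn' with
    | h σ =>
      rw [mul'_summand_mk]
      obtain ⟨h1, h2⟩ := exists_out_inr_eq_inl hσ
      exact h σ h1 h2
  · simp
  · rw [mul'_summand_mk]
    simp [wedgeSummand]

/-- If `a` vanishes as soon as one argument is among the last `l` vectors, the wedge product has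
only one nonzero summand. -/
theorem wedge_apply_of_left (a : V [⋀^Fin k]→L[ℝ] ℝ) (b : V [⋀^Fin l]→L[ℝ] ℝ)
    (v : Fin (k + l) → V)
    (ha : ∀ u : Fin k → V, (∃ i j, u i = v (Fin.natAdd k j)) → a u = 0) :
    wedge a b v = a (fun i => v (Fin.castAdd l i)) * b (fun j => v (Fin.natAdd k j)) := by
  refine wedge_apply_of_forall_summand a b v ?_
  rintro σ ⟨i, j, hij⟩ -
  rw [wedgeSummand, ha _ ⟨i, j, by simp [hij]⟩, zero_mul, mul_zero]

/-- If `b` vanishes as soon as one argument is among the first `k` vectors, the wedge product has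
only one nonzero summand. -/
theorem wedge_apply_of_right (a : V [⋀^Fin k]→L[ℝ] ℝ) (b : V [⋀^Fin l]→L[ℝ] ℝ)
    (v : Fin (k + l) → V)
    (hb : ∀ u : Fin l → V, (∃ j i, u j = v (Fin.castAdd l i)) → b u = 0) :
    wedge a b v = a (fun i => v (Fin.castAdd l i)) * b (fun j => v (Fin.natAdd k j)) := by
  refine wedge_apply_of_forall_summand a b v ?_
  rintro σ - ⟨i, j, hij⟩
  rw [wedgeSummand, hb _ ⟨i, j, by simp [hij]⟩, mul_zero, mul_zero]

/-- The vector `x` belongs to the radical of the form `a`. -/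
def IsRadical (a : V [⋀^Fin k]→L[ℝ] ℝ) (x : V) : Prop :=
  ∀ u : Fin k → V, (∃ i, u i = x) → a u = 0

/-- Each shuffle feeds the argument `x` either to `a` or to `b`, and both vanish on it. -/
theorem IsRadical.wedge {a : V [⋀^Fin k]→L[ℝ] ℝ} {b : V [⋀^Fin l]→L[ℝ] ℝ} {x : V}
    (ha : IsRadical a x) (hb : IsRadical b x) : IsRadical (wedge a b) x := by
  rintro u ⟨m, hm⟩
  rw [wedge_apply]
  refine Finset.sum_eq_zero fun σ _ => ?_
  rcases h : (Quotient.out σ).symm (finSumFinEquiv.symm m) with i | j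
  · rw [wedgeSummand, ha _ ⟨i, ?_⟩, zero_mul, mul_zero]
    rw [← h, Equiv.apply_symm_apply, Equiv.apply_symm_apply, hm]
  · rw [wedgeSummand, hb _ ⟨j, ?_⟩, mul_zero, mul_zero]
    rw [← h, Equiv.apply_symm_apply, Equiv.apply_symm_apply, hm]

theorem IsRadical.wedgePow {a : V [⋀^Fin 2]→L[ℝ] ℝ} {x : V} (ha : IsRadical a x) (m : ℕ) :
    IsRadical (wedgePow a m) x := by
  induction m with
  | zero =>
    rintro u ⟨i, -⟩
    exact i.elim0
  | succ m ih => exact ih.wedge ha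

/-- When the second block is a single index, a shuffle is determined by where that index goes: σ⁻¹τ
fixes it and hence preserves both blocks. -/
theorem mk_eq_mk_of_apply_inr {σ τ : Equiv.Perm (Fin k ⊕ Fin 1)}
    (h : σ (Sum.inr 0) = τ (Sum.inr 0)) :
    (Quotient.mk'' σ : Equiv.Perm.ModSumCongr (Fin k) (Fin 1)) = Quotient.mk'' τ := by
  refine Quotient.sound' ?_
  rw [QuotientGroup.leftRel_apply]
  refine Equiv.Perm.mem_sumCongrHom_range_of_perm_mapsTo_inl
    ((Equiv.Perm.perm_mapsTo_inl_iff_mapsTo_inr _).2 ?_)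
  rintro _ ⟨i, rfl⟩
  rw [Subsingleton.elim i 0]
  exact ⟨0, by rw [Equiv.Perm.mul_apply, ← h]; simp⟩

theorem fun_fin_one_eq {X : Type*} (f : Fin 1 → X) : f = ![f 0] := by
  ext i; fin_cases i; rfl

theorem fun_fin_two_eq {X : Type*} (f : Fin 2 → X) : f = ![f 0, f 1] := by
  ext i; fin_cases i <;> rfl

/-- Wedge product with a one-form as a sum over the argument inserted into the one-form. -/
theorem wedge_apply_one (a : V [⋀^Fin k]→L[ℝ] ℝ) (b : V [⋀^Fin 1]→L[ℝ] ℝ) (v : Fin (k + 1) → V) :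
    wedge a b v = ∑ x : Fin k ⊕ Fin 1, wedgeSummand a b v (Equiv.swap x (Sum.inr 0)) := by
  rw [wedge_apply_eq_sum_summand]
  refine (Fintype.sum_bijective (fun x : Fin k ⊕ Fin 1 =>
    (Quotient.mk'' (Equiv.swap x (Sum.inr 0)) : Equiv.Perm.ModSumCongr (Fin k) (Fin 1)))
    ⟨fun x y hxy => ?_, fun σ => ?_⟩ _ _ fun x => (mul'_summand_mk _ _ _ _).symm).symm
  · obtain ⟨⟨sl, sr⟩, h⟩ := QuotientGroup.leftRel_apply.mp (Quotient.exact' hxy)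
    have h1 := DFunLike.congr_fun (inv_mul_eq_iff_eq_mul.mp h.symm) (Sum.inr 0)
    simpa [Subsingleton.elim (sr 0) 0] using h1.symm
  · induction σ using Quotient.inductionOn' with
    | h σ => exact ⟨σ (Sum.inr 0), mk_eq_mk_of_apply_inr (by simp)⟩

theorem wedge_one_one (a b : V [⋀^Fin 1]→L[ℝ] ℝ) (v w : V) :
    wedge a b ![v, w] = a ![v] * b ![w] - a ![w] * b ![v] := by
  have e0 : (finSumFinEquiv (Sum.inl 0) : Fin (1 + 1)) = 0 := rfl
  have e1 : (finSumFinEquiv (Sum.inr 0) : Fin (1 + 1)) = 1 := rfl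
  rw [wedge_apply_one, Fintype.sum_sum_type, Fin.sum_univ_one, Fin.sum_univ_one, wedgeSummand,
    wedgeSummand, Equiv.Perm.sign_swap (by decide), Equiv.swap_self,
    fun_fin_one_eq (fun i => _), fun_fin_one_eq (fun i => _), fun_fin_one_eq (fun i => _),
    fun_fin_one_eq (fun i => _)]
  simp only [Equiv.swap_apply_left, Equiv.swap_apply_right, Equiv.refl_apply, e0, e1]
  simp
  ring

/-- The three terms record which vector enters the one-form; the two nontrivial shuffles are
represented by transpositions, whence the signs. -/
theorem wedge_two_one (a : V [⋀^Fin 2]→L[ℝ] ℝ) (b : V [⋀^Fin 1]→L[ℝ] ℝ) (u v w : V) :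
    wedge a b ![u, v, w] = a ![u, v] * b ![w] - a ![w, v] * b ![u] - a ![u, w] * b ![v] := by
  have e0 : (finSumFinEquiv (Sum.inl 0) : Fin (2 + 1)) = 0 := rfl
  have e1 : (finSumFinEquiv (Sum.inl 1) : Fin (2 + 1)) = 1 := rfl
  have e2 : (finSumFinEquiv (Sum.inr 0) : Fin (2 + 1)) = 2 := rfl
  have f1 : (Equiv.swap (Sum.inl 0) (Sum.inr 0) : Equiv.Perm (Fin 2 ⊕ Fin 1)) (Sum.inl 1) =
    Sum.inl 1 := by decide
  have f2 : (Equiv.swap (Sum.inl 1) (Sum.inr 0) : Equiv.Perm (Fin 2 ⊕ Fin 1)) (Sum.inl 0) =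
    Sum.inl 0 := by decide
  have hs : ∀ σ, wedgeSummand a b ![u, v, w] σ = ((Equiv.Perm.sign σ : ℤ) : ℝ) *
      (a ![(![u, v, w] : Fin 3 → V) (finSumFinEquiv (σ (Sum.inl 0))),
        (![u, v, w] : Fin 3 → V) (finSumFinEquiv (σ (Sum.inl 1)))] *
        b ![(![u, v, w] : Fin 3 → V) (finSumFinEquiv (σ (Sum.inr 0)))]) := fun σ => by
    rw [wedgeSummand, fun_fin_one_eq (fun i => _), fun_fin_two_eq (fun i => _)]
  rw [wedge_apply_one, Fintype.sum_sum_type, Fin.sum_univ_one, Fin.sum_univ_two, hs, hs, hs,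
    Equiv.Perm.sign_swap (by decide), Equiv.Perm.sign_swap (by decide), Equiv.swap_self]
  simp only [f1, f2, Equiv.swap_apply_left, Equiv.swap_apply_right, Equiv.refl_apply,
    e0, e1, e2]
  simp
  ring

end WedgeAlgebra

/-! ### Volume forms built from two one-forms and a two-form -/

section LinearAlgebra

variable {V : Type*} [NormedAddCommGroup V] [NormedSpace ℝ V]
  {W : Type*} [NormedAddCommGroup W] [NormedSpace ℝ W]

theorem eq_zero_of_apply_linearIndependent [FiniteDimensional ℝ V] {n : ℕ} (T : V [⋀^Fin n]→L[ℝ] ℝ)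
    (hn : Module.finrank ℝ V = n) {u : Fin n → V} (hu : LinearIndependent ℝ u) (hT : T u = 0) :
    T = 0 := by
  have hb := coe_basisOfLinearIndependentOfCardEqFinrank' u hu (by simp [hn])
  have h := (AlternatingMap.map_basis_eq_zero_iff
    (basisOfLinearIndependentOfCardEqFinrank' u hu (by simp [hn])) T.toAlternatingMap).1
      (by rw [hb]; exact hT)
  exact ContinuousAlternatingMap.toAlternatingMap_injective h

theorem linearIndependent_append_of_apply_ne_zero {k : ℕ} (b : V →ₗ[ℝ] ℝ) {u : Fin k → V}
    (hu : LinearIndependent ℝ u) (hbu : ∀ i, b (u i) = 0) {x : V} (hx : b x ≠ 0) :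
    LinearIndependent ℝ (Fin.append u ![x]) ∧ LinearIndependent ℝ (Fin.append ![x] u) := by
  have hx0 : x ≠ 0 := fun h => hx (by rw [h, map_zero])
  have hxi : LinearIndependent ℝ ![x] := by
    rw [linearIndependent_unique_iff]
    exact hx0
  have hd : Disjoint (Submodule.span ℝ (range u)) (Submodule.span ℝ (range ![x])) := by
    rw [Matrix.range_cons, Matrix.range_empty, union_empty, Submodule.disjoint_span_singleton' hx0]
    intro hmem
    have : Submodule.span ℝ (range u) ≤ LinearMap.ker b := by
      rw [Submodule.span_le]
      rintro _ ⟨i, rfl⟩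
      exact hbu i
    exact hx (this hmem)
  have key : ∀ {m n : ℕ} (f : Fin m → V) (g : Fin n → V),
      Fin.append f g = Sum.elim f g ∘ finSumFinEquiv.symm := by
    intro m n f g
    ext i
    refine Fin.addCases (fun i => ?_) (fun i => ?_) i <;> simp
  rw [key, key]
  exact ⟨(hu.sum_type hxi hd).comp _ (Equiv.injective _),
    (hxi.sum_type hu hd.symm).comp _ (Equiv.injective _)⟩

/-- A one-form as a linear functional. -/
def toFunctional (a : V [⋀^Fin 1]→L[ℝ] ℝ) : V →L[ℝ] ℝ :=
  (ContinuousAlternatingMap.ofSubsingleton ℝ V ℝ (0 : Fin 1)).symm a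

theorem toFunctional_apply (a : V [⋀^Fin 1]→L[ℝ] ℝ) (v : V) : toFunctional a v = a ![v] := by
  change a (fun _ => v) = _
  congr 1
  ext i
  fin_cases i
  rfl

theorem apply_eq_toFunctional (a : V [⋀^Fin 1]→L[ℝ] ℝ) (v : Fin 1 → V) :
    a v = toFunctional a (v 0) := by
  rw [toFunctional_apply]
  congr 1
  ext i
  fin_cases i
  rfl

theorem exists_linearIndependent_ker [FiniteDimensional ℝ V] {n : ℕ}
    (hn : Module.finrank ℝ V = n + 1) {b : V →ₗ[ℝ] ℝ}
    (hb : b ≠ 0) : ∃ u : Fin n → V, LinearIndependent ℝ u ∧ ∀ i, b (u i) = 0 := by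
  have h := Module.Dual.finrank_ker_add_one_of_ne_zero (f := b) hb
  obtain ⟨e⟩ : Nonempty (Module.Basis (Fin n) ℝ (LinearMap.ker b)) :=
    ⟨Module.finBasisOfFinrankEq ℝ (LinearMap.ker b) (by omega)⟩
  exact ⟨fun i => (e i : V), e.linearIndependent.map' _ (LinearMap.ker b).ker_subtype,
    fun i => (e i).2⟩

variable {h : ℕ} {α β : V [⋀^Fin 1]→L[ℝ] ℝ} {η : V [⋀^Fin 2]→L[ℝ] ℝ}

/-- All other shuffles insert some `u i` into `β`, which vanishes there. -/
theorem wedge_right_apply_append {k : ℕ} (τ : V [⋀^Fin k]→L[ℝ] ℝ) {u : Fin k → V}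
    (hu : ∀ i, toFunctional β (u i) = 0) (x : V) :
    wedge τ β (Fin.append u ![x]) = τ u * toFunctional β x := by
  rw [wedge_apply_of_right]
  · simp only [Fin.append_left, Fin.append_right]
    rw [apply_eq_toFunctional β]
    rfl
  · rintro w ⟨j, i, hji⟩
    rw [Fin.append_left] at hji
    rw [apply_eq_toFunctional, ← Subsingleton.elim j 0, hji, hu]

theorem wedge_left_apply_append {k : ℕ} (τ : V [⋀^Fin k]→L[ℝ] ℝ) {u : Fin k → V}
    (hu : ∀ i, toFunctional α (u i) = 0) (x : V) :
    wedge α τ (Fin.append ![x] u) = toFunctional α x * τ u := by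
  rw [wedge_apply_of_left]
  · simp only [Fin.append_left, Fin.append_right]
    rw [apply_eq_toFunctional α]
    rfl
  · rintro w ⟨j, i, hji⟩
    rw [Fin.append_right] at hji
    rw [apply_eq_toFunctional, ← Subsingleton.elim j 0, hji, hu]

theorem toFunctional_ne_zero_of_wedge_ne_zero {k : ℕ} {τ : V [⋀^Fin k]→L[ℝ] ℝ}
    (hv : wedge τ β ≠ 0) : toFunctional β ≠ 0 := by
  intro hb
  refine hv ?_
  have : β = (0 : ℝ) • β := by
    ext v
    rw [apply_eq_toFunctional, hb]
    simp
  rw [this, wedge_smul_right, zero_smul]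

theorem toFunctional_ne_zero_of_wedge_ne_zero_left {k : ℕ} {τ : V [⋀^Fin k]→L[ℝ] ℝ}
    (hv : wedge α τ ≠ 0) : toFunctional α ≠ 0 := by
  intro hb
  refine hv ?_
  have : α = (0 : ℝ) • α := by
    ext v
    rw [apply_eq_toFunctional, hb]
    simp
  rw [this, wedge_smul_left, zero_smul]

theorem exists_apply_eq_one {b : V →L[ℝ] ℝ} (hb : b ≠ 0) : ∃ x, b x = 1 := by
  obtain ⟨x, hx⟩ := DFunLike.ne_iff.1 hb
  exact ⟨(b x)⁻¹ • x, by rw [map_smul, smul_eq_mul, inv_mul_cancel₀ hx]⟩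

/-- Restriction of the volume form `τ ∧ β` to a hyperplane on which `β` vanishes. -/
theorem comp_ne_zero_of_wedge_ne_zero [FiniteDimensional ℝ V] [FiniteDimensional ℝ W] {k : ℕ}
    {τ : V [⋀^Fin k]→L[ℝ] ℝ}
    (hV : Module.finrank ℝ V = k + 1) (hW : Module.finrank ℝ W = k)
    (hv : wedge τ β ≠ 0) {A : W →L[ℝ] V} (hA : Function.Injective A)
    (hβA : ∀ w, toFunctional β (A w) = 0) : τ.compContinuousLinearMap A ≠ 0 := by
  intro h0
  obtain ⟨x, hx⟩ := exists_apply_eq_one (toFunctional_ne_zero_of_wedge_ne_zero hv)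
  let e := Module.finBasisOfFinrankEq ℝ W hW
  have hli : LinearIndependent ℝ fun i => A (e i) :=
    e.linearIndependent.map' A.toLinearMap (LinearMap.ker_eq_bot.2 hA)
  refine hv (eq_zero_of_apply_linearIndependent _ hV
    (linearIndependent_append_of_apply_ne_zero (toFunctional β).toLinearMap hli
      (fun i => hβA _) (x := x) (by simp [hx])).1 ?_)
  rw [wedge_right_apply_append _ (fun i => hβA _)]
  have : τ (fun i => A (e i)) = τ.compContinuousLinearMap A e := rfl
  rw [this, h0]
  simp

/-- Converse to the preceding restriction statement: a tuple from the hyperplane on which τ is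
nonzero, followed by a vector with β = 1, detects τ ∧ β. -/
theorem wedge_ne_zero_of_comp_ne_zero {k : ℕ} {τ : V [⋀^Fin k]→L[ℝ] ℝ} {A : W →L[ℝ] V}
    (hβ : toFunctional β ≠ 0) (hβA : ∀ w, toFunctional β (A w) = 0)
    (hτ : τ.compContinuousLinearMap A ≠ 0) : wedge τ β ≠ 0 := by
  intro h0
  obtain ⟨x, hx⟩ := exists_apply_eq_one hβ
  refine hτ (ContinuousAlternatingMap.ext fun u => ?_)
  have := wedge_right_apply_append (β := β) τ (u := fun i => A (u i)) (fun i => hβA _) x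
  rw [h0, hx, mul_one] at this
  exact this.symm

/-- The volume form is nonzero on a basis of ker β followed by `x`, so α cannot vanish on all of ker
β. This gives `r`, and subtracting a multiple of it moves `x` into ker α. -/
theorem exists_dual_pair [FiniteDimensional ℝ V] (hV : Module.finrank ℝ V = 2 * h + 2)
    (hv : wedge (wedge α (wedgePow η h)) β ≠ 0) :
    ∃ r x : V, toFunctional α r = 1 ∧ toFunctional β r = 0 ∧
      toFunctional α x = 0 ∧ toFunctional β x = 1 := by
  have hβ := toFunctional_ne_zero_of_wedge_ne_zero hv
  obtain ⟨x, hx⟩ := exists_apply_eq_one hβ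
  have hβ' : (toFunctional β).toLinearMap ≠ 0 := fun h0 => by
    have := LinearMap.congr_fun h0 x
    simp [hx] at this
  obtain ⟨u, hu, hu0⟩ := exists_linearIndependent_ker (n := 1 + 2 * h) (by omega) hβ'
  have hτu : wedge α (wedgePow η h) u ≠ 0 := by
    intro h0
    refine hv (eq_zero_of_apply_linearIndependent _ (by omega)
      (linearIndependent_append_of_apply_ne_zero _ hu hu0 (x := x) (by simp [hx])).1 ?_)
    rw [wedge_right_apply_append _ hu0, h0, zero_mul]
  obtain ⟨i, hi⟩ : ∃ i, toFunctional α (u i) ≠ 0 := by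
    by_contra! hc
    refine hτu ?_
    rw [wedge_apply]
    refine Finset.sum_eq_zero fun σ _ => ?_
    rw [wedgeSummand, apply_eq_toFunctional α, hc, zero_mul, mul_zero]
  refine ⟨(toFunctional α (u i))⁻¹ • u i, x - toFunctional α x • (toFunctional α (u i))⁻¹ • u i,
    ?_, ?_, ?_, ?_⟩
  · rw [map_smul, smul_eq_mul, inv_mul_cancel₀ hi]
  · rw [map_smul]; erw [hu0 i]; simp
  · simp [inv_mul_cancel₀ hi]
  · simp only [map_sub, map_smul, hx]; erw [hu0 i]; simp

/-- Complete `v` to a basis: a top-degree form is determined by its value on that basis, which is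
zero. -/
theorem eq_zero_of_isRadical [FiniteDimensional ℝ V] {n : ℕ} (hV : Module.finrank ℝ V = n) {v : V}
    (hv : v ≠ 0)
    {T : V [⋀^Fin n]→L[ℝ] ℝ} (hT : IsRadical T v) : T = 0 := by
  have hli : LinearIndepOn ℝ id {v} := (LinearIndepOn.singleton (v := id) hv)
  let B := Module.Basis.extend hli
  have hvmem : v ∈ hli.extend (subset_univ _) := hli.subset_extend _ rfl
  let := FiniteDimensional.fintypeBasisIndex B
  have hcard : Fintype.card (hli.extend (subset_univ _)) = n := by
    rw [← hV, Module.finrank_eq_card_basis B]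
  let e := Fintype.equivFinOfCardEq hcard
  refine eq_zero_of_apply_linearIndependent T hV (u := B ∘ e.symm)
    (B.linearIndependent.comp _ e.symm.injective) (hT _ ⟨e ⟨v, hvmem⟩, ?_⟩)
  simp [B]

theorem isRadical_of_forall {η : V [⋀^Fin 2]→L[ℝ] ℝ} {v : V} (hη : ∀ w, η ![v, w] = 0) :
    IsRadical η v := by
  rintro u ⟨i, hi⟩
  rw [fun_fin_two_eq u]
  fin_cases i
  · change u 0 = v at hi
    rw [hi, hη]
  · change u 1 = v at hi
    have hne : (0 : Fin 2) ≠ 1 := by decide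
    have := η.toAlternatingMap.map_swap ![v, u 0] hne
    have h2 : (![v, u 0] ∘ Equiv.swap 0 1 : Fin 2 → V) = ![u 0, v] := by
      ext i; fin_cases i <;> simp
    rw [h2] at this
    rw [hi]
    change η ![u 0, v] = - η ![v, u 0] at this
    rw [this, hη, neg_zero]

/-- Replacing η by its composite with the projection π onto ker α ∩ ker β along `r` and `x` does not
change the volume form on an adapted basis. But then `v` lies in the radical of all three factors,
so that value is zero. -/
theorem nondegenerate_of_wedge_ne_zero [FiniteDimensional ℝ V] (hV : Module.finrank ℝ V = 2 * h + 2)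
    (hv : wedge (wedge α (wedgePow η h)) β ≠ 0) (v : V) (hαv : toFunctional α v = 0)
    (hβv : toFunctional β v = 0)
    (hη : ∀ w, toFunctional α w = 0 → toFunctional β w = 0 → η ![v, w] = 0) : v = 0 := by
  by_contra hne
  obtain ⟨r, x, hαr, hβr, hαx, hβx⟩ := exists_dual_pair hV hv
  let π : V →L[ℝ] V := ContinuousLinearMap.id ℝ V - (toFunctional α).smulRight r -
    (toFunctional β).smulRight x
  have hπ : ∀ w, π w = w - toFunctional α w • r - toFunctional β w • x := fun w => rfl
  have hαπ : ∀ w, toFunctional α (π w) = 0 := fun w => by simp [hπ, hαr, hαx]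
  have hβπ : ∀ w, toFunctional β (π w) = 0 := fun w => by simp [hπ, hβr, hβx]
  have hπv : π v = v := by simp [hπ, hαv, hβv]
  -- After projecting the second argument, only vectors of the common kernel are paired with `v`,
  -- where η(v, ·) is assumed zero.
  have hrad : IsRadical (η.compContinuousLinearMap π) v := by
    refine isRadical_of_forall fun w => ?_
    rw [ContinuousAlternatingMap.compContinuousLinearMap_apply]
    have : (π ∘ ![v, w] : Fin 2 → V) = ![v, π w] := by
      ext i; fin_cases i <;> simp [hπv]
    rw [this]
    exact hη _ (hαπ w) (hβπ w)
  have h1 : ∀ {γ : V [⋀^Fin 1]→L[ℝ] ℝ}, toFunctional γ v = 0 → IsRadical γ v := by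
    rintro γ hγ u ⟨i, hi⟩
    rw [apply_eq_toFunctional, ← Subsingleton.elim i 0, hi, hγ]
  have hzero : wedge (wedge α (wedgePow (η.compContinuousLinearMap π) h)) β = 0 :=
    eq_zero_of_isRadical (by omega) hne
      (((h1 hαv).wedge (hrad.wedgePow h)).wedge (h1 hβv))
  -- a basis of the common kernel, completed by `r` and `x`
  obtain ⟨u, hu, hu0⟩ := exists_linearIndependent_ker (n := 1 + 2 * h)
    (b := (toFunctional β).toLinearMap) (by omega) (fun h0 => by
      have := LinearMap.congr_fun h0 x
      simp [hβx] at this)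
  let K := LinearMap.ker (toFunctional β).toLinearMap
  have hK : Module.finrank ℝ K = 2 * h + 1 := by
    have : Module.finrank ℝ K + 1 = Module.finrank ℝ V :=
      Module.Dual.finrank_ker_add_one_of_ne_zero (f := (toFunctional β).toLinearMap) (fun h0 => by
        have := LinearMap.congr_fun h0 x
        simp [hβx] at this)
    omega
  obtain ⟨e, he, he0⟩ := exists_linearIndependent_ker (n := 2 * h)
    (b := (toFunctional α).toLinearMap ∘ₗ K.subtype) hK (fun h0 => by
      have := LinearMap.congr_fun h0 ⟨r, hβr⟩
      simp [hαr] at this)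
  have he' : LinearIndependent ℝ fun i => (e i : V) := he.map' _ K.ker_subtype
  have hαe : ∀ i, toFunctional α (e i : V) = 0 := he0
  have hβe : ∀ i, toFunctional β (e i : V) = 0 := fun i => (e i).2
  have hβre : ∀ i, toFunctional β (Fin.append ![r] (fun i => (e i : V)) i) = 0 := fun i => by
    refine Fin.addCases (fun i => ?_) (fun i => ?_) i
    · rw [Fin.append_left, Matrix.cons_val_fin_one, hβr]
    · rw [Fin.append_right, hβe]
  -- On the adapted basis (r, e, x) the volume form sees only η^h on the common kernel, so it cannot
  -- distinguish η from its projected version.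
  have hval : ∀ η : V [⋀^Fin 2]→L[ℝ] ℝ, wedge (wedge α (wedgePow η h)) β
      (Fin.append (Fin.append ![r] fun i => (e i : V)) ![x]) = wedgePow η h fun i => (e i : V) := by
    intro η
    rw [wedge_right_apply_append _ hβre, wedge_left_apply_append _ hαe, hαr, hβx, one_mul, mul_one]
  refine hv (eq_zero_of_apply_linearIndependent _ (by omega)
    (linearIndependent_append_of_apply_ne_zero (toFunctional β).toLinearMap
      (linearIndependent_append_of_apply_ne_zero (toFunctional α).toLinearMap he' hαe
        (x := r) (by simp [hαr])).2 hβre (x := x) (by simp [hβx])).1 ?_)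
  have h3 := hval (η.compContinuousLinearMap π)
  rw [hzero, wedgePow_comp] at h3
  rw [hval]
  have h4 : (fun i => (e i : V)) = π ∘ fun i => (e i : V) := by
    ext i
    simp [hπ, hαe, hβe]
  rw [h4]
  exact h3.symm

/-- Multiplying a contact form by a nonzero factor changes `a ∧ η ^ h` by a nonzero factor. -/
theorem wedge_ne_zero_of_conformal [FiniteDimensional ℝ V] (hV : Module.finrank ℝ V = 2 * h + 1)
    (hv : wedge α (wedgePow η h) ≠ 0) {g : ℝ} (hg : g ≠ 0) {η' : V [⋀^Fin 2]→L[ℝ] ℝ}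
    (hη : ∀ v w, toFunctional α v = 0 → toFunctional α w = 0 → η' ![v, w] = g * η ![v, w]) :
    wedge (g • α) (wedgePow η' h) ≠ 0 := by
  obtain ⟨r, hr⟩ := exists_apply_eq_one (toFunctional_ne_zero_of_wedge_ne_zero_left hv)
  obtain ⟨e, he, hαe⟩ := exists_linearIndependent_ker (n := 2 * h)
    (b := (toFunctional α).toLinearMap) (by omega) (fun h0 => by
      have := LinearMap.congr_fun h0 r
      simp [hr] at this)
  let π : V →L[ℝ] V := ContinuousLinearMap.id ℝ V - (toFunctional α).smulRight r
  have hπ : ∀ w, π w = w - toFunctional α w • r := fun w => rfl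
  have hαπ : ∀ w, toFunctional α (π w) = 0 := fun w => by simp [hπ, hr]
  have hπe : π ∘ e = e := by
    ext i
    rw [Function.comp_apply, hπ]
    erw [hαe i]
    simp
  -- Only the restrictions to ker α enter, because the test basis below consists of `r` and vectors
  -- of ker α, which π fixes.
  have hcomp : η'.compContinuousLinearMap π = (g • η).compContinuousLinearMap π := by
    ext v
    rw [ContinuousAlternatingMap.compContinuousLinearMap_apply,
      ContinuousAlternatingMap.compContinuousLinearMap_apply, fun_fin_two_eq (π ∘ v)]
    exact hη _ _ (hαπ _) (hαπ _)
  have hpow : wedgePow η' h e = g ^ h * wedgePow η h e := by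
    have h1 := congrArg (fun τ => wedgePow τ h e) hcomp
    simp only [wedgePow_comp, ContinuousAlternatingMap.compContinuousLinearMap_apply, hπe,
      wedgePow_smul] at h1
    exact h1
  intro h0
  have h1 := wedge_left_apply_append (α := α) (wedgePow η' h) hαe r
  have h2 : wedge (g • α) (wedgePow η' h) (Fin.append ![r] e) = 0 := by rw [h0]; rfl
  rw [wedge_smul_left, ContinuousAlternatingMap.smul_apply, h1, hr, one_mul, hpow] at h2
  have h3 : wedgePow η h e = 0 := by
    simpa [hg] using h2
  refine hv (eq_zero_of_apply_linearIndependent _ (by omega)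
    (linearIndependent_append_of_apply_ne_zero (toFunctional α).toLinearMap he hαe
        (x := r) (by simp [hr])).2 ?_)
  rw [wedge_left_apply_append _ hαe, h3, mul_zero]

end LinearAlgebra

/-! ### Smoothness of families of alternating forms -/

section AlternatingCalculus

variable {X : Type*} [NormedAddCommGroup X] [NormedSpace ℝ X]
  {V : Type*} [NormedAddCommGroup V] [NormedSpace ℝ V]
  {W : Type*} [NormedAddCommGroup W] [NormedSpace ℝ W]
  {k : ℕ} {n : WithTop ℕ∞}

theorem finiteDimensional_continuousAlternatingMap [FiniteDimensional ℝ V] :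
    FiniteDimensional ℝ (V [⋀^Fin k]→L[ℝ] ℝ) := by
  let f : (V [⋀^Fin k]→L[ℝ] ℝ) →ₗ[ℝ] MultilinearMap ℝ (fun _ : Fin k => V) ℝ :=
    { toFun := fun a => a.toContinuousMultilinearMap.toMultilinearMap
      map_add' := fun _ _ => rfl
      map_smul' := fun _ _ => rfl }
  refine FiniteDimensional.of_injective f fun a b hab => ?_
  ext v
  exact congrArg (fun g : MultilinearMap ℝ (fun _ : Fin k => V) ℝ => g v) hab

/-- In finite dimension evaluation on all tuples of basis vectors is an injective linear map to a
coordinate space; a linear left inverse recovers the form from its smooth coordinates. -/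
theorem contDiffAt_alternating_iff [FiniteDimensional ℝ V] {η : X → V [⋀^Fin k]→L[ℝ] ℝ} {x : X} :
    ContDiffAt ℝ n η x ↔ ∀ v, ContDiffAt ℝ n (fun y => η y v) x := by
  refine ⟨fun h v => ?_, fun h => ?_⟩
  · exact ((ContinuousAlternatingMap.apply ℝ V ℝ v).contDiff.contDiffAt).comp x h
  · have := finiteDimensional_continuousAlternatingMap (V := V) (k := k)
    let b := Module.finBasis ℝ V
    let f : (V [⋀^Fin k]→L[ℝ] ℝ) →ₗ[ℝ] ((Fin k → Fin (Module.finrank ℝ V)) → ℝ) :=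
      { toFun := fun a s => a fun i => b (s i)
        map_add' := fun _ _ => rfl
        map_smul' := fun _ _ => rfl }
    have hf : LinearMap.ker f = ⊥ := by
      refine LinearMap.ker_eq_bot'.2 fun a ha => ?_
      refine ContinuousAlternatingMap.toAlternatingMap_injective
        (Module.Basis.ext_alternating b fun s _ => ?_)
      exact congrFun ha s
    obtain ⟨g, hg⟩ := LinearMap.exists_leftInverse_of_injective f hf
    have h1 : ContDiffAt ℝ n (fun y => f (η y)) x := contDiffAt_pi.2 fun s => h _
    have h2 := (LinearMap.toContinuousLinearMap g).contDiff.contDiffAt.comp x h1 (n := n)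
    refine h2.congr_of_eventuallyEq (Eventually.of_forall fun y => ?_)
    exact (LinearMap.congr_fun hg (η y)).symm

theorem contDiffAt_alternating_apply {η : X → V [⋀^Fin k]→L[ℝ] ℝ} {v : Fin k → X → V} {x : X}
    (hη : ContDiffAt ℝ n η x) (hv : ∀ i, ContDiffAt ℝ n (v i) x) :
    ContDiffAt ℝ n (fun y => η y fun i => v i y) x := by
  let f := (ContinuousAlternatingMap.toContinuousMultilinearMapCLM ℝ :
    (V [⋀^Fin k]→L[ℝ] ℝ) →L[ℝ] _)
  have h := (f.analyticAt_uncurry_of_multilinear (x := (η x, fun i => v i x))).contDiffAt (n := n)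
  exact h.comp x (hη.prodMk (contDiffAt_pi.2 hv))

theorem contDiffAt_alternating_comp [FiniteDimensional ℝ W] {η : X → V [⋀^Fin k]→L[ℝ] ℝ}
    {A : X → W →L[ℝ] V} {x : X} (hη : ContDiffAt ℝ n η x) (hA : ContDiffAt ℝ n A x) :
    ContDiffAt ℝ n (fun y => (η y).compContinuousLinearMap (A y)) x :=
  contDiffAt_alternating_iff.2 fun v =>
    contDiffAt_alternating_apply (v := fun i y => A y (v i)) hη
      fun _ => hA.clm_apply contDiffAt_const

theorem contDiffAt_wedge [FiniteDimensional ℝ V] {l : ℕ} {η : X → V [⋀^Fin k]→L[ℝ] ℝ}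
    {ζ : X → V [⋀^Fin l]→L[ℝ] ℝ} {x : X} (hη : ContDiffAt ℝ n η x) (hζ : ContDiffAt ℝ n ζ x) :
    ContDiffAt ℝ n (fun y => wedge (η y) (ζ y)) x := by
  refine contDiffAt_alternating_iff.2 fun v => ?_
  simp only [wedge_apply, wedgeSummand]
  exact ContDiffAt.sum fun σ _ => contDiffAt_const.mul
    ((contDiffAt_alternating_iff.1 hη _).mul (contDiffAt_alternating_iff.1 hζ _))

theorem contDiffAt_wedgePow [FiniteDimensional ℝ V] {η : X → V [⋀^Fin 2]→L[ℝ] ℝ} {x : X}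
    (hη : ContDiffAt ℝ n η x) (m : ℕ) : ContDiffAt ℝ n (fun y => wedgePow (η y) m) x := by
  induction m with
  | zero => exact contDiffAt_const
  | succ m ih => exact contDiffAt_wedge ih hη

theorem contDiffAt_extDeriv {η : X → X [⋀^Fin k]→L[ℝ] ℝ} {x : X} (hη : ContDiffAt ℝ ∞ η x) :
    ContDiffAt ℝ ∞ (extDeriv η) x :=
  (ContinuousAlternatingMap.alternatizeUncurryFinCLM ℝ X ℝ).contDiff.contDiffAt.comp x
    (hη.fderiv_right (by simp))

theorem extDeriv_one_apply {A : X → X [⋀^Fin 1]→L[ℝ] ℝ} {x : X} (hA : DifferentiableAt ℝ A x)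
    (v w : X) : extDeriv A x ![v, w] =
      fderiv ℝ (fun y => A y ![w]) x v - fderiv ℝ (fun y => A y ![v]) x w := by
  have h0 : Fin.removeNth 0 ![v, w] = ![w] := fun_fin_one_eq _
  have h1 : Fin.removeNth 1 ![v, w] = ![v] := fun_fin_one_eq _
  rw [extDeriv_apply hA, Fin.sum_univ_two, h0, h1]
  simp [sub_eq_add_neg]

theorem differentiableAt_alternating_apply {A : X → V [⋀^Fin k]→L[ℝ] ℝ} {x : X}
    (hA : DifferentiableAt ℝ A x) (v : Fin k → V) : DifferentiableAt ℝ (fun y => A y v) x :=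
  (ContinuousAlternatingMap.apply ℝ V ℝ v).differentiableAt.comp x hA

/-- This is the Leibniz rule with the term A ∧ dB dropped. -/
theorem extDeriv_wedge_closed [FiniteDimensional ℝ X] {A B : X → X [⋀^Fin 1]→L[ℝ] ℝ} {x : X}
    (hA : ContDiffAt ℝ ∞ A x) (hB : ContDiffAt ℝ ∞ B x) (hB' : extDeriv B x = 0) :
    extDeriv (fun y => wedge (A y) (B y)) x = wedge (extDeriv A x) (B x) := by
  have hdA := hA.differentiableAt (by simp)
  have hdB := hB.differentiableAt (by simp)
  have dA := fun v => differentiableAt_alternating_apply hdA v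
  have dB := fun v => differentiableAt_alternating_apply hdB v
  have hw := (contDiffAt_wedge hA hB).differentiableAt (by simp)
  -- Closedness of `B` says that its derivative is symmetric, which is what cancels the terms
  -- containing derivatives of `B`.
  have hsym : ∀ v w, fderiv ℝ (fun y => B y ![w]) x v = fderiv ℝ (fun y => B y ![v]) x w := by
    intro v w
    have := extDeriv_one_apply hdB v w
    rw [hB'] at this
    exact (sub_eq_zero.1 this.symm)
  ext v
  have hv : v = ![v 0, v 1, v 2] := by ext i; fin_cases i <;> rfl
  generalize v 0 = a, v 1 = b, v 2 = c at hv
  subst hv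
  have h0 : Fin.removeNth 0 ![a, b, c] = ![b, c] := fun_fin_two_eq _
  have h1 : Fin.removeNth 1 ![a, b, c] = ![a, c] := fun_fin_two_eq _
  have h2 : Fin.removeNth 2 ![a, b, c] = ![a, b] := fun_fin_two_eq _
  have hr : ∀ p q r, fderiv ℝ (fun y => wedge (A y) (B y) ![p, q]) x r =
      (A x ![p] * fderiv ℝ (fun y => B y ![q]) x r + B x ![q] * fderiv ℝ (fun y => A y ![p]) x r) -
      (A x ![q] * fderiv ℝ (fun y => B y ![p]) x r +
        B x ![p] * fderiv ℝ (fun y => A y ![q]) x r) := by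
    intro p q r
    simp only [wedge_one_one]
    rw [fderiv_fun_sub ((dA _).fun_mul (dB _)) ((dA _).fun_mul (dB _)), fderiv_fun_mul (dA _)
      (dB _),
      fderiv_fun_mul (dA _) (dB _)]
    simp
  rw [wedge_two_one, extDeriv_apply hw, Fin.sum_univ_three, h0, h1, h2, hr, hr, hr,
    extDeriv_one_apply hdA, extDeriv_one_apply hdA, extDeriv_one_apply hdA]
  simp only [Matrix.cons_val_zero, Matrix.cons_val_one, Matrix.cons_val_two, Matrix.head_cons,
    Matrix.tail_cons, Fin.val_zero, Fin.val_one, Fin.val_two]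
  rw [hsym c b, hsym c a, hsym b a]
  ring

theorem extDeriv_smul_apply {g : X → ℝ} {A : X → X [⋀^Fin 1]→L[ℝ] ℝ} {x : X}
    (hg : DifferentiableAt ℝ g x) (hA : DifferentiableAt ℝ A x) (v w : X) :
    extDeriv (fun y => g y • A y) x ![v, w] = g x * extDeriv A x ![v, w] +
      (fderiv ℝ g x v * A x ![w] - fderiv ℝ g x w * A x ![v]) := by
  have dA := fun v => differentiableAt_alternating_apply hA v
  have hr : ∀ p r, fderiv ℝ (fun y => (g y • A y) ![p]) x r =
      g x * fderiv ℝ (fun y => A y ![p]) x r + A x ![p] * fderiv ℝ g x r := by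
    intro p r
    have : (fun y => (g y • A y) ![p]) = fun y => g y * A y ![p] := rfl
    rw [this, fderiv_fun_mul hg (dA _)]
    simp
  rw [extDeriv_one_apply (A := fun y => g y • A y) (hg.smul hA), extDeriv_one_apply hA, hr, hr]
  ring

end AlternatingCalculus

/-! ### Calculus of differential forms on manifolds without boundary -/

section FormCalculus

variable {E : Type*} [NormedAddCommGroup E] [NormedSpace ℝ E]
  {H : Type*} [TopologicalSpace H] {I : ModelWithCorners ℝ E H}
  {M : Type*} [TopologicalSpace M] [ChartedSpace H M]
  {E' : Type*} [NormedAddCommGroup E'] [NormedSpace ℝ E']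
  {H' : Type*} [TopologicalSpace H'] {J : ModelWithCorners ℝ E' H'}
  {N : Type*} [TopologicalSpace N] [ChartedSpace H' N]
  {X : Type*} [NormedAddCommGroup X] [NormedSpace ℝ X] {k l : ℕ}

/-- The pullback of a form to a normed space, as a family of alternating forms. -/
def pullRep (F : X → M) (η : DForm I M k) (y : X) : X [⋀^Fin k]→L[ℝ] ℝ :=
  (η (F y)).compContinuousLinearMap (mfderiv 𝓘(ℝ, X) I F y)

theorem pullRep_apply (F : X → M) (η : DForm I M k) (y : X) (v : Fin k → X) :
    pullRep F η y v = η (F y) fun i => mfderiv 𝓘(ℝ, X) I F y (v i) := rfl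

theorem pullback_apply (f : M → N) (η : DForm J N k) (x : M) (v : Fin k → TangentSpace I x) :
    pullback (I := I) f η x v = η (f x) fun i => mfderiv I J f x (v i) := rfl

theorem chartRep_eq_pullRep [I.Boundaryless] (η : DForm I M k) (x₀ : M) (y : E) :
    chartRep η x₀ y = pullRep (extChartAt I x₀).symm η y := by
  rw [chartRep, pullRep, I.range_eq_univ, mfderivWithin_univ]

/-- All tangent spaces are the model space by definition, so forms at propositionally equal points
can be compared on the same vectors without transport. -/
theorem form_apply_congr (η : DForm I M k) {x z : M} (h : x = z) (w : Fin k → E) :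
    (η x : E [⋀^Fin k]→L[ℝ] ℝ) w = (η z : E [⋀^Fin k]→L[ℝ] ℝ) w := by
  subst h
  rfl

theorem pullRep_congr {F G : X → M} (η : DForm I M k) {y : X} (h : F =ᶠ[𝓝 y] G) :
    pullRep F η y = pullRep G η y := by
  ext v
  rw [pullRep_apply, pullRep_apply, h.mfderiv_eq]
  exact form_apply_congr η h.self_of_nhds _

theorem pullRep_comp_left (F : X → M) (f : M → N) (η : DForm J N k) {y : X}
    (hF : MDifferentiableAt 𝓘(ℝ, X) I F y) (hf : MDifferentiableAt I J f (F y)) :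
    pullRep F (pullback (I := I) f η) y = pullRep (f ∘ F) η y := by
  ext v
  rw [pullRep_apply, pullRep_apply, mfderiv_comp y hf hF]
  rfl

theorem pullRep_comp_right {Y : Type*} [NormedAddCommGroup Y] [NormedSpace ℝ Y] (F : X → M)
    (G : Y → X) (η : DForm I M k) {y : Y} (hF : MDifferentiableAt 𝓘(ℝ, X) I F (G y))
    (hG : DifferentiableAt ℝ G y) :
    pullRep (F ∘ G) η y = (pullRep F η (G y)).compContinuousLinearMap (fderiv ℝ G y) := by
  ext v
  rw [pullRep_apply, mfderiv_comp y hF hG.mdifferentiableAt, mfderiv_eq_fderiv]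
  rfl

theorem pullback_comp {E'' : Type*} [NormedAddCommGroup E''] [NormedSpace ℝ E'']
    {H'' : Type*} [TopologicalSpace H''] {K : ModelWithCorners ℝ E'' H''}
    {P : Type*} [TopologicalSpace P] [ChartedSpace H'' P] (f : M → N) (g : N → P)
    (η : DForm K P k) {x : M} (hg : MDifferentiableAt J K g (f x))
    (hf : MDifferentiableAt I J f x) :
    pullback (I := I) f (pullback (I := J) g η) x = pullback (I := I) (g ∘ f) η x := by
  ext v
  rw [pullback_apply, pullback_apply, pullback_apply, mfderiv_comp x hg hf]
  rfl

theorem pullRep_wedgeForm (F : X → M) (η : DForm I M k) (ζ : DForm I M l) (y : X) :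
    pullRep F (wedgeForm η ζ) y = wedge (pullRep F η y) (pullRep F ζ y) :=
  (wedge_comp (V := E) (η (F y)) (ζ (F y)) (mfderiv 𝓘(ℝ, X) I F y)).symm

theorem pullback_wedgeForm (f : M → N) (η : DForm J N k) (ζ : DForm J N l) :
    pullback (I := I) f (wedgeForm η ζ) =
      wedgeForm (pullback (I := I) f η) (pullback (I := I) f ζ) :=
  funext fun x => (wedge_comp (V := E') (W := E) (η (f x)) (ζ (f x)) (mfderiv I J f x)).symm

theorem pullback_wedgePowForm (f : M → N) (η : DForm J N 2) (m : ℕ) :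
    pullback (I := I) f (wedgePowForm η m) = wedgePowForm (pullback (I := I) f η) m :=
  funext fun x => (wedgePow_comp (V := E') (W := E) (η (f x)) (mfderiv I J f x) m).symm

variable [I.Boundaryless] [IsManifold I ∞ M]

theorem contMDiffAt_extChartAt_symm {x₀ : M} {y : E} (hy : y ∈ (extChartAt I x₀).target) :
    ContMDiffAt 𝓘(ℝ, E) I ∞ (extChartAt I x₀).symm y :=
  (contMDiffOn_extChartAt_symm x₀).contMDiffAt ((isOpen_extChartAt_target x₀).mem_nhds hy)

theorem contMDiffAt_extChartAt_of_mem {x₀ x : M} (hx : x ∈ (extChartAt I x₀).source) :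
    ContMDiffAt I 𝓘(ℝ, E) ∞ (extChartAt I x₀) x :=
  contMDiffAt_extChartAt' (by rwa [extChartAt_source] at hx)

/-- Near `y` the map factors as ψ⁻¹ ∘ (ψ ∘ F) for the chart ψ at `x₀`. This reduces pullbacks from
the manifold to pullbacks between vector spaces. -/
theorem eventually_pullRep_eq {F : X → M} {y : X} (hF : ContMDiffAt 𝓘(ℝ, X) I ∞ F y) {x₀ : M}
    (hy : F y ∈ (extChartAt I x₀).source) (η : DForm I M k) :
    ∀ᶠ z in 𝓝 y, pullRep F η z = (chartRep η x₀ (extChartAt I x₀ (F z))).compContinuousLinearMap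
      (fderiv ℝ (fun z => extChartAt I x₀ (F z)) z) := by
  have h1 : ∀ᶠ z in 𝓝 y, F z ∈ (extChartAt I x₀).source :=
    hF.continuousAt.eventually_mem ((isOpen_extChartAt_source x₀).mem_nhds hy)
  have h2 : ∀ᶠ z in 𝓝 y, ContMDiffAt 𝓘(ℝ, X) I 1 F z := by
    have hF1 : ContMDiffAt 𝓘(ℝ, X) I 1 F y := hF.of_le (by simp)
    have : IsManifold I 1 M := IsManifold.of_le (n := ∞) (by simp)
    exact (contMDiffAt_iff_contMDiffAt_nhds (by simp)).1 hF1
  filter_upwards [h1.eventually_nhds, h2] with z hz hFz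
  have hz0 := hz.self_of_nhds
  have hc : ContMDiffAt I 𝓘(ℝ, E) ∞ (extChartAt I x₀) (F z) := contMDiffAt_extChartAt_of_mem hz0
  have hs : ContMDiffAt 𝓘(ℝ, E) I ∞ (extChartAt I x₀).symm (extChartAt I x₀ (F z)) :=
    contMDiffAt_extChartAt_symm ((extChartAt I x₀).map_source hz0)
  have hG : DifferentiableAt ℝ (fun z => extChartAt I x₀ (F z)) z :=
    (ContMDiffAt.comp z (hc.of_le (by simp)) hFz).contDiffAt.differentiableAt (by simp)
  rw [chartRep_eq_pullRep, ← pullRep_comp_right (extChartAt I x₀).symm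
    (fun z => extChartAt I x₀ (F z)) η
    (hs.mdifferentiableAt (by simp)) hG]
  refine pullRep_congr _ ?_
  filter_upwards [hz] with w hw
  exact ((extChartAt I x₀).left_inv hw).symm

theorem minSmoothness_two_le_infty : minSmoothness ℝ 2 ≤ ∞ := by
  rw [minSmoothness_of_isRCLikeNormedField]
  exact WithTop.coe_le_coe.2 le_top

theorem IsSmooth.contDiffAt_chartRep {η : DForm I M k} (hη : IsSmooth η) {x₀ : M} {y : E}
    (hy : y ∈ (extChartAt I x₀).target) : ContDiffAt ℝ ∞ (chartRep η x₀) y :=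
  (hη x₀).contDiffAt ((isOpen_extChartAt_target x₀).mem_nhds hy)

theorem contDiffAt_extChartAt_comp {F : X → M} {y : X} (hF : ContMDiffAt 𝓘(ℝ, X) I ∞ F y) {x₀ : M}
    (hy : F y ∈ (extChartAt I x₀).source) :
    ContDiffAt ℝ ∞ (fun z => extChartAt I x₀ (F z)) y :=
  (ContMDiffAt.comp y (contMDiffAt_extChartAt_of_mem hy) hF).contDiffAt

theorem IsSmooth.contDiffAt_pullRep [FiniteDimensional ℝ X] {η : DForm I M k} (hη : IsSmooth η)
    {F : X → M} {y : X} (hF : ContMDiffAt 𝓘(ℝ, X) I ∞ F y) : ContDiffAt ℝ ∞ (pullRep F η) y := by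
  have hy := mem_extChartAt_source (I := I) (F y)
  have hG := contDiffAt_extChartAt_comp hF hy
  refine ContDiffAt.congr_of_eventuallyEq ?_ (eventually_pullRep_eq hF hy η)
  exact contDiffAt_alternating_comp
    (ContDiffAt.comp y (hη.contDiffAt_chartRep ((extChartAt I (F y)).map_source hy)) hG)
    (hG.fderiv_right (by simp))

/-- The derivative at `F y` is defined in the chart at `F y`, which is the chart used to factor `F`;
naturality of d between vector spaces then finishes. Applied to an inverse chart, this yields
independence of the chart. -/
theorem pullRep_extD {η : DForm I M k} (hη : IsSmooth η)
    {F : X → M} {y : X} (hF : ContMDiffAt 𝓘(ℝ, X) I ∞ F y) :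
    pullRep F (extD η) y = extDeriv (pullRep F η) y := by
  have hy := mem_extChartAt_source (I := I) (F y)
  have hG := contDiffAt_extChartAt_comp hF hy
  have hc := hη.contDiffAt_chartRep ((extChartAt I (F y)).map_source hy)
  have he : pullRep F η =ᶠ[𝓝 y] _ := eventually_pullRep_eq hF hy η
  rw [he.extDeriv_eq,
    extDeriv_pullback (f := fun z => extChartAt I (F y) (F z)) (hc.differentiableAt (by simp)) hG
      minSmoothness_two_le_infty]
  ext v
  have hcF : MDifferentiableAt I 𝓘(ℝ, E) (extChartAt I (F y)) (F y) :=
    (contMDiffAt_extChartAt_of_mem hy).mdifferentiableAt (by simp)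
  have h1 := mfderiv_comp y hcF (hF.mdifferentiableAt (by simp))
  rw [mfderiv_eq_fderiv] at h1
  have h2 : fderiv ℝ (fun z => extChartAt I (F y) (F z)) y = _ := h1
  rw [h2, pullRep_apply, extD, I.range_eq_univ, extDerivWithin_univ]
  rfl

theorem isSmooth_iff {η : DForm I M k} : IsSmooth η ↔ ∀ x₀ : M, ∀ y ∈ (extChartAt I x₀).target,
    ContDiffAt ℝ ∞ (pullRep (extChartAt I x₀).symm η) y := by
  refine forall_congr' fun x₀ => ?_
  have h : chartRep η x₀ = pullRep (extChartAt I x₀).symm η :=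
    funext fun y => chartRep_eq_pullRep η x₀ y
  rw [h]
  refine ⟨fun hc y hy => hc.contDiffAt ((isOpen_extChartAt_target x₀).mem_nhds hy),
    fun hc y hy => (hc y hy).contDiffWithinAt⟩

theorem mfderiv_symm_extChartAt_apply {x₀ x : M} (hx : x ∈ (extChartAt I x₀).source)
    (v : TangentSpace I x) :
    mfderiv 𝓘(ℝ, E) I (extChartAt I x₀).symm (extChartAt I x₀ x)
      (mfderiv I 𝓘(ℝ, E) (extChartAt I x₀) x v) = v := by
  have : IsManifold I 1 M := IsManifold.of_le (n := ∞) (by simp)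
  have h := mfderivWithin_extChartAt_symm_comp_mfderiv_extChartAt' (I := I) hx
  rw [I.range_eq_univ, mfderivWithin_univ] at h
  exact DFunLike.congr_fun h v

/-- The derivative of the inverse chart is onto: it inverts the derivative of the chart. -/
theorem apply_eq_of_pullRep_eq {η ζ : DForm I M k} {x₀ x : M} (hx : x ∈ (extChartAt I x₀).source)
    (h : pullRep (extChartAt I x₀).symm η (extChartAt I x₀ x) =
      pullRep (extChartAt I x₀).symm ζ (extChartAt I x₀ x)) : η x = ζ x := by
  ext v
  have := DFunLike.congr_fun h fun i => mfderiv I 𝓘(ℝ, E) (extChartAt I x₀) x (v i)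
  have e : (extChartAt I x₀).symm (extChartAt I x₀ x) = x := (extChartAt I x₀).left_inv hx
  have key : ∀ (ξ : DForm I M k), ξ ((extChartAt I x₀).symm (extChartAt I x₀ x))
      (fun i => mfderiv 𝓘(ℝ, E) I (extChartAt I x₀).symm (extChartAt I x₀ x)
      (mfderiv I 𝓘(ℝ, E) (extChartAt I x₀) x (v i))) = ξ x v := by
    intro ξ
    have h2 : (fun i => mfderiv 𝓘(ℝ, E) I (extChartAt I x₀).symm (extChartAt I x₀ x)
      (mfderiv I 𝓘(ℝ, E) (extChartAt I x₀) x (v i))) = v :=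
      funext fun i => mfderiv_symm_extChartAt_apply hx (v i)
    have h3 : ∀ z (hz : z = x) (w : Fin k → E), (ξ z : E [⋀^Fin k]→L[ℝ] ℝ) w =
      (ξ x : E [⋀^Fin k]→L[ℝ] ℝ) w := by rintro z rfl w; rfl
    rw [← h3 _ e v]
    exact congrArg _ h2
  rw [← key η, ← key ζ]
  exact this

/-- Two forms are equal if their pullbacks by the inverse charts are. -/
theorem form_ext {η ζ : DForm I M k} (h : ∀ x₀ : M,
    pullRep (extChartAt I x₀).symm η (extChartAt I x₀ x₀) =
      pullRep (extChartAt I x₀).symm ζ (extChartAt I x₀ x₀)) : η = ζ :=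
  funext fun x => apply_eq_of_pullRep_eq (mem_extChartAt_source x) (h x)

end FormCalculus

/-! ### Smooth forms: pullback, exterior derivative, products -/

section SmoothForms

variable {E : Type*} [NormedAddCommGroup E] [NormedSpace ℝ E] [FiniteDimensional ℝ E]
  {H : Type*} [TopologicalSpace H] {I : ModelWithCorners ℝ E H}
  {M : Type*} [TopologicalSpace M] [ChartedSpace H M]
  {E' : Type*} [NormedAddCommGroup E'] [NormedSpace ℝ E'] [FiniteDimensional ℝ E']
  {H' : Type*} [TopologicalSpace H'] {J : ModelWithCorners ℝ E' H'}
  {N : Type*} [TopologicalSpace N] [ChartedSpace H' N]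
  {X : Type*} [NormedAddCommGroup X] [NormedSpace ℝ X] {k l : ℕ}
  [I.Boundaryless] [IsManifold I ∞ M] [J.Boundaryless] [IsManifold J ∞ N]

theorem eventually_pullRep_pullback {F : X → M} {y : X} (hF : ContMDiffAt 𝓘(ℝ, X) I ∞ F y)
    {f : M → N} (hf : ContMDiff I J ∞ f) (η : DForm J N k) :
    pullRep F (pullback (I := I) f η) =ᶠ[𝓝 y] pullRep (f ∘ F) η := by
  have hF1 : ContMDiffAt 𝓘(ℝ, X) I 1 F y := hF.of_le (by simp)
  have : IsManifold I 1 M := IsManifold.of_le (n := ∞) (by simp)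
  filter_upwards [(contMDiffAt_iff_contMDiffAt_nhds (by simp)).1 hF1] with z hz
  exact pullRep_comp_left F f η (hz.mdifferentiableAt (by simp))
    (hf.mdifferentiableAt (by simp))

theorem IsSmooth.pullback {f : M → N} (hf : ContMDiff I J ∞ f) {η : DForm J N k}
    (hη : IsSmooth η) : IsSmooth (pullback (I := I) f η) := by
  refine isSmooth_iff.2 fun x₀ y hy => ?_
  have hs := contMDiffAt_extChartAt_symm (I := I) hy
  exact (hη.contDiffAt_pullRep (hf.contMDiffAt.comp y hs)).congr_of_eventuallyEq
    (eventually_pullRep_pullback hs hf η)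

theorem extD_pullback {f : M → N} (hf : ContMDiff I J ∞ f) {η : DForm J N k}
    (hη : IsSmooth η) : extD (pullback (I := I) f η) = pullback (I := I) f (extD η) := by
  refine form_ext fun x₀ => ?_
  have hs := contMDiffAt_extChartAt_symm (I := I) (mem_extChartAt_target (I := I) x₀)
  rw [pullRep_extD (hη.pullback hf) hs, (eventually_pullRep_pullback hs hf η).extDeriv_eq,
    ← pullRep_extD hη (hf.contMDiffAt.comp _ hs),
    (eventually_pullRep_pullback hs hf (extD η)).self_of_nhds]

theorem eventually_pullRep_extD {η : DForm I M k} (hη : IsSmooth η) {x₀ : M} {y : E}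
    (hy : y ∈ (extChartAt I x₀).target) : pullRep (extChartAt I x₀).symm (extD η) =ᶠ[𝓝 y]
      extDeriv (pullRep (extChartAt I x₀).symm η) := by
  filter_upwards [(isOpen_extChartAt_target x₀).mem_nhds hy] with z hz
  exact pullRep_extD hη (contMDiffAt_extChartAt_symm hz)

theorem IsSmooth.extD {η : DForm I M k} (hη : IsSmooth η) : IsSmooth (extD η) := by
  refine isSmooth_iff.2 fun x₀ y hy => ?_
  exact (contDiffAt_extDeriv (isSmooth_iff.1 hη x₀ y hy)).congr_of_eventuallyEq
    (eventually_pullRep_extD hη hy)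

theorem extD_extD {η : DForm I M k} (hη : IsSmooth η) : ContactPair.extD (ContactPair.extD η) =
    0 := by
  refine form_ext fun x₀ => ?_
  have hy := mem_extChartAt_target (I := I) x₀
  rw [pullRep_extD hη.extD (contMDiffAt_extChartAt_symm hy),
    (eventually_pullRep_extD hη hy).extDeriv_eq,
    extDeriv_extDeriv_apply (isSmooth_iff.1 hη x₀ _ hy) minSmoothness_two_le_infty]
  rfl

theorem IsSmooth.add {η ζ : DForm I M k} (hη : IsSmooth η) (hζ : IsSmooth ζ) :
    IsSmooth (η + ζ) :=
  isSmooth_iff.2 fun x₀ y hy => (isSmooth_iff.1 hη x₀ y hy).add (isSmooth_iff.1 hζ x₀ y hy)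

theorem extD_add {η ζ : DForm I M k} (hη : IsSmooth η) (hζ : IsSmooth ζ) :
    ContactPair.extD (η + ζ) = ContactPair.extD η + ContactPair.extD ζ := by
  refine form_ext fun x₀ => ?_
  have hy := mem_extChartAt_target (I := I) x₀
  have hs := contMDiffAt_extChartAt_symm (I := I) hy
  have h1 := extDeriv_add ((isSmooth_iff.1 hη x₀ _ hy).differentiableAt (by simp))
    ((isSmooth_iff.1 hζ x₀ _ hy).differentiableAt (by simp))
  rw [← pullRep_extD hη hs, ← pullRep_extD hζ hs] at h1
  rw [pullRep_extD (hη.add hζ) hs]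
  exact h1

theorem IsSmooth.const_smul {η : DForm I M k} (hη : IsSmooth η) (c : ℝ) : IsSmooth (c • η) :=
  isSmooth_iff.2 fun x₀ y hy => (isSmooth_iff.1 hη x₀ y hy).const_smul c

theorem extD_const_smul {η : DForm I M k} (hη : IsSmooth η) (c : ℝ) :
    ContactPair.extD (c • η) = c • ContactPair.extD η := by
  refine form_ext fun x₀ => ?_
  have hy := mem_extChartAt_target (I := I) x₀
  have hs := contMDiffAt_extChartAt_symm (I := I) hy
  have h1 := extDeriv_smul (x := extChartAt I x₀ x₀) c (pullRep (extChartAt I x₀).symm η)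
  rw [← pullRep_extD hη hs] at h1
  rw [pullRep_extD (hη.const_smul c) hs]
  exact h1

theorem IsSmooth.wedgeForm {η : DForm I M k} {ζ : DForm I M l} (hη : IsSmooth η)
    (hζ : IsSmooth ζ) : IsSmooth (wedgeForm η ζ) := by
  refine isSmooth_iff.2 fun x₀ y hy => ?_
  have h := contDiffAt_wedge (isSmooth_iff.1 hη x₀ y hy) (isSmooth_iff.1 hζ x₀ y hy)
  exact h.congr_of_eventuallyEq (Eventually.of_forall fun z => pullRep_wedgeForm _ η ζ z)

theorem extD_wedgeForm_closed {η ζ : DForm I M 1} (hη : IsSmooth η) (hζ : IsSmooth ζ)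
    (hζ' : ContactPair.extD ζ = 0) :
    ContactPair.extD (wedgeForm η ζ) = wedgeForm (ContactPair.extD η) ζ := by
  refine form_ext fun x₀ => ?_
  have hy := mem_extChartAt_target (I := I) x₀
  have hs := contMDiffAt_extChartAt_symm (I := I) hy
  have h0 : extDeriv (pullRep (extChartAt I x₀).symm ζ) (extChartAt I x₀ x₀) = 0 := by
    rw [← pullRep_extD hζ hs, hζ']
    rfl
  have h1 := extDeriv_wedge_closed (isSmooth_iff.1 hη x₀ _ hy) (isSmooth_iff.1 hζ x₀ _ hy) h0
  have h2 : pullRep (extChartAt I x₀).symm (ContactPair.wedgeForm η ζ) =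
    fun z => wedge (pullRep (extChartAt I x₀).symm η z) (pullRep (extChartAt I x₀).symm ζ z) :=
    funext fun z => pullRep_wedgeForm _ η ζ z
  rw [pullRep_extD (hη.wedgeForm hζ) hs, h2, h1, pullRep_wedgeForm, pullRep_extD hη hs]

theorem IsSmooth.smul {η : DForm I M k} (hη : IsSmooth η) {g : M → ℝ}
    (hg : ContMDiff I 𝓘(ℝ, ℝ) ∞ g) : IsSmooth (fun x => g x • η x : DForm I M k) := by
  refine isSmooth_iff.2 fun x₀ y hy => ?_
  have hs := contMDiffAt_extChartAt_symm (I := I) hy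
  exact (hg.contMDiffAt.comp y hs).contDiffAt.smul (isSmooth_iff.1 hη x₀ y hy)

/-- The exterior derivative of `g • η` on the kernel of `η`. -/
theorem extD_smul_apply_of_ker {η : DForm I M 1} (hη : IsSmooth η) {g : M → ℝ}
    (hg : ContMDiff I 𝓘(ℝ, ℝ) ∞ g) (x : M) (v w : E) (hv : (η x : E [⋀^Fin 1]→L[ℝ] ℝ) ![v] = 0)
    (hw : (η x : E [⋀^Fin 1]→L[ℝ] ℝ) ![w] = 0) :
    (ContactPair.extD (fun x => g x • η x : DForm I M 1) x : E [⋀^Fin 2]→L[ℝ] ℝ) ![v, w] =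
      g x * (ContactPair.extD η x : E [⋀^Fin 2]→L[ℝ] ℝ) ![v, w] := by
  have hx := mem_extChartAt_source (I := I) x
  have hy := mem_extChartAt_target (I := I) x
  have hs := contMDiffAt_extChartAt_symm (I := I) hy
  have hgs : DifferentiableAt ℝ (g ∘ (extChartAt I x).symm) (extChartAt I x x) :=
    (hg.contMDiffAt.comp _ hs).contDiffAt.differentiableAt (by simp)
  set A : E →L[ℝ] E := mfderiv I 𝓘(ℝ, E) (extChartAt I x) x with hA
  have key : ∀ (j : ℕ) (ξ : DForm I M j) (u : Fin j → E), (ξ x : E [⋀^Fin j]→L[ℝ] ℝ) u =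
      pullRep (extChartAt I x).symm ξ (extChartAt I x x) (fun i => A (u i)) := by
    intro j ξ u
    refine Eq.trans ?_ (form_apply_congr ξ ((extChartAt I x).left_inv hx).symm _)
    exact congrArg (ξ x : E [⋀^Fin j]→L[ℝ] ℝ)
      (funext fun i => (mfderiv_symm_extChartAt_apply hx (u i)).symm)
  have e1 : ∀ u : E, (fun i => A ((![u] : Fin 1 → E) i) : Fin 1 → E) = ![A u] :=
    fun u => fun_fin_one_eq _
  have e2 : (fun i => A ((![v, w] : Fin 2 → E) i) : Fin 2 → E) = ![A v, A w] :=
    fun_fin_two_eq _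
  have hgx : g ((extChartAt I x).symm (extChartAt I x x)) = g x := by
    rw [(extChartAt I x).left_inv hx]
  have hv' := ((congrArg _ (e1 v)).symm.trans (key 1 η ![v]).symm).trans hv
  have hw' := ((congrArg _ (e1 w)).symm.trans (key 1 η ![w]).symm).trans hw
  have hd : pullRep (extChartAt I x).symm (ContactPair.extD η) (extChartAt I x x) ![A v, A w] =
      (ContactPair.extD η x : E [⋀^Fin 2]→L[ℝ] ℝ) ![v, w] :=
    (congrArg _ e2).symm.trans (key 2 _ ![v, w]).symm
  refine (key 2 _ ![v, w]).trans ((congrArg _ e2).trans ?_)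
  rw [← hd, pullRep_extD (hη.smul hg) hs, pullRep_extD hη hs]
  refine (extDeriv_smul_apply hgs ((isSmooth_iff.1 hη x _ hy).differentiableAt (by simp))
    (A v) (A w)).trans ?_
  rw [hv', hw', Function.comp_apply, hgx]
  ring

variable (I) in
/-- The differential of a function, as a one-form. -/
def dFun (g : M → ℝ) : DForm I M 1 := fun x =>
  ContinuousAlternatingMap.ofSubsingleton ℝ E ℝ (0 : Fin 1) (mfderiv I 𝓘(ℝ, ℝ) g x)

theorem toFunctional_dFun (g : M → ℝ) (x : M) :
    toFunctional (V := E) (dFun I g x) = mfderiv I 𝓘(ℝ, ℝ) g x := by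
  ext v
  rfl

/-- On a vector space dg is the exterior derivative of the 0-form g, so that closedness of
differentials becomes d² = 0. -/
theorem pullRep_dFun {g : M → ℝ} {F : X → M} {y : X} (hg : MDifferentiableAt I 𝓘(ℝ, ℝ) g (F y))
    (hF : MDifferentiableAt 𝓘(ℝ, X) I F y) : pullRep F (dFun I g) y =
      extDeriv (fun z => ContinuousAlternatingMap.constOfIsEmpty ℝ X (Fin 0) (g (F z))) y := by
  rw [extDeriv_constOfIsEmpty]
  ext v
  have h := mfderiv_comp y hg hF
  rw [mfderiv_eq_fderiv] at h
  have h2 : fderiv ℝ (fun z => g (F z)) y = _ := h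
  rw [h2]
  rfl

theorem eventually_pullRep_eq_of_primitive {β : DForm I M 1} {F : X → M} {y : X} {g : M → ℝ}
    (hg : ContMDiffAt I 𝓘(ℝ, ℝ) ∞ g (F y)) (hβ : ∀ᶠ x in 𝓝 (F y), β x = dFun I g x)
    (hF : ContMDiffAt 𝓘(ℝ, X) I ∞ F y) : pullRep F β =ᶠ[𝓝 y]
      extDeriv (fun z => ContinuousAlternatingMap.constOfIsEmpty ℝ X (Fin 0) (g (F z))) := by
  have : IsManifold I 1 M := IsManifold.of_le (n := ∞) (by simp)
  have hF1 : ContMDiffAt 𝓘(ℝ, X) I 1 F y := hF.of_le (by simp)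
  have hg1 : ContMDiffAt I 𝓘(ℝ, ℝ) 1 g (F y) := hg.of_le (by simp)
  filter_upwards [(contMDiffAt_iff_contMDiffAt_nhds (by simp)).1 hF1, hF.continuousAt.eventually
    ((contMDiffAt_iff_contMDiffAt_nhds (by simp)).1 hg1), hF.continuousAt.eventually hβ]
    with z h1 h2 h3
  rw [← pullRep_dFun (h2.mdifferentiableAt (by simp)) (h1.mdifferentiableAt (by simp))]
  ext v
  rw [pullRep_apply, pullRep_apply, h3]

theorem contDiffAt_constOfIsEmpty_comp {g : M → ℝ} {F : X → M} {y : X}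
    (hg : ContMDiffAt I 𝓘(ℝ, ℝ) ∞ g (F y)) (hF : ContMDiffAt 𝓘(ℝ, X) I ∞ F y) :
    ContDiffAt ℝ ∞ (fun z => ContinuousAlternatingMap.constOfIsEmpty ℝ X (Fin 0) (g (F z))) y :=
  (ContinuousAlternatingMap.constOfIsEmptyLIE ℝ X ℝ (Fin 0)).contDiff.contDiffAt.comp y
    (ContMDiffAt.comp y hg hF).contDiffAt

theorem isSmooth_of_forall_primitive {β : DForm I M 1} (h : ∀ x, ∃ g : M → ℝ,
    ContMDiffAt I 𝓘(ℝ, ℝ) ∞ g x ∧ ∀ᶠ y in 𝓝 x, β y = dFun I g y) : IsSmooth β := by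
  refine isSmooth_iff.2 fun x₀ y hy => ?_
  have hs := contMDiffAt_extChartAt_symm (I := I) hy
  obtain ⟨g, hg, hβ⟩ := h ((extChartAt I x₀).symm y)
  exact (contDiffAt_extDeriv (contDiffAt_constOfIsEmpty_comp hg hs)).congr_of_eventuallyEq
    (eventually_pullRep_eq_of_primitive hg hβ hs)

theorem extD_eq_zero_of_forall_primitive {β : DForm I M 1} (h : ∀ x, ∃ g : M → ℝ,
    ContMDiffAt I 𝓘(ℝ, ℝ) ∞ g x ∧ ∀ᶠ y in 𝓝 x, β y = dFun I g y) : ContactPair.extD β = 0 := by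
  refine form_ext fun x₀ => ?_
  have hy := mem_extChartAt_target (I := I) x₀
  have hs := contMDiffAt_extChartAt_symm (I := I) hy
  obtain ⟨g, hg, hβ⟩ := h ((extChartAt I x₀).symm (extChartAt I x₀ x₀))
  rw [pullRep_extD (isSmooth_of_forall_primitive h) hs,
    (eventually_pullRep_eq_of_primitive hg hβ hs).extDeriv_eq,
    extDeriv_extDeriv_apply (contDiffAt_constOfIsEmpty_comp hg hs) minSmoothness_two_le_infty]
  rfl

end SmoothForms

/-! ### The Reeb-type vector field of a generalized contact pair -/

section System

variable {V : Type*} [NormedAddCommGroup V] [NormedSpace ℝ V]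
  {X : Type*} [NormedAddCommGroup X] [NormedSpace ℝ X]

theorem contDiffAt_clm_of_apply [FiniteDimensional ℝ V] {W : Type*} [NormedAddCommGroup W]
    [NormedSpace ℝ W] {f : X → V →L[ℝ] W} {x : X} {n : WithTop ℕ∞}
    (h : ∀ v, ContDiffAt ℝ n (fun y => f y v) x) : ContDiffAt ℝ n f x := by
  let d := Module.finrank ℝ V
  have hd : d = Module.finrank ℝ (Fin d → ℝ) := (Module.finrank_fin_fun ℝ).symm
  let e₁ := ContinuousLinearEquiv.ofFinrankEq hd
  let e₂ := (e₁.arrowCongr (1 : W ≃L[ℝ] W)).trans (ContinuousLinearEquiv.piRing (Fin d))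
  rw [← Function.id_comp f, ← e₂.symm_comp_self]
  exact e₂.symm.contDiff.contDiffAt.comp x (contDiffAt_pi.mpr fun i => h _)

/-- The linear map `(v, s, t) ↦ (η(v, ·) - s α - t β, α v, β v)`. -/
def systemMap (α β : V [⋀^Fin 1]→L[ℝ] ℝ) (η : V [⋀^Fin 2]→L[ℝ] ℝ) :
    V × ℝ × ℝ →ₗ[ℝ] (V →L[ℝ] ℝ) × ℝ × ℝ where
  toFun p := (toFunctional (η.curryLeft p.1) - p.2.1 • toFunctional α - p.2.2 • toFunctional β,
    toFunctional α p.1, toFunctional β p.1)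
  map_add' p q := by
    refine Prod.ext (ContinuousLinearMap.ext fun w => ?_) (Prod.ext ?_ ?_)
    · simp [toFunctional_apply]; ring
    · simp
    · simp
  map_smul' c p := by
    refine Prod.ext (ContinuousLinearMap.ext fun w => ?_) (Prod.ext ?_ ?_)
    · simp [toFunctional_apply]; ring
    · simp
    · simp

theorem systemMap_fst_apply (α β : V [⋀^Fin 1]→L[ℝ] ℝ) (η : V [⋀^Fin 2]→L[ℝ] ℝ)
    (p : V × ℝ × ℝ) (w : V) : (systemMap α β η p).1 w =
      η ![p.1, w] - p.2.1 * toFunctional α w - p.2.2 * toFunctional β w := by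
  simp [systemMap, toFunctional_apply]

theorem systemMap_snd (α β : V [⋀^Fin 1]→L[ℝ] ℝ) (η : V [⋀^Fin 2]→L[ℝ] ℝ)
    (p : V × ℝ × ℝ) : (systemMap α β η p).2 = (toFunctional α p.1, toFunctional β p.1) := rfl

/-- The right-hand side (0, 0, 1) encodes the three conditions on the vector field: η(v, ·) = sα +
tβ, α(v) = 0 and β(v) = 1. -/
theorem systemMap_eq_iff {α β : V [⋀^Fin 1]→L[ℝ] ℝ} {η : V [⋀^Fin 2]→L[ℝ] ℝ}
    {p : V × ℝ × ℝ} : systemMap α β η p = (0, 0, 1) ↔ (∀ w, η ![p.1, w] =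
      p.2.1 * toFunctional α w + p.2.2 * toFunctional β w) ∧ toFunctional α p.1 = 0 ∧
        toFunctional β p.1 = 1 := by
  rw [Prod.ext_iff, systemMap_snd, Prod.ext_iff]
  refine and_congr ?_ Iff.rfl
  rw [ContinuousLinearMap.ext_iff]
  refine forall_congr' fun w => ?_
  rw [systemMap_fst_apply]
  change _ = (0 : ℝ) ↔ _
  constructor <;> intro h <;> linarith

/-- A kernel element (v, s, t) has `v` in the common kernel of α and β and η(v, ·) zero there, so v
= 0 by nondegeneracy; a dual pair of vectors then gives s = t = 0. Both sides have dimension dim V +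
2. -/
theorem systemMap_bijective [FiniteDimensional ℝ V] {h : ℕ} {α β : V [⋀^Fin 1]→L[ℝ] ℝ}
    {η : V [⋀^Fin 2]→L[ℝ] ℝ} (hV : Module.finrank ℝ V = 2 * h + 2)
    (hv : wedge (wedge α (wedgePow η h)) β ≠ 0) : Function.Bijective (systemMap α β η) := by
  have hinj : Function.Injective (systemMap α β η) := by
    refine (injective_iff_map_eq_zero _).2 fun p hp => ?_
    have h1 : ∀ w, η ![p.1, w] = p.2.1 * toFunctional α w + p.2.2 * toFunctional β w := by
      intro w
      have := systemMap_fst_apply α β η p w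
      rw [hp] at this
      change (0 : ℝ) = _ at this
      linarith
    have h2 := systemMap_snd α β η p
    rw [hp] at h2
    have hα : toFunctional α p.1 = 0 := (Prod.ext_iff.1 h2).1.symm
    have hβ : toFunctional β p.1 = 0 := (Prod.ext_iff.1 h2).2.symm
    have hp0 : p.1 = 0 := nondegenerate_of_wedge_ne_zero hV hv p.1 hα hβ fun w hw1 hw2 => by
      rw [h1, hw1, hw2]; ring
    obtain ⟨r, x, hαr, hβr, hαx, hβx⟩ := exists_dual_pair hV hv
    have hz : ∀ w, η ![p.1, w] = 0 := fun w => by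
      rw [hp0]
      exact η.toAlternatingMap.map_coord_zero (m := ![0, w]) 0 rfl
    have h3 := h1 r
    have h4 := h1 x
    rw [hz, hαr, hβr] at h3
    rw [hz, hαx, hβx] at h4
    exact Prod.ext hp0 (Prod.ext (by simpa using h3.symm) (by simpa using h4.symm))
  refine ⟨hinj, (LinearMap.injective_iff_surjective_of_finrank_eq_finrank ?_).1 hinj⟩
  have hd : Module.finrank ℝ (V →L[ℝ] ℝ) = Module.finrank ℝ V :=
    (LinearMap.toContinuousLinearMap : (V →ₗ[ℝ] ℝ) ≃ₗ[ℝ] (V →L[ℝ] ℝ)).finrank_eq.symm.trans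
      Subspace.dual_finrank_eq
  rw [Module.finrank_prod, Module.finrank_prod (M := V →L[ℝ] ℝ), hd, Module.finrank_prod]

theorem contDiffAt_toFunctional {α : X → V [⋀^Fin 1]→L[ℝ] ℝ} {x : X} {n : WithTop ℕ∞}
    (hα : ContDiffAt ℝ n α x) {v : X → V} (hv : ContDiffAt ℝ n v x) :
    ContDiffAt ℝ n (fun y => toFunctional (α y) (v y)) x := by
  simp only [toFunctional, ContinuousAlternatingMap.ofSubsingleton]
  exact contDiffAt_alternating_apply (v := fun _ => v) hα fun _ => hv

/-- The solution is the inverse operator applied to a constant vector, and inversion of operators is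
smooth. -/
theorem contDiffAt_systemMap_solution [FiniteDimensional ℝ V] {h : ℕ}
    {α β : X → V [⋀^Fin 1]→L[ℝ] ℝ} {η : X → V [⋀^Fin 2]→L[ℝ] ℝ} {x : X} {n : WithTop ℕ∞}
    (hV : Module.finrank ℝ V = 2 * h + 2)
    (hv : wedge (wedge (α x) (wedgePow (η x) h)) (β x) ≠ 0) (hα : ContDiffAt ℝ n α x)
    (hβ : ContDiffAt ℝ n β x) (hη : ContDiffAt ℝ n η x) {p : X → V × ℝ × ℝ}
    (hp : ∀ᶠ y in 𝓝 x, systemMap (α y) (β y) (η y) (p y) = (0, 0, 1)) : ContDiffAt ℝ n p x := by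
  let L : X → (V × ℝ × ℝ) →L[ℝ] (V →L[ℝ] ℝ) × ℝ × ℝ := fun y =>
    LinearMap.toContinuousLinearMap (systemMap (α y) (β y) (η y))
  have hL : ContDiffAt ℝ n L x := by
    refine contDiffAt_clm_of_apply fun q => ?_
    refine ContDiffAt.prodMk ?_ ((contDiffAt_toFunctional hα contDiffAt_const).prodMk
      (contDiffAt_toFunctional hβ contDiffAt_const))
    refine contDiffAt_clm_of_apply fun w => ?_
    have h0 : (fun y => (systemMap (α y) (β y) (η y) q).1 w) = fun y => (η y) ![q.1, w] -
      q.2.1 * toFunctional (α y) w - q.2.2 * toFunctional (β y) w :=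
      funext fun y => systemMap_fst_apply _ _ _ _ _
    change ContDiffAt ℝ n (fun y => (systemMap (α y) (β y) (η y) q).1 w) x
    rw [h0]
    exact ((contDiffAt_alternating_iff.1 hη _).sub
      (contDiffAt_const.mul (contDiffAt_toFunctional hα contDiffAt_const))).sub
      (contDiffAt_const.mul (contDiffAt_toFunctional hβ contDiffAt_const))
  let e : (V × ℝ × ℝ) ≃L[ℝ] (V →L[ℝ] ℝ) × ℝ × ℝ :=
    (LinearEquiv.ofBijective _ (systemMap_bijective hV hv)).toContinuousLinearEquiv
  have he : (e : (V × ℝ × ℝ) →L[ℝ] (V →L[ℝ] ℝ) × ℝ × ℝ) = L x :=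
    ContinuousLinearMap.ext fun q => rfl
  have hinv : ContDiffAt ℝ n (fun y => ContinuousLinearMap.inverse (L y) (0, 0, 1)) x := by
    refine ContDiffAt.clm_apply ?_ contDiffAt_const
    refine ContDiffAt.comp (g := ContinuousLinearMap.inverse) x ?_ hL
    rw [← he]
    exact contDiffAt_map_inverse e
  refine hinv.congr_of_eventuallyEq ?_
  -- Invertibility is assumed only at `x`; it persists nearby because invertible operators form an
  -- open set.
  have hopen : ∀ᶠ y in 𝓝 x, L y ∈ range ((↑) : ((V × ℝ × ℝ) ≃L[ℝ] (V →L[ℝ] ℝ) × ℝ × ℝ) →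
      (V × ℝ × ℝ) →L[ℝ] (V →L[ℝ] ℝ) × ℝ × ℝ) := by
    refine hL.continuousAt ?_
    rw [← he]
    exact ContinuousLinearEquiv.nhds e
  filter_upwards [hp, hopen] with y hy hLy
  obtain ⟨e', he'⟩ := hLy
  rw [← he', ContinuousLinearMap.inverse_equiv]
  have h1 : e' (p y) = (0, 0, 1) := by
    have : L y (p y) = (0, 0, 1) := hy
    rw [← he'] at this
    exact this
  rw [← h1]
  exact (e'.symm_apply_apply (p y)).symm

end System

/-! ### Smooth vector fields, and the field determined by the linear system -/

section VectorField

variable {E : Type*} [NormedAddCommGroup E] [NormedSpace ℝ E]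
  {H : Type*} [TopologicalSpace H] {I : ModelWithCorners ℝ E H}
  {M : Type*} [TopologicalSpace M] [ChartedSpace H M] [I.Boundaryless] [IsManifold I ∞ M]

variable (I) in
/-- The representative of a vector field in the chart at `x₀`. -/
def vecRep (v : ∀ x : M, TangentSpace I x) (x₀ : M) (y : E) : E :=
  mfderiv I 𝓘(ℝ, E) (extChartAt I x₀) ((extChartAt I x₀).symm y) (v ((extChartAt I x₀).symm y))

variable (I) in
/-- A vector field is smooth if its representatives in charts are. -/
def IsSmoothVec (v : ∀ x : M, TangentSpace I x) : Prop :=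
  ∀ x₀ : M, ∀ y ∈ (extChartAt I x₀).target, ContDiffAt ℝ ∞ (vecRep I v x₀) y

theorem mdifferentiableAt_extChartAt_symm' {x₀ : M} {y : E} (hy : y ∈ (extChartAt I x₀).target) :
    MDifferentiableAt 𝓘(ℝ, E) I (extChartAt I x₀).symm y :=
  (contMDiffAt_extChartAt_symm hy).mdifferentiableAt (by simp)

theorem mfderiv_symm_vecRep (v : ∀ x : M, TangentSpace I x) {x₀ : M} {y : E}
    (hy : y ∈ (extChartAt I x₀).target) :
    mfderiv 𝓘(ℝ, E) I (extChartAt I x₀).symm y (vecRep (E := E) I v x₀ y) =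
      v ((extChartAt I x₀).symm y) := by
  have h := mfderiv_symm_extChartAt_apply ((extChartAt I x₀).map_target hy)
    (v ((extChartAt I x₀).symm y))
  rwa [(extChartAt I x₀).right_inv hy] at h

/-- This is the form in which existence and uniqueness theorems for integral curves take a vector
field; C¹ regularity is enough for them. -/
theorem IsSmoothVec.contMDiff {v : ∀ x : M, TangentSpace I x} (hv : IsSmoothVec I v) :
    haveI : IsManifold I 1 M := IsManifold.of_le (n := ∞) (by simp)
    ContMDiff I (I.prod 𝓘(ℝ, E)) 1 (fun x => (⟨x, v x⟩ : TangentBundle I M)) := by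
  have : IsManifold I 1 M := IsManifold.of_le (n := ∞) (by simp)
  intro x₀
  refine (Bundle.contMDiffAt_section x₀).2 ?_
  have h1 : ContMDiffAt I 𝓘(ℝ, E) 1 (fun x => vecRep I v x₀ (extChartAt I x₀ x)) x₀ :=
    ContMDiffAt.comp x₀ ((hv x₀ _ (mem_extChartAt_target x₀)).of_le (by simp)).contMDiffAt
      ((contMDiffAt_extChartAt_of_mem (mem_extChartAt_source x₀)).of_le (by simp))
  refine h1.congr_of_eventuallyEq ?_
  filter_upwards [(isOpen_extChartAt_source (I := I) x₀).mem_nhds (mem_extChartAt_source x₀)]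
    with x hx
  have hx' : x ∈ (chartAt H x₀).source := by rwa [extChartAt_source] at hx
  have h2 := TangentBundle.continuousLinearMapAt_trivializationAt (I := I) hx'
  have h3 : (trivializationAt E (TangentSpace I) x₀ ⟨x, v x⟩).2 =
      mfderiv I 𝓘(ℝ, E) (extChartAt I x₀) x (v x) := by
    rw [← h2]
    exact (Bundle.Trivialization.continuousLinearMapAt_apply_of_mem (R := ℝ)
      (trivializationAt E (TangentSpace I) x₀) (b := x) (by simpa using hx') (v x)).symm
  rw [h3, vecRep, (extChartAt I x₀).left_inv hx]

variable [FiniteDimensional ℝ E]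

/-- The vector field `X` in the kernel of `α` with `β X = 1` and `η(X, ·) = f α + g β`. -/
theorem exists_vectorField {h : ℕ} {α β : DForm I M 1} {η : DForm I M 2}
    (hE : Module.finrank ℝ E = 2 * h + 2) (hα : IsSmooth α) (hβ : IsSmooth β) (hη : IsSmooth η)
    (hv : ∀ x, wedgeForm (wedgeForm α (wedgePowForm η h)) β x ≠ 0) :
    ∃ (v : ∀ x : M, TangentSpace I x) (f g : M → ℝ), IsSmoothVec I v ∧ ContMDiff I 𝓘(ℝ, ℝ) ∞ f ∧
      ContMDiff I 𝓘(ℝ, ℝ) ∞ g ∧ ∀ x, toFunctional (V := E) (α x) (v x) = 0 ∧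
        toFunctional (V := E) (β x) (v x) = 1 ∧ ∀ w : E, (η x : E [⋀^Fin 2]→L[ℝ] ℝ) ![v x, w] =
          f x * toFunctional (V := E) (α x) w + g x * toFunctional (V := E) (β x) w := by
  have hsol : ∀ x, ∃ p : E × ℝ × ℝ, systemMap (V := E) (α x) (β x) (η x) p = (0, 0, 1) :=
    fun x => (systemMap_bijective (V := E) hE (hv x)).2 _
  choose p hp using hsol
  have hp' := fun x => (systemMap_eq_iff (V := E)).1 (hp x)
  -- In a chart, the representative of the field together with the two coefficients solves the
  -- system for the represented forms, so all three are smooth at once.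
  have key : ∀ x₀ : M, ∀ y ∈ (extChartAt I x₀).target, ContDiffAt ℝ ∞ (fun y =>
      (vecRep I (fun x => (p x).1) x₀ y, (p ((extChartAt I x₀).symm y)).2)) y := by
    intro x₀ y hy
    refine contDiffAt_systemMap_solution (h := h) hE ?_ (isSmooth_iff.1 hα x₀ y hy)
      (isSmooth_iff.1 hβ x₀ y hy) (isSmooth_iff.1 hη x₀ y hy) ?_
    · have h1 : wedge (wedge (pullRep (extChartAt I x₀).symm α y)
          (wedgePow (pullRep (extChartAt I x₀).symm η y) h)) (pullRep (extChartAt I x₀).symm β y) =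
          pullRep (extChartAt I x₀).symm (wedgeForm (wedgeForm α (wedgePowForm η h)) β) y := by
        rw [pullRep_wedgeForm, pullRep_wedgeForm]
        congr 2
        exact wedgePow_comp (V := E) _ _ _
      rw [h1]
      intro h0
      refine hv ((extChartAt I x₀).symm y) (ContinuousAlternatingMap.ext fun u => ?_)
      have h2 := DFunLike.congr_fun h0 fun i => mfderiv I 𝓘(ℝ, E) (extChartAt I x₀)
        ((extChartAt I x₀).symm y) (u i)
      refine Eq.trans ?_ h2
      refine congrArg (wedgeForm (wedgeForm α (wedgePowForm η h)) β ((extChartAt I x₀).symm y))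
        (funext fun i => ?_)
      have h3 := mfderiv_symm_extChartAt_apply ((extChartAt I x₀).map_target hy) (u i)
      rw [(extChartAt I x₀).right_inv hy] at h3
      exact h3.symm
    · filter_upwards [(isOpen_extChartAt_target x₀).mem_nhds hy] with z hz
      obtain ⟨h1, h2, h3⟩ := hp' ((extChartAt I x₀).symm z)
      have hA := mfderiv_symm_vecRep (I := I) (fun x => (p x).1) hz
      have hf : ∀ (a : DForm I M 1) (w : E), toFunctional (pullRep (extChartAt I x₀).symm a z) w =
        toFunctional (V := E) (a ((extChartAt I x₀).symm z))
          (mfderiv 𝓘(ℝ, E) I (extChartAt I x₀).symm z w) := fun a w => rfl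
      refine systemMap_eq_iff.2 ⟨fun w => ?_, ?_, ?_⟩
      · rw [hf, hf]
        refine Eq.trans ?_ (h1 _)
        rw [pullRep_apply]
        refine congrArg (η ((extChartAt I x₀).symm z)) ((fun_fin_two_eq (X := E) _).trans ?_)
        exact congrArg₂ (fun a b : E => ![a, b]) hA rfl
      · exact (hf _ _).trans ((congrArg _ hA).trans h2)
      · exact (hf _ _).trans ((congrArg _ hA).trans h3)
  have hfun : ∀ x₀ : M, ContMDiffAt I 𝓘(ℝ, ℝ × ℝ) ∞ (fun x => (p x).2) x₀ := by
    intro x₀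
    have h1 := contDiff_snd.contDiffAt.comp _ (key x₀ _ (mem_extChartAt_target x₀))
    have h2 := ContMDiffAt.comp x₀ h1.contMDiffAt
      (contMDiffAt_extChartAt_of_mem (mem_extChartAt_source x₀))
    refine h2.congr_of_eventuallyEq ?_
    filter_upwards [(isOpen_extChartAt_source (I := I) x₀).mem_nhds (mem_extChartAt_source x₀)]
      with x hx
    exact congrArg (fun z => (p z).2) ((extChartAt I x₀).left_inv hx).symm
  refine ⟨fun x => (p x).1, fun x => (p x).2.1, fun x => (p x).2.2,
    fun x₀ y hy => (key x₀ y hy).fst, fun x => ?_, fun x => ?_, fun x => ⟨(hp' x).2.1, (hp' x).2.2,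
      (hp' x).1⟩⟩
  · exact (contDiff_fst (𝕜 := ℝ) (E := ℝ) (F := ℝ)).contDiffAt.contMDiffAt.comp x (hfun x)
  · exact (contDiff_snd (𝕜 := ℝ) (E := ℝ) (F := ℝ)).contDiffAt.contMDiffAt.comp x (hfun x)

end VectorField

/-! ### Smooth dependence of solutions of differential equations on initial conditions -/

section Nemytskii

variable {K : Type*} [TopologicalSpace K] [CompactSpace K]
  {E F : Type*} [NormedAddCommGroup E] [NormedSpace ℝ E] [NormedAddCommGroup F] [NormedSpace ℝ F]

/-- Pointwise application of a family of continuous linear maps. -/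
def pointwiseApply : C(K, E →L[ℝ] F) →L[ℝ] C(K, E) →L[ℝ] C(K, F) :=
  LinearMap.mkContinuous₂ (LinearMap.mk₂ ℝ
    (fun (A : C(K, E →L[ℝ] F)) (u : C(K, E)) =>
      (⟨fun t => A t (u t), A.continuous.clm_apply u.continuous⟩ : C(K, F)))
    (fun A B u => by ext; simp) (fun c A u => by ext; simp)
    (fun A u v => by ext; simp) (fun c A u => by ext; simp)) 1 fun A u => by
      refine (ContinuousMap.norm_le _ (by positivity)).2 fun t => ?_
      rw [one_mul]
      exact ((A t).le_opNorm (u t)).trans (mul_le_mul (A.norm_coe_le_norm t)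
        (u.norm_coe_le_norm t) (by positivity) (by positivity))

/-- The derivative acts pointwise by v ↦ f'(u)v; the mean value inequality bounds the remainder at
each time, and compactness of the range of `u` makes the bound uniform. -/
theorem hasFDerivAt_postcomp {f : E → F} {f' : E → E →L[ℝ] F} (hf : ∀ x, HasFDerivAt f (f' x) x)
    (hf' : Continuous f') (hfc : Continuous f) (u : C(K, E)) :
    HasFDerivAt (fun w : C(K, E) => (⟨f, hfc⟩ : C(E, F)).comp w)
      (pointwiseApply ((⟨f', hf'⟩ : C(E, E →L[ℝ] F)).comp u)) u := by
  rw [hasFDerivAt_iff_isLittleO_nhds_zero, Asymptotics.isLittleO_iff]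
  intro c hc
  have hK : IsCompact (range u) := isCompact_range u.continuous
  -- Uniformity around a compact set is needed because nearby curves need not stay in the range of
  -- `u`.
  have hU := hK.uniformContinuousAt_of_continuousAt f' (fun a _ => hf'.continuousAt)
    (Metric.dist_mem_uniformity hc)
  obtain ⟨δ, hδ, hδU⟩ := Metric.mem_uniformity_dist.1 hU
  filter_upwards [Metric.ball_mem_nhds (0 : C(K, E)) hδ] with v hv
  rw [mem_ball_zero_iff] at hv
  refine (ContinuousMap.norm_le _ (by positivity)).2 fun t => ?_
  have hvt : ‖v t‖ ≤ ‖v‖ := v.norm_coe_le_norm t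
  have hb : ∀ z ∈ Metric.ball (u t) δ, ‖f' z - f' (u t)‖ ≤ c := by
    intro z hz
    have h1 : dist (u t) z < δ := by rw [dist_comm]; exact hz
    have h2 : dist (f' (u t)) (f' z) < c := hδU h1 ⟨t, rfl⟩
    rw [dist_comm, dist_eq_norm] at h2
    exact h2.le
  have h3 := (convex_ball (u t) δ).norm_image_sub_le_of_norm_hasFDerivWithin_le'
    (f := f) (f' := f') (fun z _ => (hf z).hasFDerivWithinAt) hb (Metric.mem_ball_self hδ)
    (y := u t + v t) (by rw [mem_ball_iff_norm, add_sub_cancel_left]; exact hvt.trans_lt hv)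
  rw [add_sub_cancel_left] at h3
  exact h3.trans (mul_le_mul_of_nonneg_left hvt hc.le)

end Nemytskii

/-- The derivative of postcomposition with `f` is pointwise application of postcomposition with f'.
The induction must range over all targets, since f' takes values in a space of operators, and these
stay in the universe of `E`. -/
theorem contDiff_postcomp_nat {K : Type*} [TopologicalSpace K] [CompactSpace K]
    {E : Type u} [NormedAddCommGroup E] [NormedSpace ℝ E] (n : ℕ) :
    ∀ {F : Type u} [NormedAddCommGroup F] [NormedSpace ℝ F] (f : C(E, F)), ContDiff ℝ n f →
      ContDiff ℝ n (fun w : C(K, E) => f.comp w) := by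
  induction n with
  | zero =>
    intro F _ _ f _
    exact contDiff_zero.2 (ContinuousMap.continuous_postcomp f)
  | succ n ih =>
    intro F _ _ f hf
    obtain ⟨f', hf', hff'⟩ := contDiff_succ_iff_hasFDerivAt.1 hf
    exact contDiff_succ_iff_hasFDerivAt.2 
      ⟨fun u => pointwiseApply ((⟨f', hf'.continuous⟩ : C(E, E →L[ℝ] F)).comp u),
        (ih (⟨f', hf'.continuous⟩ : C(E, E →L[ℝ] F)) hf').continuousLinearMap_comp
          (pointwiseApply (K := K) (E := E) (F := F)),
        fun u => hasFDerivAt_postcomp hff' hf'.continuous f.continuous u⟩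

theorem contDiff_postcomp {K : Type*} [TopologicalSpace K] [CompactSpace K]
    {E F : Type u} [NormedAddCommGroup E] [NormedSpace ℝ E] [NormedAddCommGroup F]
    [NormedSpace ℝ F] (f : C(E, F)) (hf : ContDiff ℝ ∞ f) :
    ContDiff ℝ ∞ (fun w : C(K, E) => f.comp w) :=
  contDiff_infty.2 fun n => contDiff_postcomp_nat n f (contDiff_infty.1 hf n)

/-! ### The integral equation in the space of curves -/

section LocalFlow

variable {E : Type u} [NormedAddCommGroup E] [NormedSpace ℝ E] [CompleteSpace E]

/-- The time interval used for solving differential equations. -/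
abbrev Interval : Type := Icc (-2 : ℝ) 2

/-- Extension of a curve to the real line. -/
def extend (w : C(Interval, E)) : ℝ → E := IccExtend (by norm_num) w

theorem continuous_extend (w : C(Interval, E)) : Continuous (extend w) :=
  w.continuous.Icc_extend'

theorem extend_of_mem (w : C(Interval, E)) {s : ℝ} (hs : s ∈ Icc (-2 : ℝ) 2) :
    extend w s = w ⟨s, hs⟩ := IccExtend_of_mem _ _ hs

theorem norm_extend_le (w : C(Interval, E)) (s : ℝ) : ‖extend w s‖ ≤ ‖w‖ :=
  w.norm_coe_le_norm _

/-- Integration of curves from time `0`. -/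
def primitive : C(Interval, E) →L[ℝ] C(Interval, E) :=
  LinearMap.mkContinuous
    { toFun := fun w => ⟨fun s => ∫ r in (0 : ℝ)..s, extend w r,
        (intervalIntegral.continuous_primitive
          (fun a b => (continuous_extend w).intervalIntegrable a b) 0).comp continuous_subtype_val⟩
      map_add' := fun v w => by
        ext s
        exact intervalIntegral.integral_add ((continuous_extend v).intervalIntegrable _ _)
          ((continuous_extend w).intervalIntegrable _ _)
      map_smul' := fun c w => by
        ext s
        exact intervalIntegral.integral_smul c _ } 2 fun w => by
      refine (ContinuousMap.norm_le _ (by positivity)).2 fun s => ?_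
      refine (intervalIntegral.norm_integral_le_of_norm_le_const
        (fun r _ => norm_extend_le w r)).trans ?_
      rw [mul_comm, sub_zero]
      exact mul_le_mul_of_nonneg_right (abs_le.2 s.2) (norm_nonneg _)

/-- Solutions of `γ' = τ v(γ)` depend smoothly on the initial value and on `τ`. -/
theorem exists_contDiffAt_solution {v : E → E} (hv : ContDiff ℝ ∞ v) (x₀ : E) :
    ∃ u : E × ℝ → C(Interval, E), ContDiffAt ℝ ∞ u (x₀, 0) ∧
      u (x₀, 0) = ContinuousMap.const _ x₀ ∧ ∀ᶠ p in 𝓝 (x₀, (0 : ℝ)),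
        extend (u p) 0 = p.1 ∧
        ∀ s ∈ Ioo (-2 : ℝ) 2, HasDerivAt (extend (u p)) (p.2 • v (extend (u p) s)) s := by
  let vc : C(E, E) := ⟨v, hv.continuous⟩
  let κ : E →L[ℝ] C(Interval, E) := ContinuousLinearMap.const ℝ Interval
  have hκ : ∀ x s, κ x s = x := fun x s => rfl
  -- Zeros of `G` are the solutions of w(s) = x + τ ∫₀ˢ v(w). The factor τ plays the role of small
  -- time, so one fixed interval serves all solutions.
  let G : (E × ℝ) × C(Interval, E) → C(Interval, E) := fun q =>
    q.2 - κ q.1.1 - q.1.2 • primitive (vc.comp q.2)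
  have hN : ContDiff ℝ ∞ fun q : (E × ℝ) × C(Interval, E) => primitive (vc.comp q.2) :=
    primitive.contDiff.comp ((contDiff_postcomp vc hv).comp contDiff_snd)
  have hG : ContDiff ℝ ∞ G := by
    refine (contDiff_snd.sub (κ.contDiff.comp (contDiff_fst.comp contDiff_fst))).sub ?_
    exact (contDiff_snd.comp contDiff_fst).smul hN
  let q₀ : (E × ℝ) × C(Interval, E) := ((x₀, 0), κ x₀)
  have hG0 : G q₀ = 0 := by simp [G, q₀]
  -- At τ = 0 the integral term disappears and `G` is affine in the curve with linear part the
  -- identity; the implicit function theorem applies without any contraction estimate.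
  have hinv : (fderiv ℝ G q₀ ∘L .inr ℝ (E × ℝ) C(Interval, E)) = ContinuousLinearMap.id ℝ _ := by
    have h1 : HasFDerivAt (fun w : C(Interval, E) => G ((x₀, 0), w))
        (fderiv ℝ G q₀ ∘L .inr ℝ (E × ℝ) C(Interval, E)) (κ x₀) := by
      have h2 := (hG.differentiable (by simp) q₀).hasFDerivAt
      exact HasFDerivAt.comp (κ x₀) (g := G) (f := fun w => ((x₀, (0 : ℝ)), w)) h2
        (hasFDerivAt_prodMk_right (x₀, (0 : ℝ)) (κ x₀))
    have h3 : (fun w : C(Interval, E) => G ((x₀, 0), w)) = fun w => w - κ x₀ := by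
      funext w
      simp [G]
    rw [h3] at h1
    exact h1.unique ((hasFDerivAt_id _).sub_const _)
  have hinv' : (fderiv ℝ G q₀ ∘L .inr ℝ (E × ℝ) C(Interval, E)).IsInvertible := by
    rw [hinv]
    exact ⟨ContinuousLinearEquiv.refl ℝ _, rfl⟩
  have hGat : ContDiffAt ℝ ∞ G q₀ := hG.contDiffAt
  have hne : (∞ : WithTop ℕ∞) ≠ 0 := by simp
  refine ⟨hGat.implicitFunction hne hinv', hGat.contDiffAt_implicitFunction hne hinv',
    hGat.implicitFunction_apply_self hne hinv', ?_⟩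
  filter_upwards [hGat.eventually_apply_implicitFunction hne hinv'] with p hp
  rw [hG0] at hp
  set w := hGat.implicitFunction hne hinv' p
  have hp' : w = κ p.1 + p.2 • primitive (vc.comp w) := by
    have : w - κ p.1 - p.2 • primitive (vc.comp w) = 0 := hp
    rw [sub_sub, sub_eq_zero] at this
    exact this
  have hw : ∀ s ∈ Icc (-2 : ℝ) 2, extend w s =
      p.1 + p.2 • ∫ r in (0 : ℝ)..s, extend (vc.comp w) r := by
    intro s hs
    have h1 := DFunLike.congr_fun hp' (⟨s, hs⟩ : Interval)
    rw [extend_of_mem w hs]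
    exact h1
  refine ⟨?_, fun s hs => ?_⟩
  · rw [hw 0 (by norm_num), intervalIntegral.integral_same, smul_zero, add_zero]
  · have h1 : HasDerivAt (fun s => p.1 + p.2 • ∫ r in (0 : ℝ)..s, extend (vc.comp w) r)
        (p.2 • extend (vc.comp w) s) s :=
      ((continuous_extend (vc.comp w)).integral_hasStrictDerivAt 0 s).hasDerivAt.const_smul p.2
        |>.const_add p.1
    have h2 : extend (vc.comp w) s = v (extend w s) := rfl
    rw [h2] at h1
    refine h1.congr_of_eventuallyEq ?_
    filter_upwards [Ioo_mem_nhds hs.1 hs.2] with r hr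
    exact hw r (Ioo_subset_Icc_self hr)

end LocalFlow

/-! ### The flow of a vector field on a compact manifold -/

section Flow

variable {E : Type u} [NormedAddCommGroup E] [NormedSpace ℝ E] [FiniteDimensional ℝ E]
  {H : Type*} [TopologicalSpace H] {I : ModelWithCorners ℝ E H}
  {M : Type*} [TopologicalSpace M] [ChartedSpace H M] [I.Boundaryless] [IsManifold I ∞ M]

/-- A cut-off makes a local representative global, as the solution theorem needs a field on the
whole vector space. -/
theorem exists_contDiff_eventuallyEq {F : Type*} [NormedAddCommGroup F] [NormedSpace ℝ F]
    {U : Set E} (hU : IsOpen U) {f : E → F} (hf : ∀ y ∈ U, ContDiffAt ℝ ∞ f y) {y₀ : E}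
    (hy₀ : y₀ ∈ U) : ∃ g : E → F, ContDiff ℝ ∞ g ∧ g =ᶠ[𝓝 y₀] f := by
  obtain ⟨r, hr, hrU⟩ := Metric.isOpen_iff.1 hU y₀ hy₀
  let b : ContDiffBump y₀ := ⟨r / 4, r / 2, by positivity, by linarith⟩
  refine ⟨fun y => b y • f y, contDiff_iff_contDiffAt.2 fun y => ?_, ?_⟩
  · by_cases hy : y ∈ Metric.closedBall y₀ (r / 2)
    · exact b.contDiffAt.smul (hf y (hrU (Metric.closedBall_subset_ball (by linarith) hy)))
    · refine (contDiffAt_const (c := (0 : F))).congr_of_eventuallyEq ?_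
      filter_upwards [Metric.isClosed_closedBall.isOpen_compl.mem_nhds hy] with z hz
      have : b z = 0 := b.zero_of_le_dist (by
        have := not_le.1 (fun h => hz (Metric.mem_closedBall.2 h))
        exact this.le)
      rw [this, zero_smul]
  · filter_upwards [b.eventuallyEq_one] with y hy
    rw [hy]
    exact one_smul ℝ _

/-- Integral curves near `x₀` of small multiples of a vector field exist for a uniform time, and
depend smoothly on the initial value and the multiple. -/
theorem exists_local_flow {v : ∀ x : M, TangentSpace I x} (hv : IsSmoothVec I v) (x₀ : M) :
    ∃ Θ : M × ℝ → ℝ → M, ContMDiffAt (I.prod 𝓘(ℝ, ℝ)) I ∞ (fun p => Θ p 1) (x₀, 0) ∧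
      ∀ᶠ p in 𝓝 (x₀, (0 : ℝ)), Θ p 0 = p.1 ∧
        IsMIntegralCurveOn (I := I) (Θ p) (p.2 • v) (Ioo (-2) 2) := by
  set ψ := extChartAt I x₀ with hψ
  set y₀ := ψ x₀ with hy₀
  have hy₀t : y₀ ∈ ψ.target := mem_extChartAt_target x₀
  obtain ⟨w, hw, hwv⟩ := exists_contDiff_eventuallyEq (isOpen_extChartAt_target (I := I) x₀)
    (hv x₀) hy₀t
  obtain ⟨u, hu, hu0, hus⟩ := exists_contDiffAt_solution hw y₀
  obtain ⟨r, hr, hrw⟩ := Metric.eventually_nhds_iff_ball.1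
    (hwv.and ((isOpen_extChartAt_target (I := I) x₀).mem_nhds hy₀t))
  have hψx : ContMDiffAt (I.prod 𝓘(ℝ, ℝ)) 𝓘(ℝ, E × ℝ) ∞ (fun p : M × ℝ => (ψ p.1, p.2))
      (x₀, 0) := by
    rw [modelWithCornersSelf_prod, ← chartedSpaceSelf_prod]
    exact ContMDiffAt.prodMk (ContMDiffAt.comp (x₀, (0 : ℝ))
      (contMDiffAt_extChartAt_of_mem (mem_extChartAt_source x₀)) contMDiffAt_fst) contMDiffAt_snd
  have hcu : ContMDiffAt (I.prod 𝓘(ℝ, ℝ)) 𝓘(ℝ, C(Interval, E)) ∞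
      (fun p : M × ℝ => u (ψ p.1, p.2)) (x₀, 0) := ContMDiffAt.comp (x₀, (0 : ℝ))
    (g := u) (f := fun p : M × ℝ => (ψ p.1, p.2)) hu.contMDiffAt hψx
  have h1 : (1 : ℝ) ∈ Icc (-2 : ℝ) 2 := by norm_num
  refine ⟨fun p s => ψ.symm (extend (u (ψ p.1, p.2)) s), ?_, ?_⟩
  · have hev : ContMDiffAt (I.prod 𝓘(ℝ, ℝ)) 𝓘(ℝ, E) ∞
        (fun p : M × ℝ => extend (u (ψ p.1, p.2)) 1) (x₀, 0) := by
      let ev : C(Interval, E) →L[ℝ] E := ContinuousMap.evalCLM ℝ (⟨1, h1⟩ : Interval)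
      refine (ContMDiffAt.comp (x₀, (0 : ℝ)) (g := ev) ev.contDiff.contDiffAt.contMDiffAt
        hcu).congr_of_eventuallyEq (Eventually.of_forall fun p => ?_)
      exact extend_of_mem _ h1
    refine ContMDiffAt.comp (x₀, (0 : ℝ)) (g := ψ.symm)
      (f := fun p : M × ℝ => extend (u (ψ p.1, p.2)) 1) ?_ hev
    have : extend (u (ψ x₀, 0)) 1 = y₀ := by
      rw [hu0, extend_of_mem _ h1]
      rfl
    rw [this]
    exact contMDiffAt_extChartAt_symm hy₀t
  · have hball : ∀ᶠ p in 𝓝 (x₀, (0 : ℝ)), u (ψ p.1, p.2) ∈ Metric.ball (ContinuousMap.const _ y₀)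
        r := by
      refine hcu.continuousAt.eventually_mem (Metric.isOpen_ball.mem_nhds ?_)
      change u (ψ x₀, 0) ∈ _
      rw [hu0]
      exact Metric.mem_ball_self hr
    have hsol : ∀ᶠ p in 𝓝 (x₀, (0 : ℝ)), _ := hψx.continuousAt.eventually hus
    have hsrc : ∀ᶠ p : M × ℝ in 𝓝 (x₀, (0 : ℝ)), p.1 ∈ ψ.source :=
      continuousAt_fst.eventually_mem ((isOpen_extChartAt_source x₀).mem_nhds
        (mem_extChartAt_source x₀))
    filter_upwards [hball, hsol, hsrc] with p hp1 hp2 hp3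
    refine ⟨?_, fun s hs => ?_⟩
    · rw [hp2.1]
      exact ψ.left_inv hp3
    · set γ := extend (u (ψ p.1, p.2)) with hγ
      have hγs : γ s ∈ Metric.ball y₀ r := by
        rw [hγ, extend_of_mem _ (Ioo_subset_Icc_self hs)]
        exact lt_of_le_of_lt (ContinuousMap.dist_apply_le_dist _) hp1
      obtain ⟨hwγ, hγt⟩ := hrw _ hγs
      have hd : HasMFDerivAt 𝓘(ℝ, ℝ) 𝓘(ℝ, E) γ s
          ((1 : ℝ →L[ℝ] ℝ).smulRight (p.2 • w (γ s))) :=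
        (hp2.2 s hs).hasFDerivAt.hasMFDerivAt
      have hcomp := HasMFDerivAt.comp s
        (mdifferentiableAt_extChartAt_symm' (I := I) hγt).hasMFDerivAt hd
      refine HasMFDerivAt.hasMFDerivWithinAt (HasMFDerivAt.congr_mfderiv hcomp ?_)
      have hA := mfderiv_symm_vecRep (I := I) v hγt
      have hA' : mfderiv 𝓘(ℝ, E) I ψ.symm (γ s) (p.2 • w (γ s)) = p.2 • v (ψ.symm (γ s)) := by
        rw [hwγ]
        exact (map_smul _ _ _).trans (congrArg _ hA)
      refine ContinuousLinearMap.ext fun (c : ℝ) => ?_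
      change mfderiv 𝓘(ℝ, E) I ψ.symm (γ s) (c • (p.2 • w (γ s))) = c • (p.2 • v (ψ.symm (γ s)))
      rw [← hA']
      exact map_smul _ _ _

variable [T2Space M] [CompactSpace M]

/-- Local existence times are bounded below near each point; finitely many neighbourhoods cover the
compact manifold, and the least of their times works. -/
theorem exists_uniform_time {v : ∀ x : M, TangentSpace I x} (hv : IsSmoothVec I v) :
    ∃ ε > 0, ∀ x : M, ∃ γ : ℝ → M, γ 0 = x ∧
      IsMIntegralCurveOn (I := I) γ v (Ioo (-ε) ε) := by
  have hloc : ∀ x₀ : M, ∃ ε > 0, ∀ᶠ x in 𝓝 x₀, ∃ γ : ℝ → M, γ 0 = x ∧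
      IsMIntegralCurveOn (I := I) γ v (Ioo (-ε) ε) := by
    intro x₀
    obtain ⟨Θ, -, hΘ⟩ := exists_local_flow hv x₀
    rw [nhds_prod_eq, Filter.eventually_prod_iff] at hΘ
    obtain ⟨P, hP, Q, hQ, hPQ⟩ := hΘ
    obtain ⟨δ, hδ, hδQ⟩ := Metric.eventually_nhds_iff_ball.1 hQ
    have hδ2 : Q (δ / 2) := hδQ _ (by
      rw [mem_ball_zero_iff, Real.norm_eq_abs, abs_of_pos (by positivity)]; linarith)
    refine ⟨δ, hδ, ?_⟩
    filter_upwards [hP] with x hx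
    obtain ⟨h0, h1⟩ := hPQ hx hδ2
    -- A curve of (δ/2)v on (-2, 2), run at speed 2/δ, is a curve of `v` on (-δ, δ).
    refine ⟨Θ (x, δ / 2) ∘ (· * (δ / 2)⁻¹), by simpa using h0, ?_⟩
    have h2 := h1.comp_mul (δ / 2)⁻¹
    have h3 : (δ / 2)⁻¹ • ((δ / 2) • v) = v := by
      rw [smul_smul, inv_mul_cancel₀ (by positivity), one_smul]
    simp only [h3] at h2
    refine h2.mono fun t ht => ?_
    change t * (δ / 2)⁻¹ ∈ Ioo (-2 : ℝ) 2
    rw [← div_eq_mul_inv]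
    constructor
    · rw [lt_div_iff₀ (by positivity)]; linarith [ht.1]
    · rw [div_lt_iff₀ (by positivity)]; linarith [ht.2]
  choose ε hε hx using hloc
  obtain ⟨t, -, ht⟩ := isCompact_univ.elim_nhds_subcover (fun x₀ => {x | ∃ γ : ℝ → M, γ 0 = x ∧
      IsMIntegralCurveOn (I := I) γ v (Ioo (-ε x₀) (ε x₀))}) fun x₀ _ => hx x₀
  rcases t.eq_empty_or_nonempty with rfl | hne
  · refine ⟨1, one_pos, fun x => ?_⟩
    simpa using ht (mem_univ x)
  · obtain ⟨i, hi, hmin⟩ := t.exists_min_image ε hne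
    refine ⟨ε i, hε i, fun x => ?_⟩
    obtain ⟨j, hj⟩ := mem_iUnion.1 (ht (mem_univ x))
    obtain ⟨hjt, γ, h0, hγ⟩ := mem_iUnion.1 hj
    exact ⟨γ, h0, hγ.mono (Ioo_subset_Ioo (neg_le_neg (hmin j hjt)) (hmin j hjt))⟩

/-- A smooth vector field on a compact manifold has a smooth global flow. -/
theorem exists_flow {v : ∀ x : M, TangentSpace I x} (hv : IsSmoothVec I v) :
    ∃ Ψ : ℝ → M → M, ContMDiff (I.prod 𝓘(ℝ, ℝ)) I ∞ (fun p : M × ℝ => Ψ p.2 p.1) ∧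
      (∀ x, Ψ 0 x = x) ∧ (∀ s t x, Ψ (s + t) x = Ψ s (Ψ t x)) ∧
      ∀ x, IsMIntegralCurve (I := I) (fun t => Ψ t x) v := by
  have : IsManifold I 1 M := IsManifold.of_le (n := ∞) (by simp)
  obtain ⟨ε, hε, hεv⟩ := exists_uniform_time hv
  choose γ hγ0 hγ using exists_isMIntegralCurve_of_isMIntegralCurveOn hv.contMDiff hε hεv
  have hadd : ∀ s t x, γ x (s + t) = γ (γ x t) s := by
    intro s t x
    have h1 := (hγ x).comp_add t
    exact congrFun (isMIntegralCurve_Ioo_eq_of_contMDiff_boundaryless (t₀ := 0) hv.contMDiff h1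
      (hγ (γ x t)) (by simp [hγ0])) s
  refine ⟨fun t x => γ x t, ?_, hγ0, hadd, hγ⟩
  have hloc : ∀ x₀ : M, ContMDiffAt (I.prod 𝓘(ℝ, ℝ)) I ∞ (fun p : M × ℝ => γ p.1 p.2) (x₀, 0) := by
    intro x₀
    obtain ⟨Θ, hΘ, hΘ'⟩ := exists_local_flow hv x₀
    refine hΘ.congr_of_eventuallyEq ?_
    filter_upwards [hΘ'] with p hp
    -- The curve s ↦ γ(x, st) integrates t•v with initial value x, so by uniqueness it is the local
    -- solution, and s = 1 gives γ(x, t).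
    have h1 : IsMIntegralCurveOn (I := I) (γ p.1 ∘ (· * p.2)) (p.2 • v) (Ioo (-2) 2) :=
      ((hγ p.1).comp_mul p.2).isMIntegralCurveOn _
    have hv' : IsSmoothVec I (p.2 • v) := by
      intro x y hy
      have h2 : vecRep I (p.2 • v) x = fun y => p.2 • vecRep I v x y := by
        funext y
        exact map_smul _ _ _
      rw [h2]
      exact contDiffAt_const.smul (hv x y hy)
    have h3 := isMIntegralCurveOn_Ioo_eqOn_of_contMDiff_boundaryless (t₀ := 0) (by norm_num)
      hv'.contMDiff h1 hp.2 (by simp [hp.1, hγ0])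
    simpa using h3 (show (1 : ℝ) ∈ Ioo (-2 : ℝ) 2 by norm_num)
  -- Smoothness at a point spreads to a neighbourhood for each finite order, which is why the orders
  -- are treated separately.
  refine contMDiff_infty.2 fun n => ?_
  -- uniform smoothness for small times
  have hunif : ∃ δ > 0, ∀ x : M, ∀ t : ℝ, |t| < δ →
      ContMDiffAt (I.prod 𝓘(ℝ, ℝ)) I n (fun p : M × ℝ => γ p.1 p.2) (x, t) := by
    have hn : IsManifold I n M := IsManifold.of_le (n := ∞) (by exact_mod_cast le_top)
    have h1 : ∀ᶠ t : ℝ in 𝓝 0, ∀ x ∈ (univ : Set M),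
        ContMDiffAt (I.prod 𝓘(ℝ, ℝ)) I n (fun p : M × ℝ => γ p.1 p.2) (x, t) := by
      refine isCompact_univ.eventually_forall_of_forall_eventually fun x _ => ?_
      have h2 := (contMDiffAt_iff_contMDiffAt_nhds (by simp)).1
        ((hloc x).of_le (m := n) (by exact_mod_cast le_top))
      exact (continuous_swap.tendsto ((0 : ℝ), x)).eventually h2
    obtain ⟨δ, hδ, h2⟩ := Metric.eventually_nhds_iff_ball.1 h1
    exact ⟨δ, hδ, fun x t ht => h2 t (by simpa using ht) x (mem_univ x)⟩
  obtain ⟨δ, hδ, hunif⟩ := hunif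
  have hsmall : ∀ t : ℝ, |t| < δ → ContMDiff I I n (fun x => γ x t) := fun t ht x =>
    ContMDiffAt.comp x (hunif x t ht) (contMDiffAt_id.prodMk contMDiffAt_const)
  have hiter : ∀ (k : ℕ) (t : ℝ), |t| < δ → ContMDiff I I n (fun x => γ x (k * t)) := by
    intro k t ht
    induction k with
    | zero =>
      simp only [Nat.cast_zero, zero_mul, hγ0]
      exact contMDiff_id
    | succ k ih =>
      have h1 : ∀ x, γ x ((k + 1 : ℕ) * t) = γ (γ x t) (k * t) := fun x => by
        rw [← hadd]; push_cast; ring_nf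
      simp only [h1]
      exact ih.comp (hsmall t ht)
  rintro ⟨x₀, t₀⟩
  -- The time t₀ is cut into `k` steps shorter than δ, so the time-t₀ map is a `k`-fold iterate of a
  -- smooth map.
  obtain ⟨k, hk⟩ := exists_nat_gt (|t₀| / δ)
  have hkpos : (0 : ℝ) < k := lt_of_le_of_lt (by positivity) hk
  have hmap : ContMDiff I I n (fun x => γ x t₀) := by
    have h1 := hiter k (t₀ / k) (by
      rw [abs_div, abs_of_pos hkpos, div_lt_iff₀ hkpos]
      rwa [div_lt_iff₀ hδ, mul_comm] at hk)
    rwa [mul_div_cancel₀ _ hkpos.ne'] at h1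
  -- By the group law, smoothness near time t₀ reduces to smoothness near time 0.
  have heq : (fun p : M × ℝ => γ p.1 p.2) =
      (fun p : M × ℝ => γ p.1 p.2) ∘ fun p : M × ℝ => (γ p.1 t₀, p.2 - t₀) := by
    funext p
    change γ p.1 p.2 = γ (γ p.1 t₀) (p.2 - t₀)
    rw [← hadd, sub_add_cancel]
  rw [heq]
  refine ContMDiffAt.comp (x₀, t₀) ?_ (((hmap.comp contMDiff_fst).prodMk
    (contMDiff_snd.sub contMDiff_const)).contMDiffAt)
  exact hunif _ _ (by simpa using hδ)

end Flow

/-! ### Local primitives of closed one-forms -/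

section Primitives

variable {E : Type*} [NormedAddCommGroup E] [NormedSpace ℝ E] [FiniteDimensional ℝ E]
  {H : Type*} [TopologicalSpace H] {I : ModelWithCorners ℝ E H}
  {M : Type*} [TopologicalSpace M] [ChartedSpace H M] [I.Boundaryless] [IsManifold I ∞ M]

theorem dFun_congr {f g : M → ℝ} {x : M} (h : f =ᶠ[𝓝 x] g) : dFun I f x = dFun I g x := by
  rw [dFun, dFun, h.mfderiv_eq]

theorem one_form_ext {a b : E [⋀^Fin 1]→L[ℝ] ℝ}
    (h : ∀ v : E, toFunctional a v = toFunctional b v) : a = b :=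
  ContinuousAlternatingMap.ext fun u => (apply_eq_toFunctional a u).trans
    ((h (u 0)).trans (apply_eq_toFunctional b u).symm)

theorem dFun_sub_sum {ι : Type*} [Fintype ι] {f : M → ℝ} {ρ : ι → M → ℝ} {x : M}
    (hf : MDifferentiableAt I 𝓘(ℝ, ℝ) f x) (hρ : ∀ i, MDifferentiableAt I 𝓘(ℝ, ℝ) (ρ i) x)
    (c : ℝ) (s : ι → ℝ) : dFun I (fun y => c * f y - ∑ i, s i * ρ i y) x =
      c • dFun I f x - ∑ i, s i • dFun I (ρ i) x := by
  obtain ⟨D, hD⟩ : ∃ D : ι → E →L[ℝ] ℝ, ∀ i, HasMFDerivAt I 𝓘(ℝ, ℝ) (ρ i) x (D i) :=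
    ⟨_, fun i => (hρ i).hasMFDerivAt⟩
  have hρD : ∀ i, toFunctional (V := E) (dFun I (ρ i) x) = D i := fun i => (hD i).mfderiv
  have h0 : ∀ t : Finset ι, HasMFDerivAt I 𝓘(ℝ, ℝ) (∑ i ∈ t, s i • ρ i) x
      (∑ i ∈ t, s i • D i) := by
    intro t
    classical
    induction t using Finset.induction_on with
    | empty => exact hasMFDerivAt_const (0 : ℝ) x
    | insert i t hi ih =>
      rw [Finset.sum_insert hi]
      exact (((hD i).const_smul (s i)).add ih).congr_mfderiv
        (Finset.sum_insert (M := E →L[ℝ] ℝ) (f := fun i => s i • D i) hi).symm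
  have h1 := (hf.hasMFDerivAt.const_smul c).sub (h0 Finset.univ)
  have h2 : (c • f - ∑ i, s i • ρ i) = fun y => c * f y - ∑ i, s i * ρ i y := by
    funext y
    simp
  rw [h2] at h1
  refine one_form_ext (E := E) fun v => ?_
  have h3 := congrArg (fun A : E →L[ℝ] ℝ => A v) h1.mfderiv
  refine Eq.trans h3 ?_
  have h4 : ∀ (A : E →L[ℝ] ℝ), (c • A - ∑ i, s i • D i) v =
      c * A v - ∑ i, s i * D i v := fun A => by simp
  have h5 : ∀ (A : E [⋀^Fin 1]→L[ℝ] ℝ) (B : ι → E [⋀^Fin 1]→L[ℝ] ℝ),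
      toFunctional (c • A - ∑ i, s i • B i) v =
        c * toFunctional A v - ∑ i, s i * toFunctional (B i) v := fun A B => by
    simp [toFunctional_apply]
  refine (h4 _).trans (Eq.trans ?_ (h5 _ _).symm)
  simp only [hρD]
  rfl

/-- This is the Poincaré lemma on a ball in a chart: closedness makes the derivative of the
representing functional symmetric, so it is a gradient on the convex ball. -/
theorem exists_primitive {β : DForm I M 1} (hβ : IsSmooth β) (hβ' : extD β = 0) (x₀ : M) :
    ∃ (U : Set M) (g : M → ℝ), IsOpen U ∧ x₀ ∈ U ∧ ContMDiffOn I 𝓘(ℝ, ℝ) ∞ g U ∧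
      ∀ y ∈ U, β y = dFun I g y := by
  set ψ := extChartAt I x₀ with hψ
  obtain ⟨r, hr, hrt⟩ := Metric.isOpen_iff.1 (isOpen_extChartAt_target (I := I) x₀) (ψ x₀)
    (mem_extChartAt_target x₀)
  have hA : ∀ z ∈ Metric.ball (ψ x₀) r, ContDiffAt ℝ ∞ (pullRep ψ.symm β) z :=
    fun z hz => isSmooth_iff.1 hβ x₀ z (hrt hz)
  let w : E → E →L[ℝ] ℝ := fun z => toFunctional (pullRep ψ.symm β z)
  have hw : ContDiffOn ℝ ∞ w (Metric.ball (ψ x₀) r) := fun z hz =>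
    (contDiffAt_clm_of_apply fun v => contDiffAt_toFunctional (hA z hz)
      contDiffAt_const).contDiffWithinAt
  obtain ⟨f, hf⟩ := (convex_ball (ψ x₀) r).exists_forall_hasFDerivAt_of_fderiv_symmetric
    Metric.isOpen_ball (hw.differentiableOn (by simp)) fun z hz v u => by
      have h0 : extDeriv (pullRep ψ.symm β) z = 0 := by
        rw [← pullRep_extD hβ (contMDiffAt_extChartAt_symm (hrt hz)), hβ']
        rfl
      have h1 := extDeriv_one_apply ((hA z hz).differentiableAt (by simp)) v u
      rw [h0] at h1
      have h2 : ∀ p q : E, fderiv ℝ w z p q = fderiv ℝ (fun y => pullRep ψ.symm β y ![q]) z p := by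
        intro p q
        have hwz : DifferentiableAt ℝ w z :=
          (hw.contDiffAt (Metric.isOpen_ball.mem_nhds hz)).differentiableAt (by simp)
        have h3 : (fun y => pullRep ψ.symm β y ![q]) = fun y => w y q :=
          funext fun y => (toFunctional_apply _ _).symm
        rw [h3]
        have h4 := fderiv_clm_apply hwz (differentiableAt_const q)
        rw [h4]
        simp
      rw [h2, h2]
      exact (sub_eq_zero.1 h1.symm)
  have hfs : ContDiffOn ℝ ∞ f (Metric.ball (ψ x₀) r) := by
    refine (contDiffOn_infty_iff_fderiv_of_isOpen Metric.isOpen_ball).2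
      ⟨fun z hz => (hf z hz).differentiableAt.differentiableWithinAt, ?_⟩
    exact hw.congr fun z hz => (hf z hz).fderiv
  refine ⟨ψ.source ∩ ψ ⁻¹' Metric.ball (ψ x₀) r, f ∘ ψ,
    (continuousOn_extChartAt x₀).isOpen_inter_preimage (isOpen_extChartAt_source x₀)
      Metric.isOpen_ball, ⟨mem_extChartAt_source x₀, Metric.mem_ball_self hr⟩, ?_, ?_⟩
  · rintro y ⟨hy1, hy2⟩
    exact (ContMDiffAt.comp y (hfs.contDiffAt (Metric.isOpen_ball.mem_nhds hy2)).contMDiffAt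
      (contMDiffAt_extChartAt_of_mem hy1)).contMDiffWithinAt
  · rintro y ⟨hy1, hy2⟩
    refine one_form_ext (E := E) fun v => ?_
    have h1 := mfderiv_comp (I := I) (I' := 𝓘(ℝ, E)) (I'' := 𝓘(ℝ, ℝ)) y
      (hf _ hy2).differentiableAt.mdifferentiableAt
      ((contMDiffAt_extChartAt_of_mem hy1).mdifferentiableAt (by simp))
    have h2 : mfderiv I 𝓘(ℝ, ℝ) (f ∘ ψ) y v = w (ψ y) (mfderiv I 𝓘(ℝ, E) ψ y v) := by
      rw [h1, mfderiv_eq_fderiv, (hf _ hy2).fderiv]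
      rfl
    refine Eq.trans ?_ h2.symm
    have h3 : w (ψ y) (mfderiv I 𝓘(ℝ, E) ψ y v) = toFunctional (V := E) (β (ψ.symm (ψ y)))
        (mfderiv 𝓘(ℝ, E) I ψ.symm (ψ y) (mfderiv I 𝓘(ℝ, E) ψ y v)) := rfl
    refine Eq.trans ?_ h3.symm
    refine Eq.trans ?_ (form_apply_congr β (ψ.left_inv hy1).symm _)
    exact congrArg (toFunctional (V := E) (β y)) (mfderiv_symm_extChartAt_apply hy1 v).symm

/-- In a chart the difference has zero derivative on a ball. -/
theorem eventually_sub_eq {f g : M → ℝ} {U : Set M} (hU : IsOpen U)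
    (hf : ContMDiffOn I 𝓘(ℝ, ℝ) ∞ f U) (hg : ContMDiffOn I 𝓘(ℝ, ℝ) ∞ g U)
    (h : ∀ y ∈ U, dFun I f y = dFun I g y) {x : M} (hx : x ∈ U) :
    ∀ᶠ y in 𝓝 x, f y - g y = f x - g x := by
  set ψ := extChartAt I x with hψ
  have hcont : ContinuousAt ψ.symm (ψ x) := (contMDiffAt_extChartAt_symm
    (mem_extChartAt_target (I := I) x)).continuousAt
  have hxx : ψ.symm (ψ x) = x := ψ.left_inv (mem_extChartAt_source x)
  have hev : ∀ᶠ z in 𝓝 (ψ x), z ∈ ψ.target ∧ ψ.symm z ∈ U :=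
    Filter.Eventually.and
      ((isOpen_extChartAt_target (I := I) x).mem_nhds (mem_extChartAt_target x))
        (hcont.eventually_mem (hU.mem_nhds (by rwa [hxx])))
  obtain ⟨r, hr, hrU⟩ := Metric.eventually_nhds_iff_ball.1 hev
  have hs : ∀ z ∈ Metric.ball (ψ x) r, MDifferentiableAt 𝓘(ℝ, E) I ψ.symm z := fun z hz =>
    mdifferentiableAt_extChartAt_symm' (hrU z hz).1
  have hfd : ∀ z ∈ Metric.ball (ψ x) r, ∀ k : M → ℝ, ContMDiffOn I 𝓘(ℝ, ℝ) ∞ k U →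
      HasFDerivAt (k ∘ ψ.symm) (toFunctional (pullRep ψ.symm (dFun I k) z)) z := by
    intro z hz k hk
    have h1 : MDifferentiableAt I 𝓘(ℝ, ℝ) k (ψ.symm z) :=
      (hk.contMDiffAt (hU.mem_nhds (hrU z hz).2)).mdifferentiableAt (by simp)
    exact (h1.hasMFDerivAt.comp z (hs z hz).hasMFDerivAt).hasFDerivAt
  have hd : ∀ z ∈ Metric.ball (ψ x) r, HasFDerivAt (fun z => f (ψ.symm z) - g (ψ.symm z))
      (0 : E →L[ℝ] ℝ) z := by
    intro z hz
    have h1 := (hfd z hz f hf).sub (hfd z hz g hg)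
    have h2 : pullRep ψ.symm (dFun I f) z = pullRep ψ.symm (dFun I g) z := by
      rw [pullRep, pullRep, h _ (hrU z hz).2]
    rw [h2, sub_self] at h1
    exact h1
  have hconst : ∀ z ∈ Metric.ball (ψ x) r, f (ψ.symm z) - g (ψ.symm z) = f x - g x := by
    intro z hz
    have h1 := (convex_ball (ψ x) r).is_const_of_fderivWithin_eq_zero (𝕜 := ℝ)
      (fun z hz => (hd z hz).differentiableAt.differentiableWithinAt)
      (fun z hz => ((hd z hz).hasFDerivWithinAt).fderivWithin
        (Metric.isOpen_ball.uniqueDiffWithinAt hz)) hz (Metric.mem_ball_self hr)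
    rwa [hxx] at h1
  have hψc : ContinuousAt ψ x := (contMDiffAt_extChartAt_of_mem
      (mem_extChartAt_source x)).continuousAt
  filter_upwards [hψc.eventually_mem (Metric.ball_mem_nhds _ hr),
    (isOpen_extChartAt_source (I := I) x).mem_nhds (mem_extChartAt_source x)] with y hy1 hy2
  have := hconst _ hy1
  rwa [ψ.left_inv hy2] at this

end Primitives

/-! ### Diophantine approximation and locally constant functions -/

section Approximation

/-- Simultaneous Diophantine approximation. -/
theorem exists_nat_mul_near_int {C : Set ℝ} (hC : C.Finite) {ε : ℝ} (hε : 0 < ε) :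
    ∃ N : ℕ, 1 ≤ N ∧ ∀ c ∈ C, |N * c - round (N * c)| < ε := by
  have := hC.to_subtype
  have hfact : Fact ((0 : ℝ) < 1) := ⟨one_pos⟩
  let x : C → UnitAddCircle := fun c => ((c : ℝ) : UnitAddCircle)
  -- The multiples of a point of a torus, a compact group, return arbitrarily close to 0 for
  -- arbitrarily large multipliers, in particular for some N ≥ 1.
  have h1 : MapClusterPt 0 atTop (fun n : ℕ => n • x) := mapClusterPt_zero_atTop_nsmul x
  have h2 : ∀ᶠ y : C → UnitAddCircle in 𝓝 0, ∀ c, ‖y c‖ < ε := by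
    refine eventually_all.2 fun c => ?_
    have hc : Continuous fun y : C → UnitAddCircle => ‖y c‖ := (continuous_apply c).norm
    refine hc.continuousAt.eventually_mem (isOpen_Iio.mem_nhds ?_)
    simpa using hε
  have h3 := h1.frequently h2
  obtain ⟨N, hN1, hN2⟩ := (h3.and_eventually (eventually_ge_atTop 1)).exists
  refine ⟨N, hN2, fun c hc => ?_⟩
  have h4 := hN1 ⟨c, hc⟩
  have h5 : (N • x) ⟨c, hc⟩ = ((N * c : ℝ) : UnitAddCircle) := by
    simp [x]
  rwa [h5, UnitAddCircle.norm_eq] at h4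

/-- Compactness extracts finitely many neighbourhoods on each of which `d` is constant. -/
theorem finite_image_of_eventually_const {X Y : Type*} [TopologicalSpace X] {K : Set X}
    (hK : IsCompact K) {d : X → Y} (hd : ∀ x ∈ K, ∀ᶠ y in 𝓝 x, d y = d x) : (d '' K).Finite := by
  obtain ⟨t, -, ht⟩ := hK.elim_nhds_subcover (fun x => {y | d y = d x}) hd
  refine (t.finite_toSet.image d).subset ?_
  rintro _ ⟨y, hy, rfl⟩
  obtain ⟨x, hx, hxy⟩ := mem_iUnion₂.1 (ht hy)
  exact ⟨x, hx, hxy.symm⟩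

end Approximation

/-! ### Stability of nonvanishing under small perturbations -/

section Perturbation

variable {E : Type*} [NormedAddCommGroup E] [NormedSpace ℝ E] [FiniteDimensional ℝ E]
  {H : Type*} [TopologicalSpace H] {I : ModelWithCorners ℝ E H}
  {M : Type*} [TopologicalSpace M] [ChartedSpace H M] [I.Boundaryless] [IsManifold I ∞ M]

/-- Nonvanishing is open in the pair (s, x), being tested near `x` by one fixed tuple of chart
vectors; compactness makes the range of `s` uniform in `x`. -/
theorem exists_perturbation_ne_zero [CompactSpace M] {ι : Type*} [Fintype ι] {n : ℕ}
    {η : DForm I M n} (hη : IsSmooth η) {ζ : ι → DForm I M n} (hζ : ∀ i, IsSmooth (ζ i))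
    (hne : ∀ x, η x ≠ 0) : ∃ ε > 0, ∀ s : ι → ℝ, (∀ i, |s i| < ε) → ∀ x,
      η x + ∑ i, s i • ζ i x ≠ 0 := by
  have key : ∀ᶠ s : ι → ℝ in 𝓝 0, ∀ x ∈ (univ : Set M), η x + ∑ i, s i • ζ i x ≠ 0 := by
    refine isCompact_univ.eventually_forall_of_forall_eventually fun x _ => ?_
    set ψ := extChartAt I x with hψ
    have hxt := mem_extChartAt_target (I := I) x
    obtain ⟨v, hv⟩ : ∃ v, pullRep ψ.symm η (ψ x) v ≠ 0 := by
      by_contra! hc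
      refine hne x (apply_eq_of_pullRep_eq (ζ := 0) (mem_extChartAt_source x) ?_)
      exact ContinuousAlternatingMap.ext hc
    have hψc : ContinuousAt ψ x :=
      (contMDiffAt_extChartAt_of_mem (mem_extChartAt_source x)).continuousAt
    have hc : ∀ {ξ : DForm I M n}, IsSmooth ξ →
        ContinuousAt (fun z : (ι → ℝ) × M => pullRep ψ.symm ξ (ψ z.2) v) (0, x) := by
      intro ξ hξ
      have h1 := (contDiffAt_alternating_iff.1 (isSmooth_iff.1 hξ x _ hxt) v).continuousAt
      exact ContinuousAt.comp (x := ((0 : ι → ℝ), x)) (f := fun z : (ι → ℝ) × M => ψ z.2) h1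
        (ContinuousAt.comp (x := ((0 : ι → ℝ), x)) (f := Prod.snd) hψc continuousAt_snd)
    have hs : ContinuousAt (fun z : (ι → ℝ) × M => pullRep ψ.symm η (ψ z.2) v +
        ∑ i, z.1 i * pullRep ψ.symm (ζ i) (ψ z.2) v) (0, x) :=
      (hc hη).add (tendsto_finsetSum _ fun i _ =>
        ((continuous_apply i).continuousAt.comp continuousAt_fst).mul (hc (hζ i)))
    have h0 := hs.eventually_ne (y := 0) (by simpa using hv)
    have hsrc : ∀ᶠ z : (ι → ℝ) × M in 𝓝 (0, x), z.2 ∈ ψ.source :=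
      continuousAt_snd.eventually_mem ((isOpen_extChartAt_source x).mem_nhds
        (mem_extChartAt_source x))
    filter_upwards [h0, hsrc] with z hz hzs h
    refine hz ?_
    have h1 : ψ.symm (ψ z.2) = z.2 := ψ.left_inv hzs
    have h2 : ∀ (y : M), η y + ∑ i, z.1 i • ζ i y = 0 → ∀ u : Fin n → E,
        (η y : E [⋀^Fin n]→L[ℝ] ℝ) u + ∑ i, z.1 i * (ζ i y : E [⋀^Fin n]→L[ℝ] ℝ) u = 0 := by
      intro y hy u
      have h3 := congrArg (fun T : E [⋀^Fin n]→L[ℝ] ℝ => T u) hy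
      have h4 : ∀ (A : E [⋀^Fin n]→L[ℝ] ℝ) (B : ι → E [⋀^Fin n]→L[ℝ] ℝ),
        (A + ∑ i, z.1 i • B i) u = A u + ∑ i, z.1 i * B i u := fun A B => by simp
      exact (h4 _ _).symm.trans h3
    exact h2 _ (by rw [h1]; exact h) _
  obtain ⟨ε, hε, h⟩ := Metric.eventually_nhds_iff_ball.1 key
  refine ⟨ε, hε, fun s hs x => h s ?_ x (mem_univ x)⟩
  rw [mem_ball_zero_iff, pi_norm_lt_iff hε]
  exact hs

end Perturbation

/-! ### Maps to the circle from nonvanishing closed one-forms -/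

section Tischler

/-- The integer a - b - c is a sum of three errors below 1/3, so it is zero. This makes rounding
additive on nearly integral numbers. -/
theorem abs_lt_one_third_add {a b c : ℤ} {x y : ℝ} {ε : ℝ} (hε : ε ≤ 1 / 3)
    (ha : |x - a| < ε) (hb : |y - b| < ε) (hc : |x - y - c| < ε) : a - b = c := by
  rw [abs_lt] at ha hb hc
  have h1 : ((a - b - c : ℤ) : ℝ) < 1 := by push_cast; linarith
  have h2 : (-1 : ℝ) < ((a - b - c : ℤ) : ℝ) := by push_cast; linarith
  have h1' : a - b - c < 1 := by exact_mod_cast h1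
  have h2' : -1 < a - b - c := by exact_mod_cast h2
  omega

/-- Factoring out `N` displays the new volume form as a nonzero multiple of the old one perturbed
with coefficients of size |s|/N. -/
theorem wedge_smul_sub_sum {V : Type*} [NormedAddCommGroup V] [NormedSpace ℝ V] {t : Type*}
    [Fintype t] {n : ℕ} {N : ℝ} (hN : N ≠ 0) (s : t → ℝ) (T : V [⋀^Fin n]→L[ℝ] ℝ)
    (B : V [⋀^Fin 1]→L[ℝ] ℝ) (D : t → V [⋀^Fin 1]→L[ℝ] ℝ) :
    wedge T (N • B - ∑ k, s k • D k) = N • (wedge T B + ∑ k, (-(s k) / N) • wedge T (D k)) := by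
  ext v
  have h4 : ∀ k, N * (-(s k) / N * wedge T (D k) v) = -(s k * wedge T (D k) v) := by
    intro k
    field_simp
  simp only [ContinuousAlternatingMap.smul_apply, ContinuousAlternatingMap.add_apply,
    ContinuousAlternatingMap.sum_apply, smul_eq_mul, mul_add, Finset.mul_sum, h4]
  simp only [wedge_apply, wedgeSummand, ContinuousAlternatingMap.sub_apply,
    ContinuousAlternatingMap.smul_apply, ContinuousAlternatingMap.sum_apply, smul_eq_mul,
    mul_sub, Finset.sum_sub_distrib, Finset.mul_sum, Finset.sum_neg_distrib]
  rw [sub_eq_add_neg, Finset.sum_comm]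
  congr 1
  · exact Finset.sum_congr rfl fun _ _ => by ring
  · congr 1
    exact Finset.sum_congr rfl fun _ _ => Finset.sum_congr rfl fun _ _ => by ring

/-- The function `y ↦ exp(2πi y)`. -/
def expCircle (y : ℝ) : Circle := Circle.exp (2 * Real.pi * y)

theorem expCircle_add_int (y : ℝ) (m : ℤ) : expCircle (y + m) = expCircle y := by
  rw [expCircle, expCircle, mul_add, mul_comm (2 * Real.pi) (m : ℝ)]
  exact Circle.periodic_exp.int_mul m _

variable {E : Type*} [NormedAddCommGroup E] [NormedSpace ℝ E] [FiniteDimensional ℝ E]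
  {H : Type*} [TopologicalSpace H] {I : ModelWithCorners ℝ E H}
  {M : Type*} [TopologicalSpace M] [ChartedSpace H M] [I.Boundaryless] [IsManifold I ∞ M]

/-- `p` has local lifts to the real line with differential `β`. -/
def HasLocalLifts (p : M → Circle) (β : DForm I M 1) : Prop :=
  ∀ x, ∃ (U : Set M) (g : M → ℝ), IsOpen U ∧ x ∈ U ∧ ContMDiffOn I 𝓘(ℝ, ℝ) ∞ g U ∧
    ∀ y ∈ U, β y = dFun I g y ∧ p y = expCircle (g y)

theorem HasLocalLifts.exists_primitive {p : M → Circle} {β : DForm I M 1}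
    (h : HasLocalLifts p β) (x : M) : ∃ g : M → ℝ, ContMDiffAt I 𝓘(ℝ, ℝ) ∞ g x ∧
      ∀ᶠ y in 𝓝 x, β y = dFun I g y := by
  obtain ⟨U, g, hU, hx, hg, hy⟩ := h x
  exact ⟨g, hg.contMDiffAt (hU.mem_nhds hx), (hU.eventually_mem hx).mono fun y hyU => (hy y hyU).1⟩

theorem HasLocalLifts.isSmooth {p : M → Circle} {β : DForm I M 1} (h : HasLocalLifts p β) :
    IsSmooth β := isSmooth_of_forall_primitive h.exists_primitive

variable [T2Space M] [CompactSpace M]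

/-- Tischler's argument: a closed one-form can be approximated, up to a positive factor, by the
differential of a map to the circle. -/
theorem exists_hasLocalLifts {β : DForm I M 1} (hβ : IsSmooth β) (hβ' : extD β = 0) {n : ℕ}
    {τ : DForm I M n} (hτ : IsSmooth τ) (hne : ∀ x, wedgeForm τ β x ≠ 0) :
    ∃ (p : M → Circle) (β' : DForm I M 1), HasLocalLifts p β' ∧ ∀ x, wedgeForm τ β' x ≠ 0 := by
  classical
  have hlc : LocallyCompactSpace M := inferInstance
  choose U g hU hxU hg hdg using exists_primitive (I := I) hβ hβ'
  have hK : ∀ x, ∃ K, IsCompact K ∧ x ∈ interior K ∧ K ⊆ U x :=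
    fun x => exists_compact_subset (hU x) (hxU x)
  choose K hKc hxK hKU using hK
  obtain ⟨t, -, ht⟩ := isCompact_univ.elim_nhds_subcover (fun x : M => interior (K x))
    fun x _ => isOpen_interior.mem_nhds (hxK x)
  obtain ⟨ρ, hρ⟩ := SmoothPartitionOfUnity.exists_isSubordinate I isClosed_univ
    (fun i : t => interior (K i)) (fun i => isOpen_interior) (fun x hx => by
      obtain ⟨i, hi, hxi⟩ := mem_iUnion₂.1 (ht hx)
      exact mem_iUnion.2 ⟨⟨i, hi⟩, hxi⟩)
  have hρ1 : ∀ y, ∑ k, ρ k y = 1 := fun y => by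
    rw [← finsum_eq_sum_of_fintype]
    exact ρ.sum_eq_one (mem_univ y)
  have hρs : ∀ k : t, ContMDiff I 𝓘(ℝ, ℝ) ∞ (ρ k) := fun k => (ρ k).contMDiff
  have hdρ : ∀ k : t, IsSmooth (dFun I (ρ k)) := fun k =>
    isSmooth_of_forall_primitive fun x => ⟨ρ k, (hρs k).contMDiffAt, Eventually.of_forall fun _ =>
      rfl⟩
  obtain ⟨ε₀, hε₀, hpert⟩ := exists_perturbation_ne_zero (hτ.wedgeForm hβ)
    (fun k : t => hτ.wedgeForm (hdρ k)) hne
  -- The bound ε₀ keeps the volume form nonzero, and 1/3 makes the integers obtained by rounding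
  -- additive.
  set ε := min ε₀ (1 / 3) with hε
  have hεpos : 0 < ε := lt_min hε₀ (by norm_num)
  -- the differences of the primitives take finitely many values
  have hloc : ∀ (i j : M) (y : M), y ∈ U i → y ∈ U j →
      ∀ᶠ z in 𝓝 y, g i z - g j z = g i y - g j y := fun i j y hi hj =>
    eventually_sub_eq ((hU i).inter (hU j)) ((hg i).mono inter_subset_left)
      ((hg j).mono inter_subset_right)
      (fun z hz => (hdg i z hz.1).symm.trans (hdg j z hz.2)) ⟨hi, hj⟩
  let C : Set ℝ := ⋃ i : t, ⋃ j : t, (fun y => g i y - g j y) '' (K i ∩ K j)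
  have hC : C.Finite := finite_iUnion fun i => finite_iUnion fun j =>
    finite_image_of_eventually_const ((hKc i).inter (hKc j)) fun y hy =>
      hloc i j y (hKU _ hy.1) (hKU _ hy.2)
  obtain ⟨N, hN, hNC⟩ := exists_nat_mul_near_int hC hεpos
  have hmemC : ∀ (i j : t) (y : M), y ∈ interior (K i) → y ∈ interior (K j) →
      g i y - g j y ∈ C := fun i j y hi hj => mem_iUnion₂.2
    ⟨i, j, y, ⟨interior_subset hi, interior_subset hj⟩, rfl⟩
  let δ : ℝ → ℝ := fun c => N * c - round (N * c)
  -- As the ρ k sum to 1, G i is the ρ-weighted average of the functions N g k + round(N(g i - g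
  -- k)). Changing `i` therefore shifts it by an integer, and its exponential is a globally defined
  -- map to the circle.
  let G : t → M → ℝ := fun i y => N * g i y - ∑ k : t, δ (g i y - g k y) * ρ k y
  -- the corrected primitives differ by integers
  have hρ0 : ∀ (k : t) (y : M), y ∉ interior (K k) → ρ k y = 0 := fun k y hy => by
    by_contra h
    exact hy (hρ k (subset_tsupport _ h))
  have hGint : ∀ (i j : t) (y : M), y ∈ interior (K i) → y ∈ interior (K j) →
      G i y = G j y + round (N * (g i y - g j y)) := by
    intro i j y hi hj
    have h1 : ∀ k : t, δ (g i y - g k y) * ρ k y = δ (g j y - g k y) * ρ k y +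
        (N * (g i y - g j y) - round (N * (g i y - g j y))) * ρ k y := by
      intro k
      by_cases hk : y ∈ interior (K k)
      -- Here rounding satisfies the cocycle identity, since all three differences of primitives lie
      -- in `C` and their multiples by `N` are within 1/3 of integers.
      · have h2 := abs_lt_one_third_add (min_le_right _ _) (hNC _ (hmemC i k y hi hk))
          (hNC _ (hmemC j k y hj hk)) (c := round (N * (g i y - g j y))) (by
            have := hNC _ (hmemC i j y hi hj)
            convert this using 2
            ring)
        have h3 : ((round (N * (g i y - g k y)) : ℤ) : ℝ) =
          round (N * (g j y - g k y)) + round (N * (g i y - g j y)) := by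
          rw [← h2]; push_cast; ring
        simp only [δ, h3]
        ring
      · rw [hρ0 k y hk]; ring
    have h4 : ∑ k : t, δ (g i y - g k y) * ρ k y = ∑ k : t, δ (g j y - g k y) * ρ k y +
        (N * (g i y - g j y) - round (N * (g i y - g j y))) := by
      rw [Finset.sum_congr rfl fun k _ => h1 k, Finset.sum_add_distrib, ← Finset.mul_sum, hρ1,
        mul_one]
    simp only [G, h4]
    ring
  -- the corrected primitives near a point
  have hGloc : ∀ (i : t) (y : M), y ∈ interior (K i) → ∃ s : t → ℝ, (∀ k, |s k| < ε) ∧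
      ∀ᶠ z in 𝓝 y, G i z = N * g i z - ∑ k, s k * ρ k z := by
    intro i y hi
    -- The coefficients are locally constant where ρ k matters. Off the support the term vanishes
    -- and the coefficient is set to 0, as nothing bounds it there.
    refine ⟨fun k => if y ∈ tsupport (ρ k) then δ (g i y - g k y) else 0, fun k => ?_, ?_⟩
    · dsimp only
      split_ifs with hk
      · exact hNC _ (hmemC i k y hi (hρ k hk))
      · simpa using hεpos
    · have h1 : ∀ᶠ z in 𝓝 y, ∀ k : t, δ (g i z - g k z) * ρ k z =
          (if y ∈ tsupport (ρ k) then δ (g i y - g k y) else 0) * ρ k z := by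
        refine eventually_all.2 fun k => ?_
        by_cases hk : y ∈ tsupport (ρ k)
        · filter_upwards [hloc i k y (hKU _ (interior_subset hi))
            (hKU _ (interior_subset (hρ k hk)))] with z hz
          rw [if_pos hk, hz]
        · filter_upwards [(isClosed_tsupport (ρ k)).isOpen_compl.mem_nhds hk] with z hz
          rw [image_eq_zero_of_notMem_tsupport hz, mul_zero, mul_zero]
      filter_upwards [h1] with z hz
      simp only [G]
      rw [Finset.sum_congr rfl fun k _ => hz k]
  have hgat : ∀ (i : t) (y : M), y ∈ interior (K i) → ContMDiffAt I 𝓘(ℝ, ℝ) ∞ (g i) y :=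
    fun i y hi => (hg i).contMDiffAt ((hU i).mem_nhds (hKU _ (interior_subset hi)))
  have hGs : ∀ (i : t) (y : M), y ∈ interior (K i) → ContMDiffAt I 𝓘(ℝ, ℝ) ∞ (G i) y := by
    intro i y hi
    obtain ⟨s, -, hs⟩ := hGloc i y hi
    refine ContMDiffAt.congr_of_eventuallyEq ?_ hs
    exact (contMDiffAt_const.mul (hgat i y hi)).sub (ContMDiffAt.sum fun k _ =>
      contMDiffAt_const.mul (hρs k).contMDiffAt)
  have hcov : ∀ y, ∃ i : t, y ∈ interior (K i) := fun y => by
    obtain ⟨i, hi, hyi⟩ := mem_iUnion₂.1 (ht (mem_univ y))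
    exact ⟨⟨i, hi⟩, hyi⟩
  choose ι hι using hcov
  have hdG : ∀ (i j : t) (y : M), y ∈ interior (K i) → y ∈ interior (K j) →
      dFun I (G i) y = dFun I (G j) y := by
    intro i j y hi hj
    -- The constant integer shift is written as a sum over one index with the constant function 1,
    -- to reuse the formula for differentials of such combinations.
    have h1 : G i =ᶠ[𝓝 y] fun z => 1 * G j z -
        ∑ _k : Unit, (-(round (N * (g i y - g j y)) : ℝ)) * (1 : ℝ) := by
      filter_upwards [hloc i j y (hKU _ (interior_subset hi)) (hKU _ (interior_subset hj)),
        isOpen_interior.mem_nhds hi, isOpen_interior.mem_nhds hj] with z hz hzi hzj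
      rw [hGint i j z hzi hzj, hz]
      simp
    rw [dFun_congr h1]
    have h2 := dFun_sub_sum (I := I) (ι := Unit) (ρ := fun _ _ => (1 : ℝ)) (x := y)
      ((hGs j y hj).mdifferentiableAt (by simp)) (fun _ => mdifferentiableAt_const) 1
      (fun _ => -(round (N * (g i y - g j y)) : ℝ))
    refine h2.trans ?_
    have h3 : dFun I (fun _ : M => (1 : ℝ)) y = 0 := by
      refine ContinuousAlternatingMap.ext fun v => ?_
      change mfderiv I 𝓘(ℝ, ℝ) (fun _ : M => (1 : ℝ)) y (v 0) = 0
      rw [mfderiv_const]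
      rfl
    rw [h3]
    simp
  refine ⟨fun y => expCircle (G (ι y) y), fun y => dFun I (G (ι y)) y, fun x => ?_, fun x => ?_⟩
  · refine ⟨interior (K (ι x)), G (ι x), isOpen_interior, hι x,
      fun y hy => (hGs _ y hy).contMDiffWithinAt, fun y hy => ⟨hdG _ _ y (hι y) hy, ?_⟩⟩
    change expCircle (G (ι y) y) = _
    rw [hGint (ι y) (ι x) y (hι y) hy, expCircle_add_int]
  · obtain ⟨s, hsε, hs⟩ := hGloc (ι x) x (hι x)
    have hNpos : (0 : ℝ) < N := by exact_mod_cast hN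
    have h1 : dFun I (G (ι x)) x = (N : ℝ) • β x - ∑ k, s k • dFun I (ρ k) x := by
      rw [dFun_congr hs, dFun_sub_sum ((hgat _ x (hι x)).mdifferentiableAt (by simp))
        (fun k => (hρs k).mdifferentiableAt (by simp)),
        ← hdg (ι x) x (hKU _ (interior_subset (hι x)))]
    intro h0
    -- Since dG = Nβ - Σ sₖ dρₖ, dividing by `N` shows a perturbation of β with coefficients at most
    -- |sₖ|, because N ≥ 1.
    refine hpert (fun k => -(s k) / N) (fun k => ?_) x ?_
    · rw [abs_div, abs_neg, abs_of_pos hNpos, div_lt_iff₀ hNpos]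
      have h2 : |s k| < ε₀ := (hsε k).trans_le (min_le_left _ _)
      have h3 : (1 : ℝ) ≤ N := by exact_mod_cast hN
      nlinarith
    · have h2 := (wedge_smul_sub_sum (V := E) hNpos.ne' s (τ x) (β x)
        (fun k => dFun I (ρ k) x)).symm.trans
          ((congrArg (wedge (V := E) (τ x)) h1).symm.trans h0)
      exact (smul_eq_zero.1 h2).resolve_left hNpos.ne'

end Tischler

/-! ### Hypersurfaces given by slice charts -/

section Slices

variable {E : Type*} [NormedAddCommGroup E] [NormedSpace ℝ E]
  {H : Type*} [TopologicalSpace H] {I : ModelWithCorners ℝ E H}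
  {M : Type*} [TopologicalSpace M] [ChartedSpace H M]
  {E' : Type*} [NormedAddCommGroup E'] [NormedSpace ℝ E']

variable (I) in
/-- A chart that straightens `Z` to a hyperplane. -/
structure IsSliceChart (Z : Set M) (S : OpenPartialHomeomorph M (E' × ℝ)) : Prop where
  contMDiffOn : ContMDiffOn I 𝓘(ℝ, E' × ℝ) ∞ S S.source
  contMDiffOn_symm : ContMDiffOn 𝓘(ℝ, E' × ℝ) I ∞ S.symm S.target
  mem_iff : ∀ y ∈ S.source, y ∈ Z ↔ (S y).2 = 0

variable {Z : Set M} {S : OpenPartialHomeomorph M (E' × ℝ)}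

theorem IsSliceChart.symm_mem (hS : IsSliceChart I Z S) {u : E'} (hu : (u, (0 : ℝ)) ∈ S.target) :
    S.symm (u, 0) ∈ Z := by
  rw [hS.mem_iff _ (S.map_target hu), S.right_inv hu]

theorem IsSliceChart.apply_eq (hS : IsSliceChart I Z S) {y : M} (hy : y ∈ S.source) (hyZ : y ∈ Z) :
    S y = ((S y).1, 0) := Prod.ext rfl ((hS.mem_iff y hy).1 hyZ)

open Classical in
/-- The chart of the hypersurface induced by a slice chart. -/
def sliceChart (hS : IsSliceChart I Z S) (x₀ : Z) : OpenPartialHomeomorph Z E' where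
  toFun x := (S x).1
  -- Outside the target the value is irrelevant, and `x₀` serves as a default.
  invFun u := if h : (u, (0 : ℝ)) ∈ S.target then ⟨S.symm (u, 0), hS.symm_mem h⟩ else x₀
  source := Subtype.val ⁻¹' S.source
  target := {u | (u, (0 : ℝ)) ∈ S.target}
  map_source' x hx := by
    change ((S x).1, (0 : ℝ)) ∈ S.target
    rw [← hS.apply_eq hx x.2]
    exact S.map_source hx
  map_target' u hu := by
    change (dite _ _ _ : Z).1 ∈ S.source
    rw [dif_pos (show (u, (0 : ℝ)) ∈ S.target from hu)]
    exact S.map_target hu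
  left_inv' x hx := by
    have h : ((S x).1, (0 : ℝ)) ∈ S.target := by
      rw [← hS.apply_eq hx x.2]
      exact S.map_source hx
    rw [dif_pos h]
    refine Subtype.ext ?_
    change S.symm ((S x).1, 0) = x
    rw [← hS.apply_eq hx x.2]
    exact S.left_inv hx
  right_inv' u hu := by
    rw [dif_pos (show (u, (0 : ℝ)) ∈ S.target from hu)]
    change (S (S.symm (u, 0))).1 = u
    rw [S.right_inv hu]
  open_source := S.open_source.preimage continuous_subtype_val
  open_target := S.open_target.preimage (continuous_id.prodMk continuous_const)
  continuousOn_toFun := continuous_fst.comp_continuousOn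
    (S.continuousOn.comp continuous_subtype_val.continuousOn fun _ h => h)
  continuousOn_invFun := by
    rw [Topology.IsInducing.subtypeVal.continuousOn_iff]
    refine ContinuousOn.congr (f := fun u => S.symm (u, 0))
      (S.continuousOn_symm.comp (continuous_id.prodMk continuous_const).continuousOn
        fun _ h => h) fun u hu => ?_
    change (dite _ _ _ : Z).1 = _
    rw [dif_pos (show (u, (0 : ℝ)) ∈ S.target from hu)]

theorem sliceChart_symm_coe (hS : IsSliceChart I Z S) (x₀ : Z) {u : E'}
    (hu : (u, (0 : ℝ)) ∈ S.target) : ((sliceChart hS x₀).symm u : M) = S.symm (u, 0) :=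
   congrArg Subtype.val (dif_pos hu)

variable (I E') in
/-- Every point of `Z` is contained in a slice chart. -/
def IsHypersurface (Z : Set M) : Prop :=
  ∀ x : Z, ∃ S : OpenPartialHomeomorph M (E' × ℝ), IsSliceChart I Z S ∧ (x : M) ∈ S.source

variable (hZ : IsHypersurface I E' Z)

/-- A slice chart around a point. -/
def IsHypersurface.slice (x : Z) : OpenPartialHomeomorph M (E' × ℝ) := (hZ x).choose

theorem IsHypersurface.isSliceChart (x : Z) : IsSliceChart I Z (hZ.slice x) :=
  (hZ x).choose_spec.1

theorem IsHypersurface.mem_source (x : Z) : (x : M) ∈ (hZ.slice x).source :=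
  (hZ x).choose_spec.2

/-- The charts of a hypersurface. -/
@[reducible]
def IsHypersurface.chartedSpace : ChartedSpace E' Z where
  atlas := range fun x : Z => sliceChart (hZ.isSliceChart x) x
  chartAt x := sliceChart (hZ.isSliceChart x) x
  mem_chart_source x := hZ.mem_source x
  chart_mem_atlas x := ⟨x, rfl⟩

/-- A transition map embeds `u` as (u, 0), applies the ambient transition of slice charts, and
forgets the last coordinate, so it is smooth. -/
theorem IsHypersurface.isManifold :
    letI := hZ.chartedSpace
    IsManifold 𝓘(ℝ, E') ∞ Z := by
  let := hZ.chartedSpace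
  refine isManifold_of_contDiffOn _ _ _ ?_
  rintro _ _ ⟨a, rfl⟩ ⟨b, rfl⟩
  have ha := hZ.isSliceChart a
  have hb := hZ.isSliceChart b
  rintro u ⟨⟨hu1, hu2⟩, -⟩
  have hu1' : (u, (0 : ℝ)) ∈ (hZ.slice a).target := hu1
  have hu2' : (hZ.slice a).symm (u, 0) ∈ (hZ.slice b).source := by
    have h : ((sliceChart ha a).symm u : M) ∈ (hZ.slice b).source := hu2
    rwa [sliceChart_symm_coe ha a hu1'] at h
  have h1 : ContMDiffAt 𝓘(ℝ, E') 𝓘(ℝ, E' × ℝ) ∞ (fun u : E' => (u, (0 : ℝ))) u :=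
    (contDiff_id.prodMk contDiff_const).contDiffAt.contMDiffAt
  have h2 : ContMDiffAt 𝓘(ℝ, E') I ∞ (fun u : E' => (hZ.slice a).symm (u, 0)) u :=
    ContMDiffAt.comp u (ha.contMDiffOn_symm.contMDiffAt ((hZ.slice a).open_target.mem_nhds hu1')) h1
  have h3 : ContMDiffAt 𝓘(ℝ, E') 𝓘(ℝ, E' × ℝ) ∞
      (fun u : E' => hZ.slice b ((hZ.slice a).symm (u, 0))) u :=
    ContMDiffAt.comp u (hb.contMDiffOn.contMDiffAt ((hZ.slice b).open_source.mem_nhds hu2')) h2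
  refine ContDiffAt.contDiffWithinAt (ContDiffAt.congr_of_eventuallyEq
    (contDiff_fst.contDiffAt.comp u h3.contDiffAt) ?_)
  filter_upwards [(sliceChart ha a).open_target.mem_nhds hu1] with w hw
  change (hZ.slice b ((sliceChart ha a).symm w : M)).1 = _
  rw [sliceChart_symm_coe ha a hw]
  rfl

theorem IsHypersurface.contMDiff_val :
    letI := hZ.chartedSpace
    ContMDiff 𝓘(ℝ, E') I ∞ (Subtype.val : Z → M) := by
  let := hZ.chartedSpace
  have := hZ.isManifold
  intro x
  have hx := hZ.isSliceChart x
  have hxs := hZ.mem_source x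
  have h1 : ContMDiffAt 𝓘(ℝ, E') 𝓘(ℝ, E') ∞ (extChartAt 𝓘(ℝ, E') x) x := contMDiffAt_extChartAt
  have h2 : ContMDiffAt 𝓘(ℝ, E') 𝓘(ℝ, E' × ℝ) ∞ (fun z : Z => (extChartAt 𝓘(ℝ, E') x z, (0 : ℝ)))
      x :=
    ContMDiffAt.comp x (g := fun u : E' => (u, (0 : ℝ)))
      (contDiff_id.prodMk contDiff_const).contDiffAt.contMDiffAt h1
  have h3 : ∀ z : Z, (z : M) ∈ (hZ.slice x).source →
      (extChartAt 𝓘(ℝ, E') x z, (0 : ℝ)) = hZ.slice x z := fun z hz =>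
    (hx.apply_eq hz z.2).symm
  refine ContMDiffAt.congr_of_eventuallyEq (ContMDiffAt.comp x
    (g := (hZ.slice x).symm) (hx.contMDiffOn_symm.contMDiffAt
      ((hZ.slice x).open_target.mem_nhds ?_)) h2) ?_
  · rw [h3 x hxs]
    exact (hZ.slice x).map_source hxs
  · filter_upwards [continuous_subtype_val.continuousAt.eventually_mem
      ((hZ.slice x).open_source.mem_nhds hxs)] with z hz
    rw [Function.comp_apply, h3 z hz, (hZ.slice x).left_inv hz]

/-- The charts of `Z` are components of charts of `M`, so smoothness into `Z` can be checked in `M`.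
-/
theorem IsHypersurface.contMDiffAt_of_val {F : Type*} [NormedAddCommGroup F] [NormedSpace ℝ F]
    {K : Type*} [TopologicalSpace K] {J : ModelWithCorners ℝ F K} {N : Type*} [TopologicalSpace N]
    [ChartedSpace K N] {f : N → Z} {x : N} (hf : ContMDiffAt J I ∞ (fun y => (f y : M)) x) :
    letI := hZ.chartedSpace
    ContMDiffAt J 𝓘(ℝ, E') ∞ f x := by
  let := hZ.chartedSpace
  refine contMDiffAt_iff_target.2 ⟨?_, ?_⟩
  · exact Topology.IsInducing.subtypeVal.continuousAt_iff.2 hf.continuousAt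
  · have h1 : ContMDiffAt J 𝓘(ℝ, E' × ℝ) ∞ (fun y => hZ.slice (f x) (f y)) x :=
      ContMDiffAt.comp x ((hZ.isSliceChart (f x)).contMDiffOn.contMDiffAt
        ((hZ.slice (f x)).open_source.mem_nhds (hZ.mem_source (f x)))) hf
    exact ContMDiffAt.comp x (g := (Prod.fst : E' × ℝ → E'))
      contDiff_fst.contDiffAt.contMDiffAt h1

end Slices

/-! ### The inverse function theorem and adapted linear coordinates -/

section LocalInverse

variable {E F : Type*} [NormedAddCommGroup E] [NormedSpace ℝ E] [CompleteSpace E]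
  [NormedAddCommGroup F] [NormedSpace ℝ F]

/-- The inverse function theorem, with smoothness on a neighbourhood. -/
theorem exists_smooth_localInverse {f : E → F} {U : Set E} (hU : IsOpen U)
    (hf : ContDiffOn ℝ ∞ f U) {x : E} (hx : x ∈ U) {f' : E ≃L[ℝ] F}
    (hf' : HasFDerivAt f (f' : E →L[ℝ] F) x) : ∃ Q : OpenPartialHomeomorph E F,
      x ∈ Q.source ∧ Q.source ⊆ U ∧ ⇑Q = f ∧ ContDiffOn ℝ ∞ Q.symm Q.target := by
  have hfx := hf.contDiffAt (hU.mem_nhds hx)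
  have hn : (∞ : WithTop ℕ∞) ≠ 0 := by simp
  let Q₀ := hfx.toOpenPartialHomeomorph f hf' hn
  -- Restricting to points where the derivative is invertible makes the inverse smooth on its whole
  -- domain and not just at the image of `x`.
  let W : Set E := {y | y ∈ U ∧ ∃ g : E ≃L[ℝ] F, (g : E →L[ℝ] F) = fderiv ℝ f y}
  have hW : IsOpen W := by
    refine (hf.continuousOn_fderiv_of_isOpen hU (by simp)).isOpen_inter_preimage hU
      (t := range ((↑) : (E ≃L[ℝ] F) → E →L[ℝ] F)) ContinuousLinearEquiv.isOpen
  have hQ₀ : ⇑Q₀ = f := rfl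
  refine ⟨Q₀.restrOpen W hW, ⟨hfx.mem_toOpenPartialHomeomorph_source hf' hn,
    hx, f', hf'.fderiv.symm⟩, fun y hy => hy.2.1, rfl, fun z hz => ?_⟩
  have hz' := (Q₀.restrOpen W hW).map_target hz
  obtain ⟨-, hyU, g, hg⟩ := hz'
  refine ((Q₀.restrOpen W hW).contDiffAt_symm hz (f₀' := g) ?_ ?_).contDiffWithinAt
  · rw [hg]
    exact ((hf.contDiffAt (hU.mem_nhds hyU)).differentiableAt (by simp)).hasFDerivAt
  · exact hf.contDiffAt (hU.mem_nhds hyU)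

/-- With l(x) = 1, split v into its component v - l(v)x in ker l, identified with `E'` by dimension,
and the number l(v). -/
theorem exists_equiv_prod_of_ne_zero {E' : Type*} [NormedAddCommGroup E'] [NormedSpace ℝ E']
    [FiniteDimensional ℝ E] [FiniteDimensional ℝ E']
    (hE : Module.finrank ℝ E = Module.finrank ℝ E' + 1) {l : E →L[ℝ] ℝ} (hl : l ≠ 0) :
    ∃ B : E ≃L[ℝ] E' × ℝ, ∀ v, (B v).2 = l v := by
  obtain ⟨x, hx⟩ := exists_apply_eq_one hl
  let k := LinearMap.ker l.toLinearMap
  have hl' : l.toLinearMap ≠ 0 := fun h => by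
    have := LinearMap.congr_fun h x
    simp [hx] at this
  have hk : Module.finrank ℝ k = Module.finrank ℝ E' := by
    have : Module.finrank ℝ k + 1 = Module.finrank ℝ E :=
      Module.Dual.finrank_ker_add_one_of_ne_zero (f := l.toLinearMap) hl'
    omega
  let e : k ≃ₗ[ℝ] E' := LinearEquiv.ofFinrankEq _ _ hk
  let π : E →ₗ[ℝ] k := LinearMap.codRestrict k (LinearMap.id - l.toLinearMap.smulRight x)
    fun v => by simp [k, hx]
  let T : E →ₗ[ℝ] E' × ℝ := (e.toLinearMap ∘ₗ π).prod l.toLinearMap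
  have hT : Function.Injective T := by
    refine (injective_iff_map_eq_zero _).2 fun v hv => ?_
    have h1 : l v = 0 := (Prod.ext_iff.1 hv).2
    have h2 : π v = 0 := e.map_eq_zero_iff.1 (Prod.ext_iff.1 hv).1
    have h3 : v - l v • x = 0 := congrArg Subtype.val h2
    simpa [h1] using h3
  have hdim : Module.finrank ℝ E = Module.finrank ℝ (E' × ℝ) := by
    rw [Module.finrank_prod, hE, Module.finrank_self]
  exact ⟨(LinearMap.linearEquivOfInjective T hT hdim).toContinuousLinearEquiv, fun v => rfl⟩

end LocalInverse

/-! ### The fibres of a map to the circle -/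

section Fibre

theorem expCircle_eq_one_iff {y : ℝ} : expCircle y = 1 ↔ ∃ m : ℤ, y = m := by
  rw [expCircle, Circle.exp_eq_one]
  refine exists_congr fun m => ⟨fun h => ?_, fun h => by rw [h]; ring⟩
  have : (2 * Real.pi) * y = (2 * Real.pi) * m := by rw [h]; ring
  exact mul_left_cancel₀ (by positivity) this

theorem expCircle_add (x y : ℝ) : expCircle (x + y) = expCircle x * expCircle y := by
  rw [expCircle, expCircle, expCircle, mul_add, Circle.exp_add]

theorem expCircle_zero : expCircle 0 = 1 := expCircle_eq_one_iff.2 ⟨0, by simp⟩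

variable {E : Type*} [NormedAddCommGroup E] [NormedSpace ℝ E] [FiniteDimensional ℝ E]
  {H : Type*} [TopologicalSpace H] {I : ModelWithCorners ℝ E H}
  {M : Type*} [TopologicalSpace M] [ChartedSpace H M] [I.Boundaryless] [IsManifold I ∞ M]
  {E' : Type*} [NormedAddCommGroup E'] [NormedSpace ℝ E'] [FiniteDimensional ℝ E']

variable (I) in
/-- A chart of `M` followed by a partial homeomorphism of the model vector space. -/
def extChartTrans {G : Type*} [TopologicalSpace G] (x : M) (Q : OpenPartialHomeomorph E G) :
    OpenPartialHomeomorph M G where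
  toPartialEquiv := (extChartAt I x).trans Q.toPartialEquiv
  open_source := (continuousOn_extChartAt x).isOpen_inter_preimage (isOpen_extChartAt_source x)
    Q.open_source
  open_target := Q.continuousOn_symm.isOpen_inter_preimage Q.open_target
    (isOpen_extChartAt_target x)
  continuousOn_toFun := Q.continuousOn.comp ((continuousOn_extChartAt x).mono inter_subset_left)
    fun _ h => h.2
  continuousOn_invFun := (continuousOn_extChartAt_symm x).comp
    (Q.continuousOn_symm.mono inter_subset_left) fun _ h => h.2

/-- Locally the fibre is a level set of a lift `g` of p, and dg = β does not vanish; so g - g(x) can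
be taken as the last coordinate of a chart. -/
theorem HasLocalLifts.isHypersurface {p : M → Circle} {β : DForm I M 1} (h : HasLocalLifts p β)
    (hβ : ∀ x, toFunctional (V := E) (β x) ≠ 0)
    (hE : Module.finrank ℝ E = Module.finrank ℝ E' + 1) : IsHypersurface I E' {y | p y = 1} := by
  rintro ⟨x, hx⟩
  have hx : p x = 1 := hx
  obtain ⟨U, g, hU, hxU, hg, hy⟩ := h x
  set ψ := extChartAt I x with hψ
  have hxx : ψ.symm (ψ x) = x := ψ.left_inv (mem_extChartAt_source x)
  have hgx : expCircle (g x) = 1 := by rw [← (hy x hxU).2, hx]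
  -- On this neighbourhood g differs from the integer g(x) by less than 1, so p = 1 forces g = g(x)
  -- and other sheets of the lift are excluded.
  let U₁ : Set M := U ∩ {y | |g y - g x| < 1}
  have hU₁ : IsOpen U₁ := ((hg.continuousOn.sub continuousOn_const).abs).isOpen_inter_preimage hU
    isOpen_Iio
  have hxU₁ : x ∈ U₁ := ⟨hxU, by simp⟩
  have hpU₁ : ∀ y ∈ U₁, p y = 1 ↔ g y - g x = 0 := by
    rintro y ⟨hyU, hy1⟩
    have h1 : p y = expCircle (g y - g x) := by
      rw [(hy y hyU).2, ← mul_one (expCircle (g y - g x)), ← hgx, ← expCircle_add,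
        sub_add_cancel]
    rw [h1, expCircle_eq_one_iff]
    refine ⟨?_, fun h => ⟨0, by simpa using h⟩⟩
    rintro ⟨m, hm⟩
    have hy1 : |g y - g x| < 1 := hy1
    rw [hm] at hy1 ⊢
    have : |m| < 1 := by exact_mod_cast hy1
    rw [Int.abs_lt_one_iff.1 this, Int.cast_zero]
  let V : Set E := ψ.target ∩ ψ.symm ⁻¹' U₁
  have hV : IsOpen V := (continuousOn_extChartAt_symm x).isOpen_inter_preimage
    (isOpen_extChartAt_target x) hU₁
  have hxV : ψ x ∈ V := ⟨mem_extChartAt_target x, by rwa [mem_preimage, hxx]⟩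
  have hgV : ContDiffOn ℝ ∞ (fun z => g (ψ.symm z) - g x) V := by
    rintro z ⟨hz1, hz2⟩
    exact ((ContMDiffAt.comp z (hg.contMDiffAt (hU.mem_nhds hz2.1))
      (contMDiffAt_extChartAt_symm hz1)).contDiffAt.sub contDiffAt_const).contDiffWithinAt
  set l : E →L[ℝ] ℝ := fderiv ℝ (fun z => g (ψ.symm z) - g x) (ψ x) with hl
  have hgd : HasFDerivAt (fun z => g (ψ.symm z) - g x) l (ψ x) :=
    ((hgV.contDiffAt (hV.mem_nhds hxV)).differentiableAt (by simp)).hasFDerivAt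
  have hl0 : l ≠ 0 := by
    intro h0
    refine hβ x (ContinuousLinearMap.ext fun v => ?_)
    have h1 : HasFDerivAt (g ∘ ψ.symm) l (ψ x) := by
      have := hgd.add_const (g x)
      simp only [sub_add_cancel] at this
      exact this
    have hgm : MDifferentiableAt I 𝓘(ℝ, ℝ) g (ψ.symm (ψ x)) := by
      rw [hxx]
      exact (hg.contMDiffAt (hU.mem_nhds hxU)).mdifferentiableAt (by simp)
    let A : E →L[ℝ] ℝ := mfderiv I 𝓘(ℝ, ℝ) g (ψ.symm (ψ x))
    let A' : E →L[ℝ] E := mfderiv 𝓘(ℝ, E) I ψ.symm (ψ x)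
    have hc : HasFDerivAt (g ∘ ψ.symm) (A.comp A') (ψ x) :=
      (hgm.hasMFDerivAt.comp (ψ x) (mdifferentiableAt_extChartAt_symm' (I := I)
        (mem_extChartAt_target x)).hasMFDerivAt).hasFDerivAt
    have h2 := hc.unique h1
    let w : E := mfderiv I 𝓘(ℝ, E) ψ x v
    have h3 := DFunLike.congr_fun h2 w
    rw [h0] at h3
    have h4 : toFunctional (V := E) (β x) v = mfderiv I 𝓘(ℝ, ℝ) g x v :=
      congrArg (fun a : E [⋀^Fin 1]→L[ℝ] ℝ => toFunctional a v) (hy x hxU).1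
    have h5 : ∀ (z : M), z = x → ∀ w : E, (mfderiv I 𝓘(ℝ, ℝ) g z : E →L[ℝ] ℝ) w =
        (mfderiv I 𝓘(ℝ, ℝ) g x : E →L[ℝ] ℝ) w := by rintro z rfl w; rfl
    refine h4.trans (Eq.trans ?_ ((h5 _ hxx _).symm.trans h3))
    exact congrArg (mfderiv I 𝓘(ℝ, ℝ) g x)
      (mfderiv_symm_extChartAt_apply (mem_extChartAt_source x) v).symm
  obtain ⟨B, hB⟩ := exists_equiv_prod_of_ne_zero hE hl0
  -- The last component of `B` is the differential of g - g(x); replacing it by the function itself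
  -- gives a map whose derivative at the base point is exactly `B`.
  have hfV : ContDiffOn ℝ ∞ (fun z => ((B z).1, g (ψ.symm z) - g x)) V :=
    (contDiff_fst.comp B.contDiff).contDiffOn.prodMk hgV
  have hfd : HasFDerivAt (fun z => ((B z).1, g (ψ.symm z) - g x)) (B : E →L[ℝ] E' × ℝ) (ψ x) := by
    have h1 := (((ContinuousLinearMap.fst ℝ E' ℝ).comp
      (B : E →L[ℝ] E' × ℝ)).hasFDerivAt (x := ψ x)).prodMk hgd
    have h2 : (((ContinuousLinearMap.fst ℝ E' ℝ).comp (B : E →L[ℝ] E' × ℝ)).prod l) =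
        (B : E →L[ℝ] E' × ℝ) := ContinuousLinearMap.ext fun v => Prod.ext rfl (hB v).symm
    rw [h2] at h1
    exact h1
  obtain ⟨Q, hQx, hQV, hQ, hQs⟩ := exists_smooth_localInverse hV hfV hxV hfd
  refine ⟨extChartTrans I x Q, ⟨?_, ?_, ?_⟩, mem_extChartAt_source x, hQx⟩
  · rintro y ⟨hy1, hy2⟩
    have h1 : ContDiffAt ℝ ∞ Q (ψ y) := by
      rw [hQ]
      exact hfV.contDiffAt (hV.mem_nhds (hQV hy2))
    exact (ContMDiffAt.comp y h1.contMDiffAt (contMDiffAt_extChartAt_of_mem hy1)).contMDiffWithinAt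
  · rintro z ⟨hz1, hz2⟩
    exact (ContMDiffAt.comp z (contMDiffAt_extChartAt_symm hz2)
      (hQs.contDiffAt (Q.open_target.mem_nhds hz1)).contMDiffAt).contMDiffWithinAt
  · rintro y ⟨hy1, hy2⟩
    have h1 : ψ.symm (ψ y) = y := ψ.left_inv hy1
    have h2 : ψ.symm (ψ y) ∈ U₁ := (hQV hy2).2
    rw [h1] at h2
    have h3 : (extChartTrans I x Q y).2 = g y - g x := by
      change (Q (ψ y)).2 = _
      rw [hQ]
      change g (ψ.symm (ψ y)) - g x = _
      rw [h1]
    rw [h3]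
    exact hpU₁ y h2

end Fibre

/-! ### Maps with smooth local sections -/

section LocalSections

variable {E : Type*} [NormedAddCommGroup E] [NormedSpace ℝ E]
  {H : Type*} [TopologicalSpace H] {I : ModelWithCorners ℝ E H}
  {P : Type*} [TopologicalSpace P] [ChartedSpace H P]
  {E' : Type*} [NormedAddCommGroup E'] [NormedSpace ℝ E']
  {H' : Type*} [TopologicalSpace H'] {J : ModelWithCorners ℝ E' H'}
  {N : Type*} [TopologicalSpace N] [ChartedSpace H' N]
  {E'' : Type*} [NormedAddCommGroup E''] [NormedSpace ℝ E'']
  {H'' : Type*} [TopologicalSpace H''] {K : ModelWithCorners ℝ E'' H''}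
  {Q : Type*} [TopologicalSpace Q] [ChartedSpace H'' Q] {k : ℕ}

variable (I J) in
/-- Every point of the target of `q` lies in the domain of a smooth local section. -/
def HasLocalSections (q : P → N) : Prop :=
  ∀ y : N, ∃ s : N → P, ContMDiffAt J I ∞ s y ∧ ∀ᶠ w in 𝓝 y, q (s w) = w

theorem HasLocalSections.contMDiff {q : P → N} (hq : HasLocalSections I J q) {f : N → Q}
    (hf : ContMDiff I K ∞ (f ∘ q)) : ContMDiff J K ∞ f := by
  intro y
  obtain ⟨s, hs, hqs⟩ := hq y
  exact (hf.contMDiffAt.comp y hs).congr_of_eventuallyEq (hqs.mono fun w hw =>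
    congrArg f hw.symm)

variable [I.Boundaryless] [IsManifold I ∞ P] [J.Boundaryless] [IsManifold J ∞ N]
  [FiniteDimensional ℝ E] [FiniteDimensional ℝ E']

/-- Locally η is the pullback along `s` of q*η, since q ∘ s is the identity. So smoothness and
equality of forms on the target can be tested upstairs. -/
theorem HasLocalSections.eventually_pullRep {X : Type*} [NormedAddCommGroup X] [NormedSpace ℝ X]
    {q : P → N} (hq : ContMDiff I J ∞ q) (η : DForm J N k) {y : N}
    {s : N → P} (hs : ContMDiffAt J I ∞ s y) (hqs : ∀ᶠ w in 𝓝 y, q (s w) = w) {F : X → N} {x : X}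
    (hF : ContMDiffAt 𝓘(ℝ, X) J ∞ F x) (hFx : F x = y) : pullRep F η =ᶠ[𝓝 x]
      pullRep (s ∘ F) (pullback (I := I) q η) := by
  subst hFx
  have h1 := eventually_pullRep_pullback (ContMDiffAt.comp x hs hF) hq η
  have h2 : ∀ᶠ z in 𝓝 x, q (s (F z)) = F z := hF.continuousAt.eventually hqs
  filter_upwards [h1, h2.eventually_nhds] with z hz1 hz2
  rw [hz1]
  exact pullRep_congr η (hz2.mono fun w hw => hw.symm)

theorem HasLocalSections.isSmooth {q : P → N} (hq' : HasLocalSections I J q)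
    (hq : ContMDiff I J ∞ q) {η : DForm J N k} (hη : IsSmooth (pullback (I := I) q η)) :
    IsSmooth η := by
  refine isSmooth_iff.2 fun x₀ y hy => ?_
  have hF := contMDiffAt_extChartAt_symm (I := J) hy
  obtain ⟨s, hs, hqs⟩ := hq' ((extChartAt J x₀).symm y)
  exact (hη.contDiffAt_pullRep (ContMDiffAt.comp y hs hF)).congr_of_eventuallyEq
    (HasLocalSections.eventually_pullRep hq η hs hqs hF rfl)

theorem HasLocalSections.pullback_injective {q : P → N} (hq' : HasLocalSections I J q)
    (hq : ContMDiff I J ∞ q) {η ζ : DForm J N k}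
    (h : pullback (I := I) q η = pullback (I := I) q ζ) : η = ζ := by
  refine form_ext fun y => ?_
  have hF := contMDiffAt_extChartAt_symm (I := J) (mem_extChartAt_target (I := J) y)
  obtain ⟨s, hs, hqs⟩ := hq' ((extChartAt J y).symm (extChartAt J y y))
  rw [(HasLocalSections.eventually_pullRep hq η hs hqs hF rfl).self_of_nhds,
    (HasLocalSections.eventually_pullRep hq ζ hs hqs hF rfl).self_of_nhds, h]

end LocalSections

/-! ### Smooth maps and forms on mapping tori -/

namespace MappingTorus

section MappingTorusForms

variable {E : Type*} [NormedAddCommGroup E] [NormedSpace ℝ E]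
  {H : Type*} [TopologicalSpace H] {I : ModelWithCorners ℝ E H}
  {F : Type*} [TopologicalSpace F] [ChartedSpace H F] [IsManifold I ∞ F] (φ : F ≃ₘ⟮I, I⟯ F)

/-- The deck transformation `(x, t) ↦ (φⁿ x, t - n)`. -/
def deck (n : ℤ) (p : F × ℝ) : F × ℝ := (((φ.toEquiv : Equiv.Perm F) ^ n) p.1, p.2 - (n : ℝ))

theorem mk_deck (n : ℤ) (p : F × ℝ) : mk φ (deck φ n p) = mk φ p :=
  (mk_eq_mk_iff φ _ _).2 ⟨n, rfl⟩

/-- A chosen representative. -/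
def lift (y : MappingTorus φ) : F × ℝ := (mk_surjective φ).hasRightInverse.choose y

theorem mk_lift (y : MappingTorus φ) : mk φ (lift φ y) = y :=
  (mk_surjective φ).hasRightInverse.choose_spec y

/-- The local section of the quotient map through the chosen representative. -/
def localSection (y : MappingTorus φ) : OpenPartialHomeomorph (MappingTorus φ) (F × ℝ) :=
  (isLocalHomeomorph_mk φ).localInverseAt (lift φ y)

theorem mem_localSection_source (y : MappingTorus φ) : y ∈ (localSection φ y).source := by
  have h := (isLocalHomeomorph_mk φ).apply_self_mem_localInverseAt_source (x := lift φ y)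
  rwa [mk_lift] at h

theorem mk_localSection {y w : MappingTorus φ} (hw : w ∈ (localSection φ y).source) :
    mk φ (localSection φ y w) = w :=
  (isLocalHomeomorph_mk φ).apply_localInverseAt_of_mem hw

theorem localSection_self (y : MappingTorus φ) : localSection φ y y = lift φ y := by
  have h := (isLocalHomeomorph_mk φ).injOn_localInverseAt_target (x := lift φ y)
    ((localSection φ y).map_source (mem_localSection_source φ y))
    (isLocalHomeomorph_mk φ).self_mem_localInverseAt_target
  exact h ((mk_localSection φ (mem_localSection_source φ y)).trans (mk_lift φ y).symm)

theorem chartAt_eq (y : MappingTorus φ) : chartAt (ModelProd H ℝ) y =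
    (localSection φ y).trans (chartAt (ModelProd H ℝ) (lift φ y)) := rfl

theorem eventually_localSection_mk (y : MappingTorus φ) {z : F × ℝ} (hz : mk φ z = y) :
    ∃ n : ℤ, ∀ᶠ w in 𝓝 z, localSection φ y (mk φ w) = deck φ n w :=
  eventually_localInverse_mk φ (lift φ y) z (by rw [hz]; exact mem_localSection_source φ y)

/-- In a chart of the mapping torus the quotient map reads as a deck transformation followed by a
chart of the product. -/
theorem contMDiff_mk : ContMDiff (I.prod 𝓘(ℝ, ℝ)) (I.prod 𝓘(ℝ, ℝ)) ∞ (mk φ) := by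
  intro z
  refine contMDiffAt_iff_target.2 ⟨(isLocalHomeomorph_mk φ).continuous.continuousAt, ?_⟩
  obtain ⟨n, hn⟩ := eventually_localSection_mk φ (mk φ z) rfl
  have h1 : localSection φ (mk φ z) (mk φ z) = deck φ n z := hn.self_of_nhds
  have h2 : ContMDiffAt (I.prod 𝓘(ℝ, ℝ)) 𝓘(ℝ, E × ℝ) ∞
      (fun w => extChartAt (I.prod 𝓘(ℝ, ℝ)) (lift φ (mk φ z)) (deck φ n w)) z := by
    refine ContMDiffAt.comp z (contMDiffAt_extChartAt' ?_) (contMDiff_deck φ n).contMDiffAt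
    rw [← h1, localSection_self]
    exact mem_chart_source _ _
  refine h2.congr_of_eventuallyEq ?_
  filter_upwards [hn] with w hw
  rw [← hw]
  rfl

theorem contMDiffAt_localSection (y : MappingTorus φ) :
    ContMDiffAt (I.prod 𝓘(ℝ, ℝ)) (I.prod 𝓘(ℝ, ℝ)) ∞ (localSection φ y) y := by
  set c := chartAt (ModelProd H ℝ) (lift φ y) with hc
  have hmem : lift φ y ∈ c.source := mem_chart_source _ _
  have h1 : ContMDiffAt (I.prod 𝓘(ℝ, ℝ)) (I.prod 𝓘(ℝ, ℝ)) ∞ c.symm (chartAt (ModelProd H ℝ) y y) :=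
      by
    refine (contMDiffOn_chart_symm (x := lift φ y)).contMDiffAt (c.open_target.mem_nhds ?_)
    rw [chartAt_eq, OpenPartialHomeomorph.coe_trans, Function.comp_apply, localSection_self]
    exact c.map_source hmem
  have h2 : ContMDiffAt (I.prod 𝓘(ℝ, ℝ)) (I.prod 𝓘(ℝ, ℝ)) ∞ (chartAt (ModelProd H ℝ) y) y :=
    (contMDiffOn_chart (x := y)).contMDiffAt
      ((chartAt (ModelProd H ℝ) y).open_source.mem_nhds (mem_chart_source _ y))
  refine (ContMDiffAt.comp y h1 h2).congr_of_eventuallyEq ?_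
  filter_upwards [(chartAt (ModelProd H ℝ) y).open_source.mem_nhds (mem_chart_source _ y)] with w hw
  have hw' : localSection φ y w ∈ c.source := by
    rw [chartAt_eq, OpenPartialHomeomorph.trans_source] at hw
    exact hw.2
  change _ = c.symm (c (localSection φ y w))
  exact (c.left_inv hw').symm

theorem hasLocalSections_mk : HasLocalSections (I.prod 𝓘(ℝ, ℝ)) (I.prod 𝓘(ℝ, ℝ)) (mk φ) :=
  fun y => ⟨localSection φ y, contMDiffAt_localSection φ y,
    ((localSection φ y).open_source.eventually_mem (mem_localSection_source φ y)).mono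
      fun _ hw => mk_localSection φ hw⟩

/-- Invariant forms descend to the mapping torus. -/
theorem exists_pullback_mk_eq {k : ℕ} {η : DForm (I.prod 𝓘(ℝ, ℝ)) (F × ℝ) k}
    (hη : ∀ n : ℤ, pullback (I := I.prod 𝓘(ℝ, ℝ)) (deck φ n) η = η) :
    ∃ ζ : DForm (I.prod 𝓘(ℝ, ℝ)) (MappingTorus φ) k,
      pullback (I := I.prod 𝓘(ℝ, ℝ)) (mk φ) ζ = η := by
  -- Each point uses its own section. The composite of any section with the quotient map is locally
  -- a deck transformation, so invariance removes the choice.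
  refine ⟨fun y => pullback (I := I.prod 𝓘(ℝ, ℝ)) (localSection φ y) η y, funext fun z => ?_⟩
  obtain ⟨n, hn⟩ := eventually_localSection_mk φ (mk φ z) rfl
  have h1 : pullback (I := I.prod 𝓘(ℝ, ℝ)) (mk φ)
      (fun y => pullback (I := I.prod 𝓘(ℝ, ℝ)) (localSection φ y) η y) z =
      pullback (I := I.prod 𝓘(ℝ, ℝ)) (mk φ)
        (pullback (I := I.prod 𝓘(ℝ, ℝ)) (localSection φ (mk φ z)) η) z := rfl
  have h2 := pullback_comp (mk φ) (localSection φ (mk φ z)) η (x := z)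
    ((contMDiffAt_localSection φ (mk φ z)).mdifferentiableAt (by simp))
    ((contMDiff_mk φ).mdifferentiableAt (by simp))
  have hn' : localSection φ (mk φ z) ∘ mk φ =ᶠ[𝓝 z] deck φ n := hn
  rw [h1, h2]
  refine Eq.trans ?_ (congrFun (hη n) z)
  refine ContinuousAlternatingMap.ext fun v => ?_
  rw [pullback_apply, pullback_apply, hn'.mfderiv_eq]
  exact form_apply_congr η hn'.self_of_nhds _

end MappingTorusForms

end MappingTorus

/-! ### Flows transverse to the fibres of a map to the circle -/

section Circle

theorem contMDiff_expCircle : ContMDiff 𝓘(ℝ, ℝ) (𝓡 1) ∞ expCircle :=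
  contMDiff_circleExp.comp (contDiff_const.mul contDiff_id).contMDiff

/-- A right inverse of `expCircle`, smooth outside the point antipodal to `expCircle s`. -/
def circleLog (s : ℝ) (z : Circle) : ℝ :=
  s + Complex.arg (z * expCircle (-s) : Circle) / (2 * Real.pi)

theorem expCircle_neg_mul (s : ℝ) (z : Circle) : z * expCircle (-s) * expCircle s = z := by
  rw [mul_assoc, ← expCircle_add, neg_add_cancel, expCircle_zero, mul_one]

theorem expCircle_circleLog (s : ℝ) (z : Circle) : expCircle (circleLog s z) = z := by
  rw [circleLog, expCircle_add, mul_comm]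
  conv_rhs => rw [← expCircle_neg_mul s z]
  congr 1
  rw [expCircle, mul_div_cancel₀ _ (by positivity), Circle.exp_arg]

theorem expCircle_eq_iff {s t : ℝ} : expCircle s = expCircle t ↔ ∃ m : ℤ, s = t + m := by
  have h : expCircle s = expCircle t ↔ expCircle (s - t) = 1 := by
    conv_lhs => rw [← sub_add_cancel s t, expCircle_add]
    exact mul_eq_right
  rw [h, expCircle_eq_one_iff]
  exact exists_congr fun m => sub_eq_iff_eq_add'

/-- The domain of smoothness of `circleLog`. -/
def circleLogDomain (s : ℝ) : Set Circle :=
  {z | ((z * expCircle (-s) : Circle) : ℂ) ∈ Complex.slitPlane}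

theorem isOpen_circleLogDomain (s : ℝ) : IsOpen (circleLogDomain s) :=
  Complex.isOpen_slitPlane.preimage
    (continuous_subtype_val.comp (continuous_id.mul continuous_const : Continuous fun z : Circle =>
      z * expCircle (-s)))

theorem mem_circleLogDomain (s : ℝ) : expCircle s ∈ circleLogDomain s := by
  change ((expCircle s * expCircle (-s) : Circle) : ℂ) ∈ Complex.slitPlane
  rw [← expCircle_add, add_neg_cancel, expCircle_zero]
  exact Complex.one_mem_slitPlane

theorem contMDiffAt_circleLog {s : ℝ} {z : Circle} (hz : z ∈ circleLogDomain s) :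
    ContMDiffAt (𝓡 1) 𝓘(ℝ, ℝ) ∞ (circleLog s) z := by
  have : Fact (Module.finrank ℝ ℂ = 1 + 1) := ⟨Complex.finrank_real_complex⟩
  have h1 : ContMDiffAt (𝓡 1) (𝓡 1) ∞ (fun z : Circle => z * expCircle (-s)) z :=
    (contMDiff_mul_right (I := 𝓡 1) (n := ω) (a := expCircle (-s))).contMDiffAt.of_le (by simp)
  have h2 : ContMDiff (M := Circle) (𝓡 1) 𝓘(ℝ, ℂ) ∞ fun z => (z : ℂ) :=
    contMDiff_coe_sphere (E := ℂ) (n := 1)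
  have h3 : ContDiffAt ℝ ∞ Complex.log ((z * expCircle (-s) : Circle) : ℂ) :=
    (Complex.contDiffAt_log hz).restrict_scalars ℝ
  have h4 : ContDiffAt ℝ ∞ (fun w : ℂ => s + Complex.imCLM (Complex.log w) / (2 * Real.pi))
      ((z * expCircle (-s) : Circle) : ℂ) :=
    contDiffAt_const.add ((Complex.imCLM.contDiff.contDiffAt.comp _ h3).div_const _)
  have h5 := ContMDiffAt.comp z h4.contMDiffAt (ContMDiffAt.comp z h2.contMDiffAt h1)
  refine h5.congr_of_eventuallyEq (Eventually.of_forall fun w => ?_)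
  change _ = s + (Complex.log _).im / _
  rw [Complex.log_im]
  rfl

end Circle

/-! ### Suspension flows: first return map, mapping torus and fibre bundle -/

section Suspension

variable {E : Type*} [NormedAddCommGroup E] [NormedSpace ℝ E]
  {H : Type*} [TopologicalSpace H] {I : ModelWithCorners ℝ E H}
  {M : Type*} [TopologicalSpace M] [ChartedSpace H M]
  {E' : Type*} [NormedAddCommGroup E'] [NormedSpace ℝ E']
  {H' : Type*} [TopologicalSpace H'] {J : ModelWithCorners ℝ E' H'}
  {F : Type*} [TopologicalSpace F] [ChartedSpace H' F]

section

variable [FiniteDimensional ℝ E] [I.Boundaryless] [IsManifold I ∞ M]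

theorem HasLocalLifts.contMDiff {p : M → Circle} {β : DForm I M 1} (h : HasLocalLifts p β) :
    ContMDiff I (𝓡 1) ∞ p := by
  intro x
  obtain ⟨U, g, hU, hx, hg, hy⟩ := h x
  refine (contMDiff_expCircle.contMDiffAt.comp x
    (hg.contMDiffAt (hU.mem_nhds hx))).congr_of_eventuallyEq ?_
  exact (hU.eventually_mem hx).mono fun y hyU => (hy y hyU).2

/-- Along a curve whose velocity pairs to `1` with `β`, the map to the circle turns at unit
speed. -/
theorem HasLocalLifts.apply_integralCurve {p : M → Circle} {β : DForm I M 1}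
    (h : HasLocalLifts p β) {v : (x : M) → TangentSpace I x}
    (hv : ∀ x, toFunctional (V := E) (β x) (v x) = 1) {γ : ℝ → M}
    (hγ : IsMIntegralCurve (I := I) γ v) (t : ℝ) : p (γ t) = expCircle t * p (γ 0) := by
  have hγc : Continuous γ := continuous_iff_continuousAt.2 fun s => (hγ s).continuousAt
  -- A local lift of p grows at rate β(v) = 1 along γ, so undoing a rotation at unit speed leaves a
  -- locally constant function on the connected line.
  have h1 : IsLocallyConstant fun s => p (γ s) * expCircle (-s) := by
    refine (IsLocallyConstant.iff_eventually_eq _).2 fun s => ?_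
    obtain ⟨U, g, hU, hx, hg, hy⟩ := h (γ s)
    obtain ⟨ε, hε, hball⟩ := Metric.mem_nhds_iff.1 ((hU.preimage hγc).mem_nhds hx)
    have hd : ∀ r ∈ Metric.ball s ε, HasDerivAt (fun r => g (γ r) - r) 0 r := by
      intro r hr
      have h2 : HasMFDerivAt I 𝓘(ℝ, ℝ) g (γ r) (mfderiv I 𝓘(ℝ, ℝ) g (γ r)) :=
        ((hg.contMDiffAt (hU.mem_nhds (hball hr))).mdifferentiableAt (by simp)).hasMFDerivAt
      have h3 : HasFDerivAt (g ∘ γ) _ r := (h2.comp r (hγ r)).hasFDerivAt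
      have h4 : HasDerivAt (fun r => g (γ r)) 1 r := by
        rw [hasDerivAt_iff_hasFDerivAt]
        refine HasFDerivAt.congr_fderiv h3 (ContinuousLinearMap.ext_ring ?_)
        have h6 : toFunctional (V := E) (dFun I g (γ r)) (v (γ r)) = 1 :=
          (congrArg (fun a : E [⋀^Fin 1]→L[ℝ] ℝ => toFunctional a (v (γ r)))
            (hy _ (hball hr)).1).symm.trans (hv _)
        rw [toFunctional_dFun] at h6
        refine Eq.trans ?_ (h6.trans (one_smul ℝ (1 : ℝ)).symm)
        change (mfderiv I 𝓘(ℝ, ℝ) g (γ r) : E →L[ℝ] ℝ) ((1 : ℝ) • v (γ r)) = _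
        exact congrArg (mfderiv I 𝓘(ℝ, ℝ) g (γ r) : E →L[ℝ] ℝ) (one_smul ℝ (v (γ r) : E))
      exact (h4.sub (hasDerivAt_id r)).congr_deriv (sub_self 1)
    have hconst : ∀ r ∈ Metric.ball s ε, g (γ r) - r = g (γ s) - s := fun r hr =>
      IsOpen.is_const_of_deriv_eq_zero Metric.isOpen_ball (convex_ball s ε).isPreconnected
        (fun r hr => (hd r hr).differentiableAt.differentiableWithinAt)
        (fun r hr => (hd r hr).deriv) hr (Metric.mem_ball_self hε)
    filter_upwards [Metric.ball_mem_nhds s hε] with r hr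
    have h2 : ∀ r ∈ Metric.ball s ε, p (γ r) * expCircle (-r) = expCircle (g (γ r) - r) := by
      intro r hr
      rw [(hy _ (hball hr)).2, ← expCircle_add, sub_eq_add_neg]
    rw [h2 r hr, h2 s (Metric.mem_ball_self hε), hconst r hr]
  have h2 := h1.apply_eq_of_preconnectedSpace t 0
  simp only [neg_zero, expCircle_zero, mul_one] at h2
  rw [← h2, mul_comm, expCircle_neg_mul]

end

variable (I) in
/-- A smooth flow whose time-`t` map covers the rotation of the circle by `2πt`. -/
structure IsSuspensionFlow (p : M → Circle) (Ψ : ℝ → M → M) : Prop where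
  contMDiff_apply : ContMDiff I (𝓡 1) ∞ p
  contMDiff_flow : ContMDiff (I.prod 𝓘(ℝ, ℝ)) I ∞ fun q : M × ℝ => Ψ q.2 q.1
  zero : ∀ x, Ψ 0 x = x
  add : ∀ s t x, Ψ (s + t) x = Ψ s (Ψ t x)
  apply_flow : ∀ t x, p (Ψ t x) = expCircle t * p x

variable (I J) in
/-- `ι` identifies `F` with the fibre of `p` over `1`. -/
structure IsFibreInclusion (p : M → Circle) (ι : F → M) : Prop where
  contMDiff : ContMDiff J I ∞ ι
  injective : Function.Injective ι
  apply : ∀ x, p (ι x) = 1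
  exists_eq : ∀ y, p y = 1 → ∃ x, ι x = y
  exists_retraction : ∀ x, ∃ r : M → F, ContMDiffAt I J ∞ r (ι x) ∧
    ∀ᶠ y in 𝓝 (ι x), p y = 1 → ι (r y) = y

variable {p : M → Circle} {Ψ : ℝ → M → M} {ι : F → M}

/-- Composing with the local retraction recovers `f` from its image in `M`. -/
theorem IsFibreInclusion.contMDiffAt_of_comp (hι : IsFibreInclusion I J p ι)
    {E'' : Type*} [NormedAddCommGroup E''] [NormedSpace ℝ E'']
    {H'' : Type*} [TopologicalSpace H''] {K : ModelWithCorners ℝ E'' H''}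
    {N : Type*} [TopologicalSpace N] [ChartedSpace H'' N] {f : N → F} {x : N}
    (hf : ContMDiffAt K I ∞ (fun y => ι (f y)) x) : ContMDiffAt K J ∞ f x := by
  obtain ⟨r, hr, hr'⟩ := hι.exists_retraction (f x)
  refine (ContMDiffAt.comp x hr hf).congr_of_eventuallyEq ?_
  filter_upwards [hf.continuousAt.eventually hr'] with y hy
  exact (hι.injective (hy (hι.apply _))).symm

theorem IsFibreInclusion.injective_mfderiv (hι : IsFibreInclusion I J p ι) (x : F) :
    Function.Injective (mfderiv J I ι x) := by
  obtain ⟨r, hr, hr'⟩ := hι.exists_retraction x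
  have h1 := mfderiv_comp x (hr.mdifferentiableAt (by simp))
    (hι.contMDiff.mdifferentiableAt (by simp) (x := x))
  have h2 : r ∘ ι =ᶠ[𝓝 x] id := by
    filter_upwards [hι.contMDiff.continuous.continuousAt.eventually hr'] with y hy
    exact hι.injective (hy (hι.apply _))
  rw [h2.mfderiv_eq, mfderiv_id] at h1
  have h3 : ∀ v : E', mfderiv I J r (ι x) (mfderiv J I ι x v) = v := fun v =>
    (DFunLike.congr_fun h1 v).symm
  exact Function.LeftInverse.injective h3

theorem IsSuspensionFlow.neg_apply (hΨ : IsSuspensionFlow I p Ψ) (t : ℝ) (x : M) :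
    Ψ (-t) (Ψ t x) = x := by rw [← hΨ.add, neg_add_cancel, hΨ.zero]

theorem IsSuspensionFlow.apply_neg (hΨ : IsSuspensionFlow I p Ψ) (t : ℝ) (x : M) :
    Ψ t (Ψ (-t) x) = x := by rw [← hΨ.add, add_neg_cancel, hΨ.zero]

theorem IsSuspensionFlow.apply_eq_one (hΨ : IsSuspensionFlow I p Ψ) {t : ℝ} {x : M}
    (hx : p x = expCircle (-t)) : p (Ψ t x) = 1 := by
  rw [hΨ.apply_flow, hx, ← expCircle_add, add_neg_cancel, expCircle_zero]

theorem IsSuspensionFlow.contMDiff (hΨ : IsSuspensionFlow I p Ψ) (t : ℝ) :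
    ContMDiff I I ∞ (Ψ t) :=
  hΨ.contMDiff_flow.comp (contMDiff_id.prodMk contMDiff_const)

/-- Integer times rotate the circle by full turns, so the fibre over 1 is mapped to itself. -/
theorem IsSuspensionFlow.exists_intCast (hΨ : IsSuspensionFlow I p Ψ)
    (hι : IsFibreInclusion I J p ι) (n : ℤ) (x : F) : ∃ y, ι y = Ψ n (ι x) := by
  refine hι.exists_eq _ (hΨ.apply_eq_one ?_)
  rw [hι.apply, eq_comm, expCircle_eq_one_iff]
  exact ⟨-n, by push_cast; rfl⟩

/-- The first return map of the fibre. -/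
def IsSuspensionFlow.monodromy (hΨ : IsSuspensionFlow I p Ψ) (hι : IsFibreInclusion I J p ι) :
    F ≃ₘ⟮J, J⟯ F where
  toFun x := (hΨ.exists_intCast hι 1 x).choose
  invFun x := (hΨ.exists_intCast hι (-1) x).choose
  left_inv x := hι.injective <| by
    rw [(hΨ.exists_intCast hι (-1) _).choose_spec, (hΨ.exists_intCast hι 1 _).choose_spec]
    push_cast
    exact hΨ.neg_apply 1 _
  right_inv x := hι.injective <| by
    rw [(hΨ.exists_intCast hι 1 _).choose_spec, (hΨ.exists_intCast hι (-1) _).choose_spec]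
    push_cast
    exact hΨ.apply_neg 1 _
  contMDiff_toFun x := hι.contMDiffAt_of_comp <| by
    simp only [Equiv.coe_fn_mk, (hΨ.exists_intCast hι 1 _).choose_spec]
    exact ((hΨ.contMDiff _).comp hι.contMDiff).contMDiffAt
  contMDiff_invFun x := hι.contMDiffAt_of_comp <| by
    simp only [Equiv.coe_fn_symm_mk, (hΨ.exists_intCast hι (-1) _).choose_spec]
    exact ((hΨ.contMDiff _).comp hι.contMDiff).contMDiffAt

theorem IsSuspensionFlow.monodromy_apply (hΨ : IsSuspensionFlow I p Ψ)
    (hι : IsFibreInclusion I J p ι) (x : F) : ι (hΨ.monodromy hι x) = Ψ 1 (ι x) := by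
  have h : ι (hΨ.monodromy hι x) = Ψ ((1 : ℤ) : ℝ) (ι x) :=
    (hΨ.exists_intCast hι 1 x).choose_spec
  rwa [Int.cast_one] at h

theorem IsSuspensionFlow.monodromy_zpow_apply (hΨ : IsSuspensionFlow I p Ψ)
    (hι : IsFibreInclusion I J p ι) (n : ℤ) (x : F) :
    ι ((((hΨ.monodromy hι).toEquiv : Equiv.Perm F) ^ n) x) = Ψ n (ι x) := by
  induction n using Int.induction_on generalizing x with
  | zero => rw [zpow_zero, Int.cast_zero, hΨ.zero]; rfl
  | succ n ih =>
    rw [zpow_add_one, Equiv.Perm.mul_apply, ih]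
    refine (congrArg _ (hΨ.monodromy_apply hι x)).trans ?_
    rw [← hΨ.add]
    push_cast
    rfl
  | pred n ih =>
    rw [zpow_sub_one, Equiv.Perm.mul_apply, ih]
    have h : ι (((hΨ.monodromy hι).toEquiv : Equiv.Perm F)⁻¹ x) = Ψ (-1) (ι x) := by
      have h1 : ι (((hΨ.monodromy hι).toEquiv : Equiv.Perm F)⁻¹ x) = Ψ ((-1 : ℤ) : ℝ) (ι x) :=
        (hΨ.exists_intCast hι (-1) x).choose_spec
      rw [Int.cast_neg, Int.cast_one] at h1
      exact h1
    rw [h, ← hΨ.add]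
    push_cast
    rfl

open MappingTorus

variable [IsManifold J ∞ F]

/-- If two flow lines from the fibre meet, applying p shows that the times differ by an integer, and
that integer power of the return map relates the starting points. So (x, s) ↦ Ψ s (ι x) is injective
on the mapping torus. -/
theorem IsSuspensionFlow.flow_eq_iff (hΨ : IsSuspensionFlow I p Ψ)
    (hι : IsFibreInclusion I J p ι) (x y : F) (s t : ℝ) :
    Ψ s (ι x) = Ψ t (ι y) ↔ MappingTorus.mk (hΨ.monodromy hι) (x, s) = MappingTorus.mk
      (hΨ.monodromy hι) (y, t) := by
  rw [mk_eq_mk_iff]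
  constructor
  · intro h
    have h1 := congrArg p h
    rw [hΨ.apply_flow, hΨ.apply_flow, hι.apply, hι.apply, mul_one, mul_one,
      expCircle_eq_iff] at h1
    obtain ⟨m, rfl⟩ := h1
    refine ⟨-m, Prod.ext (hι.injective ?_) (by push_cast; ring)⟩
    change ι ((((hΨ.monodromy hι).toEquiv : Equiv.Perm F) ^ (-m)) y) = ι x
    rw [hΨ.monodromy_zpow_apply hι, ← hΨ.neg_apply t (ι y), ← h, ← hΨ.add, ← hΨ.add]
    push_cast
    rw [show -(m : ℝ) + -t + (t + m) = 0 by ring, hΨ.zero]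
  · rintro ⟨n, hn⟩
    obtain ⟨rfl, rfl⟩ := Prod.mk.inj hn
    rw [hΨ.monodromy_zpow_apply hι, ← hΨ.add, sub_add_cancel]

/-- Flowing back by a logarithm of p(y) lands in the fibre over 1. The parameter `s` selects the
branch, so that it can be chosen smooth near a given point. -/
theorem IsSuspensionFlow.exists_flow_neg (hΨ : IsSuspensionFlow I p Ψ)
    (hι : IsFibreInclusion I J p ι) (s : ℝ) (y : M) :
    ∃ x, ι x = Ψ (-circleLog s (p y)) y := by
  refine hι.exists_eq _ (hΨ.apply_eq_one ?_)
  rw [neg_neg, expCircle_circleLog]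

theorem IsSuspensionFlow.contMDiffAt_flow_neg (hΨ : IsSuspensionFlow I p Ψ) {s : ℝ} {y : M}
    (hs : p y ∈ circleLogDomain s) :
    ContMDiffAt I I ∞ (fun y => Ψ (-circleLog s (p y)) y) y :=
  hΨ.contMDiff_flow.contMDiffAt.comp y (contMDiffAt_id.prodMk
    ((contMDiffAt_circleLog hs).comp y hΨ.contMDiff_apply.contMDiffAt).neg)

/-- The manifold is the mapping torus of the first return map. -/
def IsSuspensionFlow.diffeomorph (hΨ : IsSuspensionFlow I p Ψ) (hι : IsFibreInclusion I J p ι) :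
    M ≃ₘ⟮I, J.prod 𝓘(ℝ, ℝ)⟯ MappingTorus (hΨ.monodromy hι) where
  toFun y := MappingTorus.mk _ ((hΨ.exists_flow_neg hι 0 y).choose, circleLog 0 (p y))
  invFun w := Ψ (lift _ w).2 (ι (lift _ w).1)
  left_inv y := by
    have h := (hΨ.flow_eq_iff hι _ _ _ _).2 (mk_lift (hΨ.monodromy hι)
      (MappingTorus.mk _ ((hΨ.exists_flow_neg hι 0 y).choose, circleLog 0 (p y))))
    refine h.trans ?_
    rw [(hΨ.exists_flow_neg hι 0 y).choose_spec, hΨ.apply_neg]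
  right_inv w := by
    conv_rhs => rw [← mk_lift (hΨ.monodromy hι) w]
    refine (hΨ.flow_eq_iff hι _ _ _ _).1 ?_
    exact (congrArg _ (hΨ.exists_flow_neg hι 0 _).choose_spec).trans (hΨ.apply_neg _ _)
  contMDiff_toFun y := by
    obtain ⟨s, hs⟩ : ∃ s, expCircle s = p y := ⟨_, expCircle_circleLog 0 _⟩
    have hs : p y ∈ circleLogDomain s := by rw [← hs]; exact mem_circleLogDomain s
    -- The class in the mapping torus does not depend on the branch of the logarithm, so the branch
    -- 0 of the definition may be replaced by one smooth at p(y).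
    have h1 : (fun y => MappingTorus.mk (hΨ.monodromy hι) ((hΨ.exists_flow_neg hι 0 y).choose,
        circleLog 0 (p y))) = fun y => MappingTorus.mk (hΨ.monodromy hι)
          ((hΨ.exists_flow_neg hι s y).choose, circleLog s (p y)) := by
      funext y
      refine (hΨ.flow_eq_iff hι _ _ _ _).1 ?_
      rw [(hΨ.exists_flow_neg hι 0 _).choose_spec, (hΨ.exists_flow_neg hι s _).choose_spec,
        hΨ.apply_neg, hΨ.apply_neg]
    have h2 : ContMDiffAt I J ∞ (fun y => (hΨ.exists_flow_neg hι s y).choose) y := by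
      refine hι.contMDiffAt_of_comp ?_
      simp only [(hΨ.exists_flow_neg hι s _).choose_spec]
      exact hΨ.contMDiffAt_flow_neg hs
    have h3 := (contMDiff_mk (hΨ.monodromy hι)).contMDiffAt.comp y
      (h2.prodMk ((contMDiffAt_circleLog hs).comp y hΨ.contMDiff_apply.contMDiffAt))
    exact h3.congr_of_eventuallyEq (Eventually.of_forall fun z => congrFun h1 z)
  contMDiff_invFun := by
    refine (hasLocalSections_mk (hΨ.monodromy hι)).contMDiff ?_
    have h1 : ContMDiff (J.prod 𝓘(ℝ, ℝ)) I ∞ fun q : F × ℝ => Ψ q.2 (ι q.1) :=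
      hΨ.contMDiff_flow.comp ((hι.contMDiff.comp contMDiff_fst).prodMk contMDiff_snd)
    refine h1.congr fun q => ?_
    exact (hΨ.flow_eq_iff hι _ _ _ _).2 (mk_lift (hΨ.monodromy hι) _)

theorem IsSuspensionFlow.diffeomorph_symm_mk (hΨ : IsSuspensionFlow I p Ψ)
    (hι : IsFibreInclusion I J p ι) (x : F) (t : ℝ) :
    (hΨ.diffeomorph hι).symm (MappingTorus.mk _ (x, t)) = Ψ t (ι x) :=
  (hΨ.flow_eq_iff hι _ _ _ _).2 (mk_lift (hΨ.monodromy hι) _)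

theorem IsSuspensionFlow.proj_diffeomorph (hΨ : IsSuspensionFlow I p Ψ)
    (hι : IsFibreInclusion I J p ι) (y : M) :
    proj (hΨ.monodromy hι) (hΨ.diffeomorph hι y) = p y :=
  expCircle_circleLog 0 (p y)

/-- Over the domain of a branch of the logarithm, flowing back to the fibre over 1 trivialises p. -/
theorem IsSuspensionFlow.isSmoothFiberBundle (hΨ : IsSuspensionFlow I p Ψ)
    (hι : IsFibreInclusion I J p ι) : IsSmoothFiberBundle I (𝓡 1) J F p := by
  intro b
  obtain ⟨s, rfl⟩ : ∃ s, expCircle s = b := ⟨_, expCircle_circleLog 0 b⟩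
  have h1 : ContMDiffOn I ((𝓡 1).prod J) ∞
      (fun y => (p y, (hΨ.exists_flow_neg hι s y).choose)) (p ⁻¹' circleLogDomain s) := by
    intro y hy
    refine (hΨ.contMDiff_apply.contMDiffAt.prodMk (hι.contMDiffAt_of_comp ?_)).contMDiffWithinAt
    simp only [(hΨ.exists_flow_neg hι s _).choose_spec]
    exact hΨ.contMDiffAt_flow_neg hy
  have h2 : ContMDiffOn ((𝓡 1).prod J) I ∞ (fun q : Circle × F => Ψ (circleLog s q.1) (ι q.2))
      (circleLogDomain s ×ˢ univ) := by
    rintro ⟨z, x⟩ ⟨hz, -⟩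
    have h3 : ContMDiffAt ((𝓡 1).prod J) 𝓘(ℝ, ℝ) ∞ (fun q : Circle × F => circleLog s q.1)
      (z, x) := ContMDiffAt.comp (z, x) (g := circleLog s)
        (contMDiffAt_circleLog hz) contMDiffAt_fst
    exact (ContMDiffAt.comp (z, x) hΨ.contMDiff_flow.contMDiffAt
      ((hι.contMDiff.contMDiffAt.comp (z, x) contMDiffAt_snd).prodMk h3)).contMDiffWithinAt
  have h3 : ∀ (z : Circle) (x : F), p (Ψ (circleLog s z) (ι x)) = z := fun z x => by
    rw [hΨ.apply_flow, hι.apply, expCircle_circleLog, mul_one]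
  refine ⟨{
    toFun := fun y => (p y, (hΨ.exists_flow_neg hι s y).choose)
    invFun := fun q => Ψ (circleLog s q.1) (ι q.2)
    source := p ⁻¹' circleLogDomain s
    target := circleLogDomain s ×ˢ univ
    map_source' := fun y hy => ⟨hy, mem_univ _⟩
    map_target' := fun q hq => by rw [mem_preimage, h3]; exact hq.1
    left_inv' := fun y _ => by
      rw [(hΨ.exists_flow_neg hι s y).choose_spec, hΨ.apply_neg]
    right_inv' := fun q _ => by
      refine Prod.ext (h3 _ _) (hι.injective ?_)
      rw [(hΨ.exists_flow_neg hι s _).choose_spec, h3, hΨ.neg_apply]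
    open_source := (isOpen_circleLogDomain s).preimage hΨ.contMDiff_apply.continuous
    open_target := (isOpen_circleLogDomain s).prod isOpen_univ
    continuousOn_toFun := h1.continuousOn
    continuousOn_invFun := h2.continuousOn
    baseSet := circleLogDomain s
    open_baseSet := isOpen_circleLogDomain s
    source_eq := rfl
    target_eq := rfl
    proj_toFun := fun _ _ => rfl }, mem_circleLogDomain s, h1, h2⟩

end Suspension

/-! ### The fibre over 1 as a hypersurface -/

section HypersurfaceInclusion

variable {E : Type*} [NormedAddCommGroup E] [NormedSpace ℝ E]
  {H : Type*} [TopologicalSpace H] {I : ModelWithCorners ℝ E H}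
  {M : Type*} [TopologicalSpace M] [ChartedSpace H M]
  {E' : Type*} [NormedAddCommGroup E'] [NormedSpace ℝ E']

/-- The retraction sets the last coordinate of a slice chart to zero. -/
theorem IsHypersurface.isFibreInclusion {p : M → Circle} (hZ : IsHypersurface I E' {y | p y = 1}) :
    letI := hZ.chartedSpace
    IsFibreInclusion I 𝓘(ℝ, E') p (Subtype.val : {y | p y = 1} → M) := by
  let := hZ.chartedSpace
  refine ⟨hZ.contMDiff_val, Subtype.val_injective, fun x => x.2, fun y hy => ⟨⟨y, hy⟩, rfl⟩,
    fun x => ?_⟩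
  have hx := hZ.isSliceChart x
  set S := hZ.slice x
  have hxs : (x : M) ∈ S.source := hZ.mem_source x
  have h0 : (S x).2 = 0 := (hx.mem_iff _ hxs).1 x.2
  have h1 : ContMDiffAt I 𝓘(ℝ, E' × ℝ) ∞ (fun y => ((S y).1, (0 : ℝ))) (x : M) := by
    refine ContMDiffAt.comp (x : M) (g := fun u : E' × ℝ => (u.1, (0 : ℝ)))
      (contDiff_fst.prodMk contDiff_const).contDiffAt.contMDiffAt
      (hx.contMDiffOn.contMDiffAt (S.open_source.mem_nhds hxs))
  have h2 : ((S x).1, (0 : ℝ)) ∈ S.target := by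
    rw [← hx.apply_eq hxs x.2]
    exact S.map_source hxs
  have h3 : ∀ᶠ y in 𝓝 (x : M), ((S y).1, (0 : ℝ)) ∈ S.target :=
    h1.continuousAt (S.open_target.mem_nhds h2)
  refine ⟨fun y => (sliceChart hx x).symm (S y).1, ?_, ?_⟩
  · refine hZ.contMDiffAt_of_val ?_
    refine (ContMDiffAt.comp (x : M) (hx.contMDiffOn_symm.contMDiffAt
      (S.open_target.mem_nhds h2)) h1).congr_of_eventuallyEq ?_
    exact h3.mono fun y hy => sliceChart_symm_coe hx x hy
  · filter_upwards [h3, S.open_source.mem_nhds hxs] with y hy hys hpy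
    rw [sliceChart_symm_coe hx x hy, ← hx.apply_eq hys hpy, S.left_inv hys]

end HypersurfaceInclusion

/-! ### Contact geometry of the fibres -/

section FibreContact

variable {E : Type*} [NormedAddCommGroup E] [NormedSpace ℝ E] [FiniteDimensional ℝ E]
  {H : Type*} [TopologicalSpace H] {I : ModelWithCorners ℝ E H}
  {M : Type*} [TopologicalSpace M] [ChartedSpace H M] [I.Boundaryless] [IsManifold I ∞ M]
  {E' : Type*} [NormedAddCommGroup E'] [NormedSpace ℝ E'] [FiniteDimensional ℝ E']
  {H' : Type*} [TopologicalSpace H'] {J : ModelWithCorners ℝ E' H'}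
  {F : Type*} [TopologicalSpace F] [ChartedSpace H' F] [J.Boundaryless] [IsManifold J ∞ F]
  {X : Type*} [NormedAddCommGroup X] [NormedSpace ℝ X] [FiniteDimensional ℝ X]

theorem mfderiv_apply_zero_one {G : X × ℝ → M} {v : (x : M) → TangentSpace I x} {z : X × ℝ}
    (hG : MDifferentiableAt 𝓘(ℝ, X × ℝ) I G z)
    (hv : HasMFDerivAt 𝓘(ℝ, ℝ) I (fun s => G (z.1, s)) z.2
      ((1 : ℝ →L[ℝ] ℝ).smulRight (v (G z)))) :
    (mfderiv 𝓘(ℝ, X × ℝ) I G z : X × ℝ →L[ℝ] E) (0, 1) = (v (G z) : E) := by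
  have h1 : HasMFDerivAt 𝓘(ℝ, ℝ) 𝓘(ℝ, X × ℝ) (fun s : ℝ => (z.1, s)) z.2
      (ContinuousLinearMap.inr ℝ X ℝ) :=
    (hasFDerivAt_prodMk_right z.1 z.2).hasMFDerivAt
  have h2 := hasMFDerivAt_unique hv (HasMFDerivAt.comp z.2 hG.hasMFDerivAt h1)
  have h3 := DFunLike.congr_fun h2 (1 : ℝ)
  exact h3.symm.trans (one_smul ℝ (v (G z) : E))

/-- The derivative of the pullback of a one-form along the integral curves of a vector field in
its kernel. -/
theorem hasDerivAt_pullRep {G : X × ℝ → M} {v : (x : M) → TangentSpace I x} {u : X} {t : ℝ}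
    (hG : ContMDiffAt 𝓘(ℝ, X × ℝ) I ∞ G (u, t))
    (hv : ∀ z : X × ℝ, HasMFDerivAt 𝓘(ℝ, ℝ) I (fun s => G (z.1, s)) z.2
      ((1 : ℝ →L[ℝ] ℝ).smulRight (v (G z))))
    {α : DForm I M 1} (hα : IsSmooth α) (hαv : ∀ x, toFunctional (V := E) (α x) (v x) = 0)
    {w : X} {c : ℝ} (hc : (extD α (G (u, t)) : E [⋀^Fin 2]→L[ℝ] ℝ)
      ![v (G (u, t)), (mfderiv 𝓘(ℝ, X × ℝ) I G (u, t) : X × ℝ →L[ℝ] E) (w, 0)] = c) :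
    HasDerivAt (fun s => pullRep G α (u, s) ![(w, 0)]) c t := by
  have h1 : ContDiffAt ℝ ∞ (pullRep G α) (u, t) := hα.contDiffAt_pullRep hG
  have hd : DifferentiableAt ℝ (pullRep G α) (u, t) := h1.differentiableAt (by simp)
  have hM1 : IsManifold I 1 M := IsManifold.of_le (n := ∞) (by simp)
  have h2 : ∀ᶠ z in 𝓝 (u, t), pullRep G α z ![((0 : X), (1 : ℝ))] = 0 := by
    filter_upwards [(contMDiffAt_iff_contMDiffAt_nhds (by simp)).1
      (hG.of_le (show (1 : WithTop ℕ∞) ≤ ∞ by simp))] with z hz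
    refine Eq.trans ?_ (hαv (G z))
    refine congrArg (α (G z) : E [⋀^Fin 1]→L[ℝ] ℝ) (a₂ := fun _ => v (G z)) (funext fun i => ?_)
    fin_cases i
    exact mfderiv_apply_zero_one (hz.mdifferentiableAt (by simp)) (hv z)
  have h3 := extDeriv_one_apply hd ((0 : X), (1 : ℝ)) (w, 0)
  have h4 : fderiv ℝ (fun y => pullRep G α y ![((0 : X), (1 : ℝ))]) (u, t) = 0 := by
    rw [(show (fun y => pullRep G α y ![((0 : X), (1 : ℝ))]) =ᶠ[𝓝 (u, t)] fun _ => (0 : ℝ)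
      from h2).fderiv_eq]
    exact fderiv_const_apply _
  rw [h4, ← pullRep_extD hα hG] at h3
  have h5 : pullRep G (extD α) (u, t) ![((0 : X), (1 : ℝ)), (w, 0)] = c := by
    rw [← hc, pullRep_apply]
    refine congrArg (extD α (G (u, t)) : E [⋀^Fin 2]→L[ℝ] ℝ) (funext fun i => ?_)
    fin_cases i
    · exact mfderiv_apply_zero_one (hG.mdifferentiableAt (by simp)) (hv (u, t))
    · rfl
  rw [h5] at h3
  have h6 : DifferentiableAt ℝ (fun y => pullRep G α y ![(w, (0 : ℝ))]) (u, t) :=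
    differentiableAt_alternating_apply hd _
  have h7 := h6.hasFDerivAt.comp_hasDerivAt t
    ((hasDerivAt_const t u).prodMk (hasDerivAt_id t))
  refine h7.congr_deriv ?_
  rw [h3]
  simp

/-- Multiplying by the integrating factor gives a function with zero derivative. -/
theorem eq_exp_integral_mul {a k : ℝ → ℝ} (hk : Continuous k)
    (ha : ∀ t, HasDerivAt a (k t * a t) t) (t : ℝ) : a t = Real.exp (∫ s in (0)..t, k s) * a 0 := by
  have h1 : ∀ t, HasDerivAt (fun t => ∫ s in (0)..t, k s) (k t) t := fun t =>
    intervalIntegral.integral_hasDerivAt_right (hk.intervalIntegrable _ _)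
      (hk.stronglyMeasurableAtFilter _ _) hk.continuousAt
  have h2 : ∀ t, HasDerivAt (fun t => a t * Real.exp (-∫ s in (0)..t, k s)) 0 t := fun t =>
    ((ha t).mul (h1 t).neg.exp).congr_deriv (by ring)
  have h3 := is_const_of_deriv_eq_zero (fun t => (h2 t).differentiableAt)
    (fun t => (h2 t).deriv) t 0
  simp only [intervalIntegral.integral_same, neg_zero, Real.exp_zero, mul_one] at h3
  rw [← h3, mul_comm, mul_assoc, ← Real.exp_add, neg_add_cancel, Real.exp_zero, mul_one]

/-- The proportionality factor of smooth nonvanishing forms is smooth. -/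
theorem contMDiff_of_eq_smul {k : ℕ} {η ζ : DForm J F k} (hη : IsSmooth η) (hζ : IsSmooth ζ)
    (hne : ∀ x, η x ≠ 0) {g : F → ℝ} (hg : ∀ x, ζ x = g x • η x) : ContMDiff J 𝓘(ℝ, ℝ) ∞ g := by
  intro x
  set ψ := extChartAt J x with hψ
  have hy : ψ x ∈ ψ.target := mem_extChartAt_target x
  have h0 : pullRep ψ.symm η (ψ x) ≠ 0 := fun h =>
    hne x (apply_eq_of_pullRep_eq (ζ := 0) (mem_extChartAt_source x) h)
  obtain ⟨w, hw⟩ : ∃ w, pullRep ψ.symm η (ψ x) w ≠ 0 := by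
    by_contra! h
    exact h0 (ContinuousAlternatingMap.ext h)
  have h1 := contDiffAt_alternating_apply (isSmooth_iff.1 hη x _ hy)
    (v := fun i _ => w i) fun i => contDiffAt_const
  have h2 := contDiffAt_alternating_apply (isSmooth_iff.1 hζ x _ hy)
    (v := fun i _ => w i) fun i => contDiffAt_const
  have h3 : ContMDiffAt J 𝓘(ℝ, ℝ) ∞
      (fun y => pullRep ψ.symm ζ (ψ y) w / pullRep ψ.symm η (ψ y) w) x :=
    ContMDiffAt.comp x (g := fun z => pullRep ψ.symm ζ z w / pullRep ψ.symm η z w)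
      (h2.div h1 hw).contMDiffAt contMDiffAt_extChartAt
  refine h3.congr_of_eventuallyEq ?_
  have h4 : ∀ᶠ y in 𝓝 x, pullRep ψ.symm η (ψ y) w ≠ 0 :=
    (ContinuousAt.comp (f := ψ) (g := fun z => pullRep ψ.symm η z w) h1.continuousAt
      (continuousAt_extChartAt x)).eventually_ne hw
  filter_upwards [h4, (isOpen_extChartAt_source (I := J) x).mem_nhds (mem_extChartAt_source x)]
    with y hy4 hys
  have h5 : pullRep ψ.symm ζ (ψ y) w = g (ψ.symm (ψ y)) * pullRep ψ.symm η (ψ y) w :=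
    DFunLike.congr_fun (hg (ψ.symm (ψ y))) fun i => mfderiv 𝓘(ℝ, E') J ψ.symm (ψ y) (w i)
  rw [ψ.left_inv hys] at h5
  rw [h5, mul_div_cancel_right₀ _ hy4]

/-- A generalized contact pair restricts to a contact form on a hypersurface tangent to the kernel
of the closed form. -/
theorem isContactForm_pullback {h : ℕ} {α β : DForm I M 1}
    (hE : Module.finrank ℝ E = 2 * h + 2) (hE' : Module.finrank ℝ E' = 2 * h + 1)
    (hα : IsSmooth α) (hv : ∀ x, wedgeForm (wedgeForm α (wedgePowForm (extD α) h)) β x ≠ 0)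
    {f : F → M} (hf : ContMDiff J I ∞ f) (hf' : ∀ x, Function.Injective (mfderiv J I f x))
    (hβ : pullback (I := J) f β = 0) : IsContactForm h (pullback (I := J) f α) := by
  refine ⟨hE', hα.pullback hf, fun x h0 => ?_⟩
  rw [extD_pullback hf hα, ← pullback_wedgePowForm, ← pullback_wedgeForm] at h0
  refine comp_ne_zero_of_wedge_ne_zero (V := E) (W := E') (k := 1 + 2 * h) (by omega) (by omega)
    (hv (f x)) (A := mfderiv J I f x) (hf' x) (fun w => ?_) h0
  exact DFunLike.congr_fun (congrFun hβ x) fun _ => w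

/-- A local lift takes values in a single coset of ℤ along `f`, hence is locally constant by
continuity, and its differential pulls back to zero. -/
theorem HasLocalLifts.pullback_eq_zero {p : M → Circle} {β : DForm I M 1}
    (hβ : HasLocalLifts p β) {f : F → M} (hf : ContMDiff J I ∞ f) {c : Circle}
    (hc : ∀ x, p (f x) = c) : pullback (I := J) f β = 0 := by
  funext x
  obtain ⟨U, g, hU, hx, hg, hy⟩ := hβ (f x)
  have hgx : ContMDiffAt I 𝓘(ℝ, ℝ) ∞ g (f x) := hg.contMDiffAt (hU.mem_nhds hx)
  have h1 : ∀ᶠ z in 𝓝 x, |g (f z) - g (f x)| < 1 := by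
    have h : ContinuousAt (fun z => |g (f z) - g (f x)|) x :=
      ((hgx.continuousAt.comp hf.continuous.continuousAt).sub continuousAt_const).abs
    exact h.eventually_lt_const (by simp)
  have h2 : g ∘ f =ᶠ[𝓝 x] fun _ => g (f x) := by
    filter_upwards [h1, hf.continuous.continuousAt (hU.mem_nhds hx)] with z hz hzU
    have h3 : expCircle (g (f z)) = expCircle (g (f x)) := by
      rw [← (hy _ hzU).2, ← (hy _ hx).2, hc, hc]
    obtain ⟨m, hm⟩ := expCircle_eq_iff.1 h3
    have h4 : |m| < 1 := by
      rw [hm, add_sub_cancel_left] at hz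
      exact_mod_cast hz
    rw [Function.comp_apply, hm, Int.abs_lt_one_iff.1 h4, Int.cast_zero, add_zero]
  have h3 := mfderiv_comp x (hgx.mdifferentiableAt (by simp))
    (hf.mdifferentiableAt (by simp) (x := x))
  rw [h2.mfderiv_eq, mfderiv_const] at h3
  refine ContinuousAlternatingMap.ext fun w => ?_
  refine (DFunLike.congr_fun (hy _ hx).1 fun i => mfderiv J I f x (w i)).trans ?_
  exact (DFunLike.congr_fun h3 (w 0)).symm

end FibreContact

/-! ### The flow acts on the fibres by conformal maps -/

section FibreFlow

variable {E : Type*} [NormedAddCommGroup E] [NormedSpace ℝ E] [FiniteDimensional ℝ E]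
  {H : Type*} [TopologicalSpace H] {I : ModelWithCorners ℝ E H}
  {M : Type*} [TopologicalSpace M] [ChartedSpace H M] [I.Boundaryless] [IsManifold I ∞ M]
  {E' : Type*} [NormedAddCommGroup E'] [NormedSpace ℝ E'] [FiniteDimensional ℝ E']
  {H' : Type*} [TopologicalSpace H'] {J : ModelWithCorners ℝ E' H'}
  {F : Type*} [TopologicalSpace F] [ChartedSpace H' F] [J.Boundaryless] [IsManifold J ∞ F]
  {p : M → Circle} {Ψ : ℝ → M → M} {ι : F → M}

theorem IsSuspensionFlow.contMDiff_comp (hΨ : IsSuspensionFlow I p Ψ)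
    (hι : IsFibreInclusion I J p ι) (t : ℝ) : ContMDiff J I ∞ fun x => Ψ t (ι x) :=
  (hΨ.contMDiff t).comp hι.contMDiff

theorem IsSuspensionFlow.injective_mfderiv_comp (hΨ : IsSuspensionFlow I p Ψ)
    (hι : IsFibreInclusion I J p ι) (t : ℝ) (x : F) :
    Function.Injective (mfderiv J I (fun x => Ψ t (ι x)) x) := by
  have h1 := mfderiv_comp x ((hΨ.contMDiff (-t)).mdifferentiableAt (by simp))
    ((hΨ.contMDiff_comp hι t).mdifferentiableAt (by simp) (x := x))
  have h2 : Ψ (-t) ∘ (fun x => Ψ t (ι x)) = ι := funext fun x => hΨ.neg_apply t (ι x)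
  rw [h2] at h1
  intro v w hvw
  refine hι.injective_mfderiv x ?_
  exact (DFunLike.congr_fun h1 v).trans ((congrArg (mfderiv I I (Ψ (-t)) (Ψ t (ι x))) hvw).trans
    (DFunLike.congr_fun h1 w).symm)

variable {α β : DForm I M 1} {v : (x : M) → TangentSpace I x} {f g : M → ℝ}

/-- The flow preserves the restriction of `α` to the fibres up to a positive factor. -/
theorem IsSuspensionFlow.pullback_flow (hΨ : IsSuspensionFlow I p Ψ)
    (hι : IsFibreInclusion I J p ι) (hβ : HasLocalLifts p β) (hα : IsSmooth α)
    (hv : ∀ x, IsMIntegralCurve (I := I) (fun t => Ψ t x) v)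
    (hf : Continuous f) (hαv : ∀ x, toFunctional (V := E) (α x) (v x) = 0)
    (hdα : ∀ (x : M) (w : E), (extD α x : E [⋀^Fin 2]→L[ℝ] ℝ) ![v x, w] =
      f x * toFunctional (V := E) (α x) w + g x * toFunctional (V := E) (β x) w) (t : ℝ) (x : F) :
    pullback (I := J) (fun x => Ψ t (ι x)) α x =
      Real.exp (∫ s in (0)..t, f (Ψ s (ι x))) • pullback (I := J) (fun x => Ψ 0 (ι x)) α x := by
  set ψ := extChartAt J x with hψ
  have hy : ψ x ∈ ψ.target := mem_extChartAt_target x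
  have hs : ContMDiffAt 𝓘(ℝ, E') J ∞ ψ.symm (ψ x) := contMDiffAt_extChartAt_symm hy
  have hψx : ψ.symm (ψ x) = x := ψ.left_inv (mem_extChartAt_source x)
  -- The flow on the fibre, read in a chart of `F` and with time as last coordinate; the chart
  -- variable gives the fibre directions.
  let G : E' × ℝ → M := fun z => Ψ z.2 (ι (ψ.symm z.1))
  have hG : ∀ t, ContMDiffAt 𝓘(ℝ, E' × ℝ) I ∞ G (ψ x, t) := by
    intro t
    have h1 : ContMDiffAt 𝓘(ℝ, E' × ℝ) 𝓘(ℝ, E') ∞ (Prod.fst : E' × ℝ → E') (ψ x, t) :=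
      contDiffAt_fst.contMDiffAt
    have h2 : ContMDiffAt 𝓘(ℝ, E' × ℝ) 𝓘(ℝ, ℝ) ∞ (Prod.snd : E' × ℝ → ℝ) (ψ x, t) :=
      contDiffAt_snd.contMDiffAt
    exact ContMDiffAt.comp (ψ x, t) hΨ.contMDiff_flow.contMDiffAt
      ((ContMDiffAt.comp (ψ x, t) (hι.contMDiff.contMDiffAt.comp (ψ x) hs) h1).prodMk h2)
  have hrep : ∀ {k : ℕ} (η : DForm I M k) (t : ℝ) (w : Fin k → E'),
      pullRep G η (ψ x, t) (fun i => (w i, 0)) =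
        pullRep ψ.symm (pullback (I := J) (fun x => Ψ t (ι x)) η) (ψ x) w := by
    intro k η t w
    have h1 : HasFDerivAt (fun u : E' => (u, t)) (ContinuousLinearMap.inl ℝ E' ℝ) (ψ x) :=
      hasFDerivAt_prodMk_left (ψ x) t
    have h2 := pullRep_comp_right G (fun u : E' => (u, t)) η (y := ψ x)
      ((hG t).mdifferentiableAt (by simp)) h1.differentiableAt
    rw [pullRep_comp_left ψ.symm (fun x => Ψ t (ι x)) η (hs.mdifferentiableAt (by simp))
      ((hΨ.contMDiff_comp hι t).mdifferentiableAt (by simp))]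
    refine Eq.trans ?_ (DFunLike.congr_fun h2 w).symm
    rw [h1.fderiv]
    rfl
  -- The flow carries fibres to fibres, so the β-term of dα(X, ·) disappears and a linear equation
  -- a' = f a remains for each fibre vector.
  have hβ0 : ∀ t, pullback (I := J) (fun x => Ψ t (ι x)) β = 0 := fun t =>
    hβ.pullback_eq_zero (hΨ.contMDiff_comp hι t) (c := expCircle t) fun x => by
      rw [hΨ.apply_flow, hι.apply, mul_one]
  have hder : ∀ (w : E') (t : ℝ), HasDerivAt (fun s => pullRep G α (ψ x, s) ![(w, 0)])
      (f (Ψ t (ι x)) * pullRep G α (ψ x, t) ![(w, 0)]) t := by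
    intro w t
    refine hasDerivAt_pullRep (hG t) (v := v) (fun z => hv (ι (ψ.symm z.1)) z.2) hα hαv ?_
    refine (hdα _ _).trans ?_
    have h1 : toFunctional (V := E) (β (G (ψ x, t)))
        ((mfderiv 𝓘(ℝ, E' × ℝ) I G (ψ x, t) : E' × ℝ →L[ℝ] E) (w, 0)) = 0 := by
      have h2 := hrep β t fun _ => w
      rw [hβ0 t] at h2
      exact h2
    rw [h1, mul_zero, add_zero]
    refine congrArg₂ (· * ·) ?_ (congrArg (α (G (ψ x, t)) : E [⋀^Fin 1]→L[ℝ] ℝ)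
      (a₁ := fun _ => (mfderiv 𝓘(ℝ, E' × ℝ) I G (ψ x, t) : E' × ℝ →L[ℝ] E) (w, 0))
      (funext fun i => ?_))
    · change f (Ψ t (ι (ψ.symm (ψ x)))) = _
      rw [hψx]
    · fin_cases i
      rfl
  have hk : Continuous fun s => f (Ψ s (ι x)) :=
    hf.comp (hΨ.contMDiff_flow.continuous.comp (continuous_const.prodMk continuous_id))
  have hconst : ∀ w : Fin 1 → E', (fun i => (w i, (0 : ℝ))) = ![(w 0, 0)] := fun w =>
    funext fun i => by fin_cases i; rfl
  refine apply_eq_of_pullRep_eq (mem_extChartAt_source x)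
    (ζ := fun y => Real.exp (∫ s in (0)..t, f (Ψ s (ι x))) •
      pullback (I := J) (fun x => Ψ 0 (ι x)) α y) (ContinuousAlternatingMap.ext fun w => ?_)
  have h1 := eq_exp_integral_mul hk (hder (w 0)) t
  rw [← hconst, hrep, hrep] at h1
  exact h1

/-- Composing the inclusion with the return map is flowing for time 1, so the conformal factor is
the exponential of the integral of `f` over one turn. The inclusion is written as Ψ 0 ∘ ι to match
the family of inclusions at time 0. -/
theorem IsSuspensionFlow.isContactomorphism (hΨ : IsSuspensionFlow I p Ψ)
    (hι : IsFibreInclusion I J p ι) (hβ : HasLocalLifts p β) (hα : IsSmooth α)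
    (hv : ∀ x, IsMIntegralCurve (I := I) (fun t => Ψ t x) v)
    (hf : Continuous f) (hαv : ∀ x, toFunctional (V := E) (α x) (v x) = 0)
    (hdα : ∀ (x : M) (w : E), (extD α x : E [⋀^Fin 2]→L[ℝ] ℝ) ![v x, w] =
      f x * toFunctional (V := E) (α x) w + g x * toFunctional (V := E) (β x) w)
    (hne : ∀ x, pullback (I := J) (fun x => Ψ 0 (ι x)) α x ≠ 0) :
    IsContactomorphism (pullback (I := J) (fun x => Ψ 0 (ι x)) α) (hΨ.monodromy hι) := by
  have h1 := hΨ.pullback_flow hι hβ hα hv hf hαv hdα 1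
  refine ⟨fun x => Real.exp (∫ s in (0)..1, f (Ψ s (ι x))),
    contMDiff_of_eq_smul (hα.pullback (hΨ.contMDiff_comp hι 0))
      (hα.pullback (hΨ.contMDiff_comp hι 1)) hne h1, fun x => Real.exp_pos _, fun x => ?_⟩
  rw [← h1 x]
  refine (pullback_comp (hΨ.monodromy hι) (fun x => Ψ 0 (ι x)) α
    ((hΨ.contMDiff_comp hι 0).mdifferentiableAt (by simp))
    ((hΨ.monodromy hι).contMDiff.mdifferentiableAt (by simp))).trans ?_
  have h2 : (fun x => Ψ 0 (ι x)) ∘ hΨ.monodromy hι = fun x => Ψ 1 (ι x) := funext fun y => by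
    rw [Function.comp_apply, hΨ.monodromy_apply hι, hΨ.zero]
  rw [h2]

end FibreFlow

/-! ### Closed manifolds with a generalized contact pair are mapping tori -/

section Fibration

theorem IsSmooth.wedgePowForm {E : Type*} [NormedAddCommGroup E] [NormedSpace ℝ E]
    [FiniteDimensional ℝ E] {H : Type*} [TopologicalSpace H] {I : ModelWithCorners ℝ E H}
    {M : Type*} [TopologicalSpace M] [ChartedSpace H M] [I.Boundaryless] [IsManifold I ∞ M]
    {η : DForm I M 2} (hη : IsSmooth η) (m : ℕ) : IsSmooth (wedgePowForm η m) := by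
  refine isSmooth_iff.2 fun x₀ y hy => ?_
  refine (contDiffAt_wedgePow (isSmooth_iff.1 hη x₀ y hy) m).congr_of_eventuallyEq
    (Eventually.of_forall fun z => ?_)
  exact (wedgePow_comp (V := E) (η ((extChartAt I x₀).symm z))
    (mfderiv 𝓘(ℝ, E) I (extChartAt I x₀).symm z) m).symm

theorem IsContactForm.ne_zero {E : Type*} [NormedAddCommGroup E] [NormedSpace ℝ E]
    {H : Type*} [TopologicalSpace H] {I : ModelWithCorners ℝ E H}
    {M : Type*} [TopologicalSpace M] [ChartedSpace H M] {h : ℕ}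
    {η : DForm I M 1} (hη : IsContactForm h η) (x : M) : η x ≠ 0 := by
  intro h0
  refine toFunctional_ne_zero_of_wedge_ne_zero_left (V := E) (α := η x) (hη.volume x) ?_
  exact (congrArg (fun a : E [⋀^Fin 1]→L[ℝ] ℝ => toFunctional a) h0).trans
    (ContinuousLinearMap.ext fun _ => rfl)

theorem exists_mappingTorus {h : ℕ} {M : Type u} [TopologicalSpace M]
    [ChartedSpace (EuclideanSpace ℝ (Fin (2 * h + 2))) M] [IsManifold (𝓡 (2 * h + 2)) ∞ M]
    [T2Space M] [CompactSpace M] {α β : DForm (𝓡 (2 * h + 2)) M 1}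
    (hαβ : IsGeneralizedContactPair h α β) :
    ∃ (F : Type u) (_ : TopologicalSpace F)
      (_ : ChartedSpace (EuclideanSpace ℝ (Fin (2 * h + 1))) F)
      (_ : IsManifold (𝓡 (2 * h + 1)) ∞ F) (_ : T2Space F) (_ : CompactSpace F)
      (φ : F ≃ₘ⟮𝓡 (2 * h + 1), 𝓡 (2 * h + 1)⟯ F) (p : M → Circle)
      (Φ : M ≃ₘ⟮𝓡 (2 * h + 2), (𝓡 (2 * h + 1)).prod 𝓘(ℝ, ℝ)⟯ MappingTorus φ),
      IsSmoothFiberBundle (𝓡 (2 * h + 2)) (𝓡 1) (𝓡 (2 * h + 1)) F p ∧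
      (∀ y : M, MappingTorus.proj φ (Φ y) = p y) ∧
      (∀ t : ℝ, IsContactForm h (pullback (I := 𝓡 (2 * h + 1))
        (fun x : F => Φ.symm (MappingTorus.mk φ (x, t))) α)) ∧
      IsContactomorphism (pullback (I := 𝓡 (2 * h + 1))
        (fun x : F => Φ.symm (MappingTorus.mk φ (x, 0))) α) φ := by
  have hα := hαβ.smooth_left
  have hτ : IsSmooth (wedgeForm α (wedgePowForm (extD α) h)) := hα.wedgeForm
      (hα.extD.wedgePowForm h)
  -- From here on β' replaces β; only closedness of β and the volume condition were needed.
  obtain ⟨p, β', hβ', hne⟩ := exists_hasLocalLifts hαβ.smooth_right hαβ.closed hτ hαβ.volume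
  obtain ⟨v, f, g, hv, hf, -, hvfg⟩ := exists_vectorField hαβ.finrank_eq hα hβ'.isSmooth
    hα.extD hne
  obtain ⟨Ψ, hΨs, hΨ0, hΨa, hΨv⟩ := exists_flow hv
  have hΨ : IsSuspensionFlow (𝓡 (2 * h + 2)) p Ψ := by
    refine ⟨hβ'.contMDiff, hΨs, hΨ0, hΨa, fun t x => ?_⟩
    have h1 := hβ'.apply_integralCurve (fun x => (hvfg x).2.1) (hΨv x) t
    simp only [hΨ0] at h1
    exact h1
  have hE' : Module.finrank ℝ (EuclideanSpace ℝ (Fin (2 * h + 1))) = 2 * h + 1 :=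
    finrank_euclideanSpace_fin
  have hZ : IsHypersurface (𝓡 (2 * h + 2)) (EuclideanSpace ℝ (Fin (2 * h + 1)))
      {y | p y = 1} := by
    refine hβ'.isHypersurface (fun x => toFunctional_ne_zero_of_wedge_ne_zero (hne x)) ?_
    rw [hαβ.finrank_eq, hE']
  let := hZ.chartedSpace
  have := hZ.isManifold
  have hι := hZ.isFibreInclusion
  have hcl : IsClosed {y | p y = 1} := isClosed_singleton.preimage hΨ.contMDiff_apply.continuous
  have hcpt : CompactSpace {y | p y = 1} := isCompact_iff_compactSpace.1 hcl.isCompact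
  have hsymm : ∀ t, (fun x => (hΨ.diffeomorph hι).symm
      (MappingTorus.mk (hΨ.monodromy hι) (x, t))) = fun x : {y | p y = 1} => Ψ t (x : M) := fun t =>
    funext fun x => hΨ.diffeomorph_symm_mk hι x t
  have hcontact : ∀ t, IsContactForm h (pullback (I := 𝓡 (2 * h + 1))
      (fun x : {y | p y = 1} => Ψ t (x : M)) α) := fun t => by
    refine isContactForm_pullback hαβ.finrank_eq hE' hα hne (hΨ.contMDiff_comp hι t)
      (hΨ.injective_mfderiv_comp hι t) ?_
    exact hβ'.pullback_eq_zero (hΨ.contMDiff_comp hι t) (c := expCircle t) fun x => by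
      rw [hΨ.apply_flow, hι.apply, mul_one]
  refine ⟨{y | p y = 1}, inferInstance, inferInstance, inferInstance, inferInstance, hcpt,
    hΨ.monodromy hι, p, hΨ.diffeomorph hι, hΨ.isSmoothFiberBundle hι, hΨ.proj_diffeomorph hι,
    fun t => ?_, ?_⟩
  · rw [hsymm]
    exact hcontact t
  · rw [hsymm]
    refine hΨ.isContactomorphism hι hβ' hα hΨv hf.continuous (fun x => (hvfg x).1)
      (fun x => (hvfg x).2.2) fun x => ?_
    exact (hcontact 0).ne_zero x

end Fibration

/-! ### Locally conformally symplectic forms from generalized contact pairs -/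

section LCS

section LinearAlgebra

variable {V : Type*} [NormedAddCommGroup V] [NormedSpace ℝ V] {h : ℕ}
  {α β : V [⋀^Fin 1]→L[ℝ] ℝ} {η : V [⋀^Fin 2]→L[ℝ] ℝ}

theorem apply_swap (η : V [⋀^Fin 2]→L[ℝ] ℝ) (v w : V) : η ![v, w] = -η ![w, v] := by
  have h := η.toAlternatingMap.map_swap ![w, v] (show (0 : Fin 2) ≠ 1 by decide)
  rw [show ![w, v] ∘ Equiv.swap (0 : Fin 2) 1 = ![v, w] from fun_fin_two_eq _] at h
  exact h

theorem wedge_wedge_self (α β : V [⋀^Fin 1]→L[ℝ] ℝ) : wedge (wedge α β) β = 0 := by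
  ext v
  have hv : v = ![v 0, v 1, v 2] := by ext i; fin_cases i <;> rfl
  rw [hv, wedge_two_one (wedge α β), wedge_one_one, wedge_one_one, wedge_one_one]
  change _ = (0 : ℝ)
  ring

/-- Pairing with `x` gives (c - f)α(v) = 0. Then v - β(v)x lies in the common kernel and pairs to
zero with it, so v = β(v)x; pairing with a vector on which α is 1 finally gives β(v) = 0. -/
theorem eq_zero_of_lcs [FiniteDimensional ℝ V] (hV : Module.finrank ℝ V = 2 * h + 2)
    (hv : wedge (wedge α (wedgePow η h)) β ≠ 0) {x : V} {f g c : ℝ} (hαx : toFunctional α x = 0)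
    (hβx : toFunctional β x = 1)
    (hx : ∀ w, η ![x, w] = f * toFunctional α w + g * toFunctional β w) (hc : c ≠ f) {v : V}
    (hσ : ∀ w, (η + c • wedge α β) ![v, w] = 0) : v = 0 := by
  have hσ' : ∀ v w, (η + c • wedge α β) ![v, w] = η ![v, w] + c *
      (toFunctional α v * toFunctional β w - toFunctional α w * toFunctional β v) := by
    intro v w
    rw [toFunctional_apply, toFunctional_apply, toFunctional_apply, toFunctional_apply]
    exact congrArg (fun r => η ![v, w] + c * r) (wedge_one_one α β v w)
  -- Alternation forces η(x, x) = 0, while the formula for η(x, ·) evaluates to `g`.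
  have hg : g = 0 := by
    have h1 := hx x
    have h2 := apply_swap η x x
    rw [hαx, hβx] at h1
    linarith
  have hαv : toFunctional α v = 0 := by
    have h1 := hσ x
    rw [hσ', apply_swap, hx, hαx, hβx, hg] at h1
    have h2 : (c - f) * toFunctional α v = 0 := by linarith
    exact (mul_eq_zero.1 h2).resolve_left (sub_ne_zero.2 hc)
  have hvx : v = toFunctional β v • x := by
    refine sub_eq_zero.1 (nondegenerate_of_wedge_ne_zero hV hv _ ?_ ?_ fun w hαw hβw => ?_)
    · rw [map_sub, map_smul, hαv, hαx, smul_zero, sub_zero]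
    · rw [map_sub, map_smul, hβx, smul_eq_mul, mul_one, sub_self]
    · have h1 := hσ w
      rw [hσ', hαw, hβw, mul_zero, zero_mul, sub_zero, mul_zero, add_zero] at h1
      have h2 : η ![v - toFunctional β v • x, w] = η ![v, w] - toFunctional β v * η ![x, w] := by
        rw [sub_eq_add_neg, ← neg_smul]
        have h3 := η.toAlternatingMap.map_vecCons_add ![w] v (-toFunctional β v • x)
        have h4 := η.toAlternatingMap.map_vecCons_smul ![w] (-toFunctional β v) x
        rw [h4, smul_eq_mul, neg_mul, ← sub_eq_add_neg] at h3
        exact h3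
      rw [h2, h1, hx, hαw, hβw]
      ring
  have hα0 : toFunctional α ≠ 0 := by
    obtain ⟨r, -, hr, -⟩ := exists_dual_pair hV hv
    intro h0
    rw [h0] at hr
    exact zero_ne_one hr
  obtain ⟨r, hr⟩ := exists_apply_eq_one hα0
  have h1 := hσ r
  have h2 : η ![v, r] = toFunctional β v * η ![x, r] := by
    have h4 := η.toAlternatingMap.map_vecCons_smul ![r] (toFunctional β v) x
    rw [← hvx] at h4
    exact h4
  rw [hσ', h2, hx, hg, hr, hαv] at h1
  have h3 : (f - c) * toFunctional β v = 0 := by linarith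
  rw [hvx, (mul_eq_zero.1 h3).resolve_left (sub_ne_zero.2 hc.symm), zero_smul]

end LinearAlgebra

variable {E : Type*} [NormedAddCommGroup E] [NormedSpace ℝ E] [FiniteDimensional ℝ E]
  {H : Type*} [TopologicalSpace H] {I : ModelWithCorners ℝ E H}
  {M : Type*} [TopologicalSpace M] [ChartedSpace H M] [I.Boundaryless] [IsManifold I ∞ M]

theorem IsGeneralizedContactPair.exists_isLCSForm [CompactSpace M] {h : ℕ} {α β : DForm I M 1}
    (hαβ : IsGeneralizedContactPair h α β) : ∃ c₀ : ℝ, ∀ c : ℝ, c₀ ≤ c →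
      IsLCSForm (extD α + c • wedgeForm α β) (c • β) := by
  have hα := hαβ.smooth_left
  have hβ := hαβ.smooth_right
  obtain ⟨v, f, g, -, hf, -, hvfg⟩ := exists_vectorField hαβ.finrank_eq hα hβ hα.extD hαβ.volume
  obtain ⟨b, hb⟩ := (isCompact_range hf.continuous).bddAbove
  -- The bound b dominates `f` on the compact manifold, so c ≥ b + 1 keeps c - f positive
  -- everywhere.
  refine ⟨b + 1, fun c hc => ⟨hα.extD.add ((hα.wedgeForm hβ).const_smul c), hβ.const_smul c,
    fun x w hw => ?_, ?_, ?_⟩⟩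
  · have hcf : c ≠ f x := by
      have h1 : f x ≤ b := hb ⟨x, rfl⟩
      linarith
    exact eq_zero_of_lcs (V := E) hαβ.finrank_eq (hαβ.volume x) (hvfg x).1 (hvfg x).2.1
      (hvfg x).2.2 hcf hw
  · rw [extD_const_smul hβ, hαβ.closed, smul_zero]
  · rw [extD_add hα.extD ((hα.wedgeForm hβ).const_smul c), extD_extD hα, zero_add,
      extD_const_smul (hα.wedgeForm hβ), extD_wedgeForm_closed hα hβ hαβ.closed]
    funext x
    -- The extra term c² α∧β∧β of the product with the Lee form is zero.
    have h1 : ∀ (a : E [⋀^Fin 2]→L[ℝ] ℝ) (α β : E [⋀^Fin 1]→L[ℝ] ℝ),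
        c • wedge a β = wedge (a + c • wedge α β) (c • β) := by
      intro a α β
      rw [wedge_smul_right]
      congr 1
      have h2 := wedge_wedge_self α β
      ext v
      have hv : v = ![v 0, v 1, v 2] := by ext i; fin_cases i <;> rfl
      have h3 : wedge (wedge α β) β v = 0 := DFunLike.congr_fun h2 v
      rw [hv, wedge_two_one (wedge α β)] at h3
      rw [hv, wedge_two_one a, wedge_two_one (a + c • wedge α β)]
      simp only [ContinuousAlternatingMap.add_apply, ContinuousAlternatingMap.smul_apply,
        smul_eq_mul]
      linear_combination (-c) * h3
    exact h1 (extD α x) (α x) (β x)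

end LCS

/-! ### Generalized contact pairs on mapping tori of contactomorphisms -/

section Invariant

variable {E : Type*} [NormedAddCommGroup E] [NormedSpace ℝ E] [FiniteDimensional ℝ E]
  {H : Type*} [TopologicalSpace H] {I : ModelWithCorners ℝ E H}
  {F : Type*} [TopologicalSpace F] [ChartedSpace H F] [I.Boundaryless] [IsManifold I ∞ F]
  {a : DForm I F 1}

/-- `ψ` scales the one-form `a` by a positive smooth function. -/
def IsConformalMap (a : DForm I F 1) (ψ : F → F) : Prop :=
  ContMDiff I I ∞ ψ ∧ ∃ f : F → ℝ, ContMDiff I 𝓘(ℝ, ℝ) ∞ f ∧ (∀ x, 0 < f x) ∧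
    ∀ x, pullback (I := I) ψ a x = f x • a x

theorem pullback_id {k : ℕ} (η : DForm I F k) : pullback (I := I) id η = η := by
  funext x
  refine ContinuousAlternatingMap.ext fun v => ?_
  rw [pullback_apply, mfderiv_id]
  rfl

theorem pullback_comp_eq_smul {ψ₁ ψ₂ : F → F} (h₁ : ContMDiff I I ∞ ψ₁) (h₂ : ContMDiff I I ∞ ψ₂)
    {f₁ f₂ : F → ℝ} (hf₁ : ∀ x, pullback (I := I) ψ₁ a x = f₁ x • a x)
    (hf₂ : ∀ x, pullback (I := I) ψ₂ a x = f₂ x • a x) (x : F) :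
    pullback (I := I) (ψ₁ ∘ ψ₂) a x = (f₁ (ψ₂ x) * f₂ x) • a x := by
  rw [← pullback_comp ψ₂ ψ₁ a (h₁.mdifferentiableAt (by simp)) (h₂.mdifferentiableAt (by simp)),
    mul_smul, ← hf₂]
  refine ContinuousAlternatingMap.ext fun v => ?_
  exact DFunLike.congr_fun (hf₁ (ψ₂ x)) fun i => mfderiv I I ψ₂ x (v i)

theorem IsConformalMap.comp {ψ₁ ψ₂ : F → F} (h₁ : IsConformalMap a ψ₁)
    (h₂ : IsConformalMap a ψ₂) : IsConformalMap a (ψ₁ ∘ ψ₂) := by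
  obtain ⟨hψ₁, f₁, hf₁, hp₁, he₁⟩ := h₁
  obtain ⟨hψ₂, f₂, hf₂, hp₂, he₂⟩ := h₂
  exact ⟨hψ₁.comp hψ₂, fun x => f₁ (ψ₂ x) * f₂ x, (hf₁.comp hψ₂).mul hf₂,
    fun x => mul_pos (hp₁ _) (hp₂ _), pullback_comp_eq_smul hψ₁ hψ₂ he₁ he₂⟩

theorem IsContactomorphism.isConformalMap {φ : F ≃ₘ⟮I, I⟯ F} (hφ : IsContactomorphism a φ) :
    IsConformalMap a φ := ⟨φ.contMDiff, hφ⟩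

theorem IsContactomorphism.isConformalMap_symm {φ : F ≃ₘ⟮I, I⟯ F} (hφ : IsContactomorphism a φ) :
    IsConformalMap a φ.symm := by
  obtain ⟨f, hf, hp, he⟩ := hφ
  refine ⟨φ.symm.contMDiff, fun x => (f (φ.symm x))⁻¹,
    fun x => ((hf.comp φ.symm.contMDiff) x).inv₀ (hp _).ne', fun x => inv_pos.2 (hp _),
    fun x => ?_⟩
  have h1 : pullback (I := I) (φ ∘ φ.symm) a x = a x := by
    have h2 : φ ∘ φ.symm = id := funext fun y => φ.apply_symm_apply y
    rw [h2, pullback_id]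
  rw [← pullback_comp φ.symm φ a (φ.contMDiff.mdifferentiableAt (by simp))
    (φ.symm.contMDiff.mdifferentiableAt (by simp))] at h1
  have h2 : pullback (I := I) φ.symm (pullback (I := I) φ a) x =
      f (φ.symm x) • pullback (I := I) φ.symm a x := by
    refine ContinuousAlternatingMap.ext fun v => ?_
    exact DFunLike.congr_fun (he (φ.symm x)) fun i => mfderiv I I φ.symm x (v i)
  rw [← h1, h2, inv_smul_smul₀ (hp _).ne']

theorem IsContactomorphism.isConformalMap_zpow {φ : F ≃ₘ⟮I, I⟯ F} (hφ : IsContactomorphism a φ)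
    (n : ℤ) : IsConformalMap a ⇑((φ.toEquiv : Equiv.Perm F) ^ n) := by
  induction n using Int.induction_on with
  | zero =>
    refine ⟨contMDiff_id, fun _ => 1, contMDiff_const, fun _ => one_pos, fun x => ?_⟩
    rw [one_smul]
    exact congrFun (pullback_id a) x
  | succ n ih =>
    rw [zpow_add_one, Equiv.Perm.coe_mul]
    exact ih.comp hφ.isConformalMap
  | pred n ih =>
    rw [zpow_sub_one, Equiv.Perm.coe_mul]
    exact ih.comp hφ.isConformalMap_symm

theorem locallyFinite_ball_int (X : Type*) [TopologicalSpace X] :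
    LocallyFinite fun n : ℤ => {z : X × ℝ | |z.2 - n| < 1} := by
  intro z
  refine ⟨{w | |w.2 - z.2| < 1}, (isOpen_lt (by fun_prop) continuous_const).mem_nhds (by simp), ?_⟩
  refine (finite_Icc (⌊z.2⌋ - 2) (⌊z.2⌋ + 3)).subset ?_
  rintro n ⟨w, hw1, hw2⟩
  have hw1 : |w.2 - n| < 1 := hw1
  have hw2 : |w.2 - z.2| < 1 := hw2
  rw [abs_lt] at hw1 hw2
  have h1 := Int.floor_le z.2
  have h2 := Int.lt_floor_add_one z.2
  constructor
  · have : ((⌊z.2⌋ - 2 : ℤ) : ℝ) ≤ n := by push_cast; linarith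
    exact_mod_cast this
  · have : (n : ℝ) ≤ ((⌊z.2⌋ + 3 : ℤ) : ℝ) := by push_cast; linarith
    exact_mod_cast this

/-- A positive function on `F × ℝ` that makes the pullback of `a` invariant. -/
theorem IsContactomorphism.exists_invariant_factor {φ : F ≃ₘ⟮I, I⟯ F}
    (hφ : IsContactomorphism a φ) (ha : ∀ x, a x ≠ 0) :
    ∃ (f : F → ℝ) (g : F × ℝ → ℝ), (∀ x, pullback (I := I) φ a x = f x • a x) ∧
      ContMDiff (I.prod 𝓘(ℝ, ℝ)) 𝓘(ℝ, ℝ) ∞ g ∧ (∀ z, 0 < g z) ∧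
      ∀ x t, g (φ x, t - 1) * f x = g (x, t) := by
  choose hψ f hf hp he using hφ.isConformalMap_zpow
  have hone : ∀ x, ((φ.toEquiv : Equiv.Perm F) ^ (1 : ℤ)) x = φ x := fun x => by
    rw [zpow_one]; rfl
  -- Since `a` vanishes nowhere, conformal factors are unique, so those of composites multiply as
  -- cocycles.
  have hcocycle : ∀ (n : ℤ) (x : F), f n (φ x) * f 1 x = f (n + 1) x := by
    intro n x
    refine smul_left_injective ℝ (ha x) ?_
    change (f n (φ x) * f 1 x) • a x = f (n + 1) x • a x
    rw [← he (n + 1), ← hone, ← pullback_comp_eq_smul (hψ n) (hψ 1) (he n) (he 1),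
      ← Equiv.Perm.coe_mul, ← zpow_add]
  -- Supported in [-1, 1] and positive on (-1, 1): every real is within 1/2 of an integer, so some
  -- translate is positive at it, and the translates are locally finite.
  let ρ : ContDiffBump (0 : ℝ) := ⟨1 / 2, 1, by norm_num, by norm_num⟩
  let G : ℤ → F × ℝ → ℝ := fun n z => ρ (z.2 - n) * f n z.1
  have hG0 : ∀ (n : ℤ) (z : F × ℝ), z ∉ {z : F × ℝ | |z.2 - n| < 1} → G n z = 0 := by
    intro n z hz
    have h1 : ρ (z.2 - n) = 0 := ρ.zero_of_le_dist (by
      rw [Real.dist_eq, sub_zero]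
      exact not_lt.1 hz)
    simp only [G, h1, zero_mul]
  have hsub : ∀ n, Function.support (G n) ⊆ {z : F × ℝ | |z.2 - n| < 1} := fun n z hz => by
    by_contra h
    exact hz (hG0 n z h)
  have hlf : LocallyFinite fun n => Function.support (G n) := (locallyFinite_ball_int F).subset hsub
  have hGs : ∀ n, ContMDiff (I.prod 𝓘(ℝ, ℝ)) 𝓘(ℝ, ℝ) ∞ (G n) := fun n =>
    ((ρ.contDiff.comp (contDiff_id.sub contDiff_const)).contMDiff.comp contMDiff_snd).mul
      ((hf n).comp contMDiff_fst)
  refine ⟨f 1, fun z => ∑ᶠ n, G n z, fun x => ?_, contMDiff_finsum hGs hlf, fun z => ?_,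
    fun x t => ?_⟩
  · rw [← he 1, zpow_one]
    rfl
  · refine finsum_pos (fun n => mul_nonneg ρ.nonneg (hp _ _).le) ⟨round z.2, ?_⟩ ?_
    · refine mul_pos (ρ.pos_of_mem_ball ?_) (hp _ _)
      rw [Metric.mem_ball, Real.dist_eq, sub_zero]
      exact (abs_sub_round z.2).trans_lt (by norm_num : (1 : ℝ) / 2 < 1)
    · exact hlf.point_finite z
  -- The `n`-th term at (φ x, t - 1), multiplied by the factor of φ, is the term n + 1 at (x, t);
  -- the sum is only reindexed.
  · rw [finsum_mul]
    refine Eq.trans (finsum_congr fun n => ?_) (finsum_comp_equiv (Equiv.addRight (1 : ℤ)))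
    simp only [G, Equiv.coe_addRight]
    rw [mul_assoc, hcocycle]
    push_cast
    rw [show t - 1 - (n : ℝ) = t - (n + 1) by ring]

/-- The deck group is generated by the transformation with n = 1. -/
theorem pullback_deck_eq {φ : F ≃ₘ⟮I, I⟯ F} {k : ℕ} {η : DForm (I.prod 𝓘(ℝ, ℝ)) (F × ℝ) k}
    (h1 : pullback (I := I.prod 𝓘(ℝ, ℝ)) (MappingTorus.deck φ 1) η = η) (n : ℤ) :
    pullback (I := I.prod 𝓘(ℝ, ℝ)) (MappingTorus.deck φ n) η = η := by
  have hadd : ∀ m n : ℤ, MappingTorus.deck φ (m + n) =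
      MappingTorus.deck φ m ∘ MappingTorus.deck φ n := by
    intro m n
    funext z
    refine Prod.ext ?_ ?_
    · change ((φ.toEquiv : Equiv.Perm F) ^ (m + n)) z.1 = _
      rw [zpow_add]
      rfl
    · change z.2 - ((m + n : ℤ) : ℝ) = z.2 - n - m
      push_cast
      ring
  have hcomp : ∀ m n : ℤ, pullback (I := I.prod 𝓘(ℝ, ℝ)) (MappingTorus.deck φ (m + n)) η =
      pullback (I := I.prod 𝓘(ℝ, ℝ)) (MappingTorus.deck φ n)
        (pullback (I := I.prod 𝓘(ℝ, ℝ)) (MappingTorus.deck φ m) η) := by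
    intro m n
    rw [hadd]
    exact funext fun z => (pullback_comp _ _ _
      ((MappingTorus.contMDiff_deck φ m).mdifferentiableAt (by simp))
      ((MappingTorus.contMDiff_deck φ n).mdifferentiableAt (by simp))).symm
  have h0 : pullback (I := I.prod 𝓘(ℝ, ℝ)) (MappingTorus.deck φ 0) η = η := by
    have : MappingTorus.deck φ 0 = id := by
      funext z
      refine Prod.ext ?_ ?_
      · change ((φ.toEquiv : Equiv.Perm F) ^ (0 : ℤ)) z.1 = _
        rw [zpow_zero]
        rfl
      · change z.2 - ((0 : ℤ) : ℝ) = z.2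
        simp
    rw [this, pullback_id]
  have hm1 : pullback (I := I.prod 𝓘(ℝ, ℝ)) (MappingTorus.deck φ (-1)) η = η := by
    have h2 := hcomp 1 (-1)
    rw [h1, add_neg_cancel, h0] at h2
    exact h2.symm
  induction n using Int.induction_on with
  | zero => exact h0
  | succ n ih => rw [hcomp, ih, h1]
  | pred n ih => rw [sub_eq_add_neg, hcomp, ih, hm1]

theorem isSmooth_dFun {g : F → ℝ} (hg : ContMDiff I 𝓘(ℝ, ℝ) ∞ g) : IsSmooth (dFun I g) :=
  isSmooth_of_forall_primitive fun _ => ⟨g, hg.contMDiffAt, Eventually.of_forall fun _ => rfl⟩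

theorem extD_dFun {g : F → ℝ} (hg : ContMDiff I 𝓘(ℝ, ℝ) ∞ g) : extD (dFun I g) = 0 :=
  extD_eq_zero_of_forall_primitive fun _ =>
    ⟨g, hg.contMDiffAt, Eventually.of_forall fun _ => rfl⟩

theorem pullback_dFun {E' : Type*} [NormedAddCommGroup E'] [NormedSpace ℝ E']
    {H' : Type*} [TopologicalSpace H'] {J : ModelWithCorners ℝ E' H'}
    {N : Type*} [TopologicalSpace N] [ChartedSpace H' N] {f : N → F} {g : F → ℝ}
    (hg : MDifferentiable I 𝓘(ℝ, ℝ) g) (hf : MDifferentiable J I f) :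
    pullback (I := J) f (dFun I g) = dFun J (g ∘ f) := by
  funext x
  refine ContinuousAlternatingMap.ext fun v => ?_
  exact (DFunLike.congr_fun (mfderiv_comp x (hg (f x)) (hf x)) (v 0)).symm

end Invariant

/-! ### The volume condition on slices, and descent to the mapping torus -/

section SliceVolume

variable {E : Type*} [NormedAddCommGroup E] [NormedSpace ℝ E] [FiniteDimensional ℝ E]
  {H : Type*} [TopologicalSpace H] {I : ModelWithCorners ℝ E H}
  {F : Type*} [TopologicalSpace F] [ChartedSpace H F] [I.Boundaryless] [IsManifold I ∞ F]
  {a : DForm I F 1}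

theorem IsContactForm.smul {h : ℕ} (ha : IsContactForm h a) {g : F → ℝ}
    (hg : ContMDiff I 𝓘(ℝ, ℝ) ∞ g) (hg0 : ∀ x, g x ≠ 0) :
    IsContactForm h (fun x => g x • a x : DForm I F 1) := by
  refine ⟨ha.finrank_eq, ha.smooth.smul hg, fun x => ?_⟩
  refine wedge_ne_zero_of_conformal (V := E) ha.finrank_eq (ha.volume x) (hg0 x) fun v w hv hw => ?_
  exact extD_smul_apply_of_ker ha.smooth hg x v w
    ((toFunctional_apply (V := E) (a x) v).symm.trans hv)
    ((toFunctional_apply (V := E) (a x) w).symm.trans hw)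

/-- On the slice of constant t, α is a nonvanishing multiple of a contact form and dt vanishes. As
dt is itself nonzero, wedging with it preserves nonvanishing. -/
theorem IsContactForm.volume_prod {h : ℕ} (ha : IsContactForm h a) {g : F × ℝ → ℝ}
    (hg : ContMDiff (I.prod 𝓘(ℝ, ℝ)) 𝓘(ℝ, ℝ) ∞ g) (hg0 : ∀ z, g z ≠ 0)
    {α : DForm (I.prod 𝓘(ℝ, ℝ)) (F × ℝ) 1}
    (hα : IsSmooth α)
    (hαg : ∀ z, α z = g z • pullback (I := I.prod 𝓘(ℝ, ℝ)) (Prod.fst : F × ℝ → F) a z) (z : F × ℝ) :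
    wedgeForm (wedgeForm α (wedgePowForm (extD α) h))
      (dFun (I.prod 𝓘(ℝ, ℝ)) (Prod.snd : F × ℝ → ℝ)) z ≠ 0 := by
  obtain ⟨x, t⟩ := z
  have hs : ContMDiff I (I.prod 𝓘(ℝ, ℝ)) ∞ fun y : F => (y, t) :=
    contMDiff_id.prodMk contMDiff_const
  have hsnd : ContMDiff (I.prod 𝓘(ℝ, ℝ)) 𝓘(ℝ, ℝ) ∞ (Prod.snd : F × ℝ → ℝ) := contMDiff_snd
  have h1 : pullback (I := I) (fun y : F => (y, t)) α = fun y => g (y, t) • a y := by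
    funext y
    have h2 : pullback (I := I) (fun y : F => (y, t))
        (pullback (I := I.prod 𝓘(ℝ, ℝ)) (Prod.fst : F × ℝ → F) a) y = a y :=
      (pullback_comp (fun y : F => (y, t)) (Prod.fst : F × ℝ → F) a
        (contMDiff_fst.mdifferentiableAt (n := ∞) (by simp))
        (hs.mdifferentiableAt (by simp))).trans (congrFun (pullback_id a) y)
    rw [← h2]
    refine ContinuousAlternatingMap.ext fun v => ?_
    exact DFunLike.congr_fun (hαg (y, t)) fun i => mfderiv I (I.prod 𝓘(ℝ, ℝ)) (fun y => (y, t)) y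
      (v i)
  have h2 : pullback (I := I) (fun y : F => (y, t))
      (dFun (I.prod 𝓘(ℝ, ℝ)) (Prod.snd : F × ℝ → ℝ)) = 0 := by
    rw [pullback_dFun (hsnd.mdifferentiable (by simp)) (hs.mdifferentiable (by simp))]
    funext y
    refine ContinuousAlternatingMap.ext fun v => ?_
    change mfderiv I 𝓘(ℝ, ℝ) (fun _ : F => t) y (v 0) = 0
    rw [mfderiv_const]
    rfl
  have hc := ha.smul (hg.comp hs) fun y => hg0 (y, t)
  refine wedge_ne_zero_of_comp_ne_zero (V := E × ℝ) (W := E)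
    (A := mfderiv I (I.prod 𝓘(ℝ, ℝ)) (fun y : F => (y, t)) x) ?_ ?_ ?_
  · intro h0
    have h3 := DFunLike.congr_fun h0 ((0 : E), (1 : ℝ))
    have h4 : mfderiv (I.prod 𝓘(ℝ, ℝ)) 𝓘(ℝ, ℝ) (Prod.snd : F × ℝ → ℝ) (x, t) ((0 : E), (1 : ℝ)) =
        0 := h3
    rw [mfderiv_snd] at h4
    exact (one_ne_zero : (1 : ℝ) ≠ 0) h4
  · intro w
    exact DFunLike.congr_fun (congrFun h2 x) fun _ => w
  · have h3 : pullback (I := I) (fun y : F => (y, t)) (wedgeForm α (wedgePowForm (extD α) h)) x ≠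
        0 := by
      rw [pullback_wedgeForm, pullback_wedgePowForm, ← extD_pullback hs hα, h1]
      exact hc.volume x
    exact h3

/-- The mapping torus of a contactomorphism has a generalized contact pair. -/
theorem IsContactForm.exists_isGeneralizedContactPair {h : ℕ} (ha : IsContactForm h a)
    {φ : F ≃ₘ⟮I, I⟯ F} (hφ : IsContactomorphism a φ) :
    ∃ α β : DForm (I.prod 𝓘(ℝ, ℝ)) (MappingTorus φ) 1, IsGeneralizedContactPair h α β := by
  obtain ⟨f, g, hf, hg, hg0, hfg⟩ := hφ.exists_invariant_factor ha.ne_zero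
  have hfst : ContMDiff (I.prod 𝓘(ℝ, ℝ)) I ∞ (Prod.fst : F × ℝ → F) := contMDiff_fst
  have hsnd : ContMDiff (I.prod 𝓘(ℝ, ℝ)) 𝓘(ℝ, ℝ) ∞ (Prod.snd : F × ℝ → ℝ) := contMDiff_snd
  -- The pair upstairs is (g·a, dt); the factor `g` compensates exactly for the conformal factor of
  -- φ.
  let α' : DForm (I.prod 𝓘(ℝ, ℝ)) (F × ℝ) 1 := fun z =>
    g z • pullback (I := I.prod 𝓘(ℝ, ℝ)) (Prod.fst : F × ℝ → F) a z
  let β' : DForm (I.prod 𝓘(ℝ, ℝ)) (F × ℝ) 1 := dFun (I.prod 𝓘(ℝ, ℝ)) (Prod.snd : F × ℝ → ℝ)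
  have hα' : IsSmooth α' := (ha.smooth.pullback hfst).smul hg
  have hd : ContMDiff (I.prod 𝓘(ℝ, ℝ)) (I.prod 𝓘(ℝ, ℝ)) ∞ (MappingTorus.deck φ 1) :=
    MappingTorus.contMDiff_deck φ 1
  have hdeck : ∀ z, MappingTorus.deck φ 1 z = (φ z.1, z.2 - 1) := fun z => by
    refine Prod.ext ?_ ?_
    · change ((φ.toEquiv : Equiv.Perm F) ^ (1 : ℤ)) z.1 = _
      rw [zpow_one]
      rfl
    · change z.2 - ((1 : ℤ) : ℝ) = z.2 - 1
      rw [Int.cast_one]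
  have hα1 : pullback (I := I.prod 𝓘(ℝ, ℝ)) (MappingTorus.deck φ 1) α' = α' := by
    funext z
    have h1 : pullback (I := I.prod 𝓘(ℝ, ℝ)) (MappingTorus.deck φ 1)
        (pullback (I := I.prod 𝓘(ℝ, ℝ)) (Prod.fst : F × ℝ → F) a) z =
        pullback (I := I.prod 𝓘(ℝ, ℝ)) (Prod.fst : F × ℝ → F) (pullback (I := I) φ a) z := by
      rw [pullback_comp _ _ a (hfst.mdifferentiableAt (by simp)) (hd.mdifferentiableAt (by simp)),
        pullback_comp _ _ a (φ.contMDiff.mdifferentiableAt (by simp))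
          (hfst.mdifferentiableAt (by simp))]
      have h2 : (Prod.fst : F × ℝ → F) ∘ MappingTorus.deck φ 1 = φ ∘ Prod.fst :=
        funext fun w => congrArg Prod.fst (hdeck w)
      rw [h2]
    have h2 : pullback (I := I.prod 𝓘(ℝ, ℝ)) (Prod.fst : F × ℝ → F) (pullback (I := I) φ a) z =
        f z.1 • pullback (I := I.prod 𝓘(ℝ, ℝ)) (Prod.fst : F × ℝ → F) a z := by
      refine ContinuousAlternatingMap.ext fun v => ?_
      exact DFunLike.congr_fun (hf z.1) fun i => mfderiv (I.prod 𝓘(ℝ, ℝ)) I Prod.fst z (v i)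
    have h3 : pullback (I := I.prod 𝓘(ℝ, ℝ)) (MappingTorus.deck φ 1) α' z =
        g (MappingTorus.deck φ 1 z) • pullback (I := I.prod 𝓘(ℝ, ℝ)) (MappingTorus.deck φ 1)
        (pullback (I := I.prod 𝓘(ℝ, ℝ)) (Prod.fst : F × ℝ → F) a) z := rfl
    rw [h3, h1, h2, smul_smul, hdeck, hfg]
  have hβ1 : pullback (I := I.prod 𝓘(ℝ, ℝ)) (MappingTorus.deck φ 1) β' = β' := by
    rw [pullback_dFun (hsnd.mdifferentiable (by simp)) (hd.mdifferentiable (by simp))]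
    have h1 : (Prod.snd : F × ℝ → ℝ) ∘ MappingTorus.deck φ 1 = fun z => z.2 - 1 :=
      funext fun w => congrArg Prod.snd (hdeck w)
    rw [h1]
    funext z
    refine ContinuousAlternatingMap.ext fun v => ?_
    change mfderiv (I.prod 𝓘(ℝ, ℝ)) 𝓘(ℝ, ℝ) (fun z : F × ℝ => z.2 - 1) z (v 0) =
      mfderiv (I.prod 𝓘(ℝ, ℝ)) 𝓘(ℝ, ℝ) (Prod.snd : F × ℝ → ℝ) z (v 0)
    have h2 : HasMFDerivAt (I.prod 𝓘(ℝ, ℝ)) 𝓘(ℝ, ℝ) (fun z : F × ℝ => z.2 - 1) z _ :=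
      ((hasDerivAt_id z.2).sub_const 1).hasFDerivAt.hasMFDerivAt.comp z (hasMFDerivAt_snd z)
    rw [h2.mfderiv, mfderiv_snd]
    exact mul_one (show E × ℝ from v 0).2
  obtain ⟨α, hα⟩ := MappingTorus.exists_pullback_mk_eq φ (pullback_deck_eq hα1)
  obtain ⟨β, hβ⟩ := MappingTorus.exists_pullback_mk_eq φ (pullback_deck_eq hβ1)
  have hmk := MappingTorus.contMDiff_mk φ
  have hmk' := MappingTorus.hasLocalSections_mk φ
  have hαs : IsSmooth α := hmk'.isSmooth hmk (by rw [hα]; exact hα')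
  have hβs : IsSmooth β := hmk'.isSmooth hmk (by rw [hβ]; exact isSmooth_dFun hsnd)
  refine ⟨α, β, ⟨?_, hαs, hβs, ?_, fun y => ?_⟩⟩
  · rw [Module.finrank_prod, ha.finrank_eq, Module.finrank_self]
  · refine hmk'.pullback_injective hmk ?_
    rw [← extD_pullback hmk hβs, hβ]
    exact extD_dFun hsnd
  · obtain ⟨z, rfl⟩ := MappingTorus.mk_surjective φ y
    intro h0
    refine ha.volume_prod hg (fun z => (hg0 z).ne') hα' (fun _ => rfl) z ?_
    have h1 : pullback (I := I.prod 𝓘(ℝ, ℝ)) (MappingTorus.mk φ)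
        (wedgeForm (wedgeForm α (wedgePowForm (extD α) h)) β) z = 0 := by
      refine ContinuousAlternatingMap.ext fun v => ?_
      exact DFunLike.congr_fun h0 fun i => mfderiv (I.prod 𝓘(ℝ, ℝ)) (I.prod 𝓘(ℝ, ℝ))
        (MappingTorus.mk φ) z (v i)
    rw [pullback_wedgeForm, pullback_wedgeForm, pullback_wedgePowForm, ← extD_pullback hmk hαs,
      hα, hβ] at h1
    exact h1

end SliceVolume

/-- Subtracting the integer part of t moves every class into the image of the compact set F × [0,
1]. -/
theorem MappingTorus.compactSpace {E : Type*} [NormedAddCommGroup E] [NormedSpace ℝ E]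
    {H : Type*} [TopologicalSpace H] {I : ModelWithCorners ℝ E H}
    {F : Type*} [TopologicalSpace F] [ChartedSpace H F] [IsManifold I ∞ F]
    [CompactSpace F] (φ : F ≃ₘ⟮I, I⟯ F) :
    CompactSpace (MappingTorus φ) := by
  have h1 : MappingTorus.mk φ '' (univ ×ˢ Icc (0 : ℝ) 1) = univ := by
    refine eq_univ_of_forall fun y => ?_
    obtain ⟨z, rfl⟩ := MappingTorus.mk_surjective φ y
    refine ⟨MappingTorus.deck φ ⌊z.2⌋ z, ⟨mem_univ _, ?_, ?_⟩, MappingTorus.mk_deck φ _ z⟩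
    · exact sub_nonneg.2 (Int.floor_le z.2)
    · change z.2 - (⌊z.2⌋ : ℝ) ≤ 1
      linarith [Int.lt_floor_add_one z.2]
  refine ⟨?_⟩
  rw [← h1]
  exact (isCompact_univ.prod isCompact_Icc).image (MappingTorus.isLocalHomeomorph_mk φ).continuous

end ContactPair

end

theorem mainTheorem3 (h : ℕ) :
    -- a closed manifold with a generalized contact pair fibers over the circle
    (∀ (M : Type u) [TopologicalSpace M] [ChartedSpace (EuclideanSpace ℝ (Fin (2 * h + 2))) M]
        [IsManifold (𝓡 (2 * h + 2)) ∞ M] [T2Space M] [CompactSpace M]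
        (α β : ContactPair.DForm (𝓡 (2 * h + 2)) M 1),
        ContactPair.IsGeneralizedContactPair h α β →
        ∃ (F : Type u) (_ : TopologicalSpace F)
          (_ : ChartedSpace (EuclideanSpace ℝ (Fin (2 * h + 1))) F)
          (_ : IsManifold (𝓡 (2 * h + 1)) ∞ F) (_ : T2Space F) (_ : CompactSpace F)
          (φ : F ≃ₘ⟮𝓡 (2 * h + 1), 𝓡 (2 * h + 1)⟯ F)
          (p : M → Circle)
          (Φ : M ≃ₘ⟮𝓡 (2 * h + 2), (𝓡 (2 * h + 1)).prod 𝓘(ℝ, ℝ)⟯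
            ContactPair.MappingTorus φ),
          -- `p` is a fiber bundle with fiber `F`
          ContactPair.IsSmoothFiberBundle (𝓡 (2 * h + 2)) (𝓡 1) (𝓡 (2 * h + 1)) F p ∧
          -- with monodromy `φ`
          (∀ y : M, ContactPair.MappingTorus.proj φ (Φ y) = p y) ∧
          -- `α` restricts to a contact form on every fiber
          (∀ t : ℝ, ContactPair.IsContactForm h
            (ContactPair.pullback (I := 𝓡 (2 * h + 1))
              (fun x : F => Φ.symm (ContactPair.MappingTorus.mk φ (x, t))) α)) ∧
          -- and `φ` is a contactomorphism of the fiber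
          ContactPair.IsContactomorphism
            (ContactPair.pullback (I := 𝓡 (2 * h + 1))
              (fun x : F => Φ.symm (ContactPair.MappingTorus.mk φ (x, 0))) α) φ) ∧
    -- every mapping torus of a contactomorphism has a generalized contact pair and lcs forms
    (∀ (F : Type u) [TopologicalSpace F] [ChartedSpace (EuclideanSpace ℝ (Fin (2 * h + 1))) F]
        [IsManifold (𝓡 (2 * h + 1)) ∞ F] [T2Space F]
        (a : ContactPair.DForm (𝓡 (2 * h + 1)) F 1)
        (φ : F ≃ₘ⟮𝓡 (2 * h + 1), 𝓡 (2 * h + 1)⟯ F),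
        ContactPair.IsContactForm h a → ContactPair.IsContactomorphism a φ →
        ∃ α β : ContactPair.DForm ((𝓡 (2 * h + 1)).prod 𝓘(ℝ, ℝ)) (ContactPair.MappingTorus φ) 1,
          ContactPair.IsGeneralizedContactPair h α β ∧
          (CompactSpace F → ∃ c₀ : ℝ, ∀ c : ℝ, c₀ ≤ c →
            ContactPair.IsLCSForm (ContactPair.extD α + c • ContactPair.wedgeForm α β) (c • β))) := by
  refine ⟨fun M _ _ _ _ _ α β hαβ => ContactPair.exists_mappingTorus hαβ,
    fun F _ _ _ _ a φ ha hφ => ?_⟩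
  obtain ⟨α, β, hαβ⟩ := ha.exists_isGeneralizedContactPair hφ
  refine ⟨α, β, hαβ, fun _ => ?_⟩
  have := ContactPair.MappingTorus.compactSpace φ
  exact hαβ.exists_isLCSForm
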